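/- **Setting.** Let $k_1,k_2,k_3\in\mathbb R$. On $\mathbb R[x_1,x_2,x_3]$ let $R_i$ be the substitution $x_i\mapsto -x_i$ and $T_i f=\partial f/\partial x_i+k_i\,(f-R_if)/x_i$ the Dunkl operators ($i=1,2,3$). Let $e_1,e_2,e_3$ act on $\mathbb C^2$ by the Pauli matrices $\sigma_1=\begin{pmatrix}0&1\\1&0\end{pmatrix}$, $\sigma_2=\begin{pmatrix}0&-\sqrt{-1}\\ \sqrt{-1}&0\end{pmatrix}$, $\sigma_3=\begin{pmatrix}1&0\\0&-1\end{pmatrix}$; put $\mathbf D=e_1\otimes T_1+e_2\otimes T_2+e_3\otimes T_3$ and $\mathscr M_n=\ker\big(\mathbf D|_{\mathbb C^2\otimes_{\mathbb R}\mathbb R[x_1,x_2,x_3]_n}\big)$, where the subscript $n$ denotes the homogeneous polynomials of degree $n$. The universal Bannai–Ito algebra $\mathfrak{BI}$ is the $\mathbb C$-algebra generated by $X,Y,Z$ subject to the relations that each of $\{X,Y\}-Z$, $\{Y,Z\}-X$, $\{Z,X\}-Y$ commutes with $X,Y,Z$, where $\{A,B\}=AB+BA$. It acts on $\mathscr M_n$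 by $$\begin{aligned} Xf&=\big(\sqrt{-1}\,e_1\otimes(x_3T_2-x_2T_3)\big)R_2R_3f+\tfrac12R_2R_3f+k_2R_3f+k_3R_2f,\\ Yf&=\big(\sqrt{-1}\,e_2\otimes(x_1T_3-x_3T_1)\big)R_3R_1f+\tfrac12R_3R_1f+k_3R_1f+k_1R_3f,\\ Zf&=\big(\sqrt{-1}\,e_3\otimes(x_2T_1-x_1T_2)\big)R_1R_2f+\tfrac12R_1R_2f+k_1R_2f+k_2R_1f. \end{aligned}$$ Let $t_i=-2k_i$ if $2k_i$ is an odd negative integer, and $t_i=\infty$ otherwise. Let $\mathscr M_n(x_j)$ be the $\mathfrak{BI}$-submodule $\mathscr M_n\cap\bigoplus_{i=t_j}^n\mathbb C^2\otimes\big(x_j^i\cdot\mathbb R[x_l:l\ne j]_{n-i}\big)$ of $\mathscr M_n$ (zero if $n<t_j$). For $a,b,c\in\mathbb C$ and even $d\ge 0$ let $O_d(a,b,c)$ be the $(d+1)$-dimensional $\mathfrak{BI}$-module with a basis $v_0,\dots,v_d$ such that $Xv_i=\theta_iv_i+v_{i+1}$, $Yv_i=\theta_i^*v_i+\varphi_iv_{i-1}$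 (with $v_{-1}=v_{d+1}=0$) and $\{X,Y\}-Z$ acts as the scalar $2ab-c(d+1)$, where $\theta_i=\frac{(-1)^i(2a-d+2i)}2$, $\theta_i^*=\frac{(-1)^i(2b-d+2i)}2$, and $\varphi_i=\frac{i(d+1-2i-2a-2b-2c)}2$ for even $i$, $\varphi_i=\frac{(i-d-1)(d+1-2i-2a-2b+2c)}2$ for odd $i$. For an automorphism $g$ of $\mathfrak{BI}$ and a module $V$, $V^g$ is $V$ with $u\in\mathfrak{BI}$ acting as $g(u)$. Let $\varepsilon$ be the automorphism $(X,Y,Z)\mapsto(-X,-Y,Z)$, let $\rho$ be the automorphism $X\mapsto Y\mapsto Z\mapsto X$ (the cycle $(1\,2\,3)$), so that $\rho^{-1}$ is $X\mapsto Z\mapsto Y\mapsto X$ (the cycle $(1\,3\,2)$). **Theorem.** Let $n$ be an odd positive integer, $h=\frac{n+1}2$ and $s=k_1+k_2+k_3$. (A) Suppose $t_2\le n<\min\{t_1,t_3\}$. Then $\mathscr M_n(x_2)$ is isomorphic to a direct sum of two copies of $V=O_{n-t_2}(k_3+h,\,-s-h,\,-k_1-h)^{\varepsilon}$, and $\mathscr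 M_n/\mathscr M_n(x_2)$ is isomorphic to a direct sum of two copies of $W=O_{t_2-1}(k_3,\,-s-n-1,\,k_1)$. If moreover $k_1,k_3\ge 0$, then $V$ and $W$ are irreducible and $V\cong O_{n-t_2}(-k_3-h,\,s+h,\,-k_1-h)$. (B) Suppose $t_3\le n<\min\{t_1,t_2\}$. Then $\mathscr M_n(x_3)$ is isomorphic to a direct sum of two copies of $V=O_{n-t_3}(k_1+h,\,-s-h,\,-k_2-h)^{\varepsilon\circ\rho^{-1}}$, and $\mathscr M_n/\mathscr M_n(x_3)$ is isomorphic to a direct sum of two copies of $W=O_{t_3-1}(k_1,\,-s-n-1,\,k_2)^{\rho^{-1}}$. If moreover $k_1,k_2\ge 0$, then $V$ and $W$ are irreducible, $V\cong O_{n-t_3}(-k_2-h,\,-k_1-h,\,s+h)$ and $W\cong O_{t_3-1}(k_2,\,k_1,\,-s-n-1)$. (C) Suppose $t_1\le n<\min\{t_2,t_3\}$. Then $\mathscr M_n(x_1)$ is isomorphic to a direct sum of two copies of $V=O_{n-t_1}(k_2+h,\,-s-h,\,-k_3-h)^{\varepsilon\circ\rho}$, and $\mathscr M_n/\mathscr M_n(x_1)$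 is isomorphic to a direct sum of two copies of $W=O_{t_1-1}(k_2,\,-s-n-1,\,k_3)^{\rho}$. If moreover $k_2,k_3\ge 0$, then $V$ and $W$ are irreducible, $V\cong O_{n-t_1}(s+h,\,-k_3-h,\,-k_2-h)$ and $W\cong O_{t_1-1}(-s-n-1,\,k_3,\,k_2)$. -/

import Mathlib

set_option linter.unusedSimpArgs false

open scoped TensorProduct

namespace BannaiIto

section Algebra

/-! The universal Bannai–Ito algebra. The generators `X, Y, Z` are indexed by `0, 1, 2`. -/

/-- The elements `{Y,Z} - X`, `{Z,X} - Y`, `{X,Y} - Z` (for `i = 0, 1, 2`) built from a triple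
`x = (X, Y, Z)` in a ring. -/
def cen {A : Type*} [Ring A] (x : Fin 3 → A) (i : Fin 3) : A :=
  x (i + 1) * x (i + 2) + x (i + 2) * x (i + 1) - x i

/-- The defining relations: each of `{X,Y} - Z`, `{Y,Z} - X`, `{Z,X} - Y` commutes with each of
`X, Y, Z`. -/
inductive BIRel : FreeAlgebra ℂ (Fin 3) → FreeAlgebra ℂ (Fin 3) → Prop
  | comm (i j : Fin 3) :
      BIRel (cen (FreeAlgebra.ι ℂ) i * FreeAlgebra.ι ℂ j) (FreeAlgebra.ι ℂ j * cen (FreeAlgebra.ι ℂ) i)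

/-- The universal Bannai–Ito algebra over `ℂ`, by generators and relations. -/
def BI : Type := RingQuot BIRel

noncomputable instance : Ring BI := inferInstanceAs (Ring (RingQuot BIRel))
noncomputable instance : Algebra ℂ BI := inferInstanceAs (Algebra ℂ (RingQuot BIRel))

namespace BI

/-- The generators `X = gen 0`, `Y = gen 1`, `Z = gen 2`. -/
noncomputable def gen (i : Fin 3) : BI := RingQuot.mkAlgHom ℂ BIRel (FreeAlgebra.ι ℂ i)

theorem mk_cen (i : Fin 3) :
    RingQuot.mkAlgHom ℂ BIRel (cen (FreeAlgebra.ι ℂ) i) = (cen gen i : BI) := by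
  simp only [cen, map_sub, map_add, map_mul]; rfl

theorem cen_comm (i j : Fin 3) : cen gen i * gen j = gen j * cen gen i := by
  have := RingQuot.mkAlgHom_rel ℂ (BIRel.comm i j)
  rw [map_mul, map_mul, mk_cen] at this
  exact this

/-- The universal property of the universal Bannai–Ito algebra. -/
noncomputable def lift {A : Type*} [Ring A] [Algebra ℂ A] (x : Fin 3 → A)
    (h : ∀ i j, cen x i * x j = x j * cen x i) : BI →ₐ[ℂ] A :=
  RingQuot.liftAlgHom ℂ ⟨FreeAlgebra.lift ℂ x, by
    rintro _ _ ⟨i, j⟩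
    simpa [cen] using h i j⟩

@[simp] theorem lift_gen {A : Type*} [Ring A] [Algebra ℂ A] (x : Fin 3 → A)
    (h : ∀ i j, cen x i * x j = x j * cen x i) (i : Fin 3) : lift x h (gen i) = x i := by
  simp only [lift, gen]
  exact (RingQuot.liftAlgHom_mkAlgHom_apply _ _ _ _).trans (by simp)

theorem hom_ext {A : Type*} [Ring A] [Algebra ℂ A] {f g : BI →ₐ[ℂ] A}
    (h : ∀ i, f (gen i) = g (gen i)) : f = g := by
  refine RingQuot.ringQuot_ext' ℂ f g (FreeAlgebra.hom_ext (funext h))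

theorem induction {p : BI → Prop} (algebraMap : ∀ c : ℂ, p (algebraMap ℂ BI c))
    (gen : ∀ i, p (gen i)) (add : ∀ a b, p a → p b → p (a + b))
    (mul : ∀ a b, p a → p b → p (a * b)) (b : BI) : p b := by
  obtain ⟨a, rfl⟩ := RingQuot.mkAlgHom_surjective ℂ BIRel b
  induction a using FreeAlgebra.induction with
  | grade0 c => rw [AlgHom.commutes]; exact algebraMap c
  | grade1 i => exact gen i
  | mul a b ha hb => rw [map_mul]; exact mul _ _ ha hb
  | add a b ha hb => rw [map_add]; exact add _ _ ha hb

/-- The signs by which `(ε₁, ε₂) ∈ {±1}²` multiplies `X, Y, Z`. -/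
def signs (ε : ℤˣ × ℤˣ) : Fin 3 → ℤˣ := ![ε.1, ε.2, ε.1 * ε.2]

theorem signs_mul (ε : ℤˣ × ℤˣ) (i : Fin 3) :
    signs ε (i + 1) * signs ε (i + 2) = signs ε i := by
  revert ε i; decide

/-- The algebra endomorphism `X ↦ ε₁ X`, `Y ↦ ε₂ Y`, `Z ↦ ε₁ ε₂ Z`. -/
noncomputable def signHom (ε : ℤˣ × ℤˣ) : BI →ₐ[ℂ] BI :=
  lift (fun i => ((signs ε i : ℤ) : ℂ) • gen i) fun i j => by
    have : cen (fun i => ((signs ε i : ℤ) : ℂ) • gen i) i = ((signs ε i : ℤ) : ℂ) • cen gen i := by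
      have h : ((signs ε (i + 1) : ℤ) : ℂ) * ((signs ε (i + 2) : ℤ) : ℂ) = ((signs ε i : ℤ) : ℂ) := by
        rw [← signs_mul ε i]; push_cast; rfl
      simp only [cen, smul_mul_smul_comm, smul_sub, smul_add, h, mul_comm ((signs ε (i + 2) : ℤ) : ℂ)]
    rw [this, smul_mul_smul_comm, smul_mul_smul_comm, cen_comm, mul_comm]

/-- The action of `{±1}²` on the universal Bannai–Ito algebra: `(1,-1)` is the automorphism
`(X,Y,Z) ↦ (X,-Y,-Z)` and `(-1,1)` is the automorphism `(X,Y,Z) ↦ (-X,Y,-Z)`. -/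
noncomputable def signAut (ε : ℤˣ × ℤˣ) : BI ≃ₐ[ℂ] BI :=
  have h : (signHom ε).comp (signHom ε) = AlgHom.id ℂ BI := hom_ext fun i => by
    have : ((signs ε i : ℤ) : ℂ) * ((signs ε i : ℤ) : ℂ) = 1 := by
      rcases Int.units_eq_one_or (signs ε i) with h | h <;> simp [h]
    simp [signHom, smul_smul, this]
  AlgEquiv.ofAlgHom (signHom ε) (signHom ε) h h

/-- The algebra endomorphism permuting the generators, `gen i ↦ gen (τ i)`. -/
noncomputable def permHom (τ : Equiv.Perm (Fin 3)) : BI →ₐ[ℂ] BI :=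
  lift (fun i => gen (τ i)) fun i j => by
    have key : ∀ (τ : Equiv.Perm (Fin 3)) (i : Fin 3),
        (τ (i + 1) = τ i + 1 ∧ τ (i + 2) = τ i + 2) ∨
        (τ (i + 1) = τ i + 2 ∧ τ (i + 2) = τ i + 1) := by decide
    have : cen (fun i => gen (τ i)) i = cen gen (τ i) := by
      rcases key τ i with h | h
      · simp only [cen, h]
      · simp only [cen, h, add_comm]
    rw [this, cen_comm]

/-- The action of the symmetric group of degree three on the universal Bannai–Ito algebra by
permutation of the generators: `(1 2)` swaps `X` and `Y`, and `(2 3)` swaps `Y` and `Z`. -/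
noncomputable def permAut (τ : Equiv.Perm (Fin 3)) : BI ≃ₐ[ℂ] BI :=
  AlgEquiv.ofAlgHom (permHom τ) (permHom τ⁻¹)
    (hom_ext fun i => by simp [permHom]) (hom_ext fun i => by simp [permHom])

/-- The action of `(ε, τ)` in the semidirect product of `{±1}²` and the symmetric group:
`u ↦ ε(τ(u))`. -/
noncomputable def aut (ε : ℤˣ × ℤˣ) (τ : Equiv.Perm (Fin 3)) : BI ≃ₐ[ℂ] BI :=
  (permAut τ).trans (signAut ε)

@[simp] theorem signAut_gen (ε : ℤˣ × ℤˣ) (i : Fin 3) :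
    signAut ε (gen i) = ((signs ε i : ℤ) : ℂ) • gen i := lift_gen _ _ i

@[simp] theorem permAut_gen (τ : Equiv.Perm (Fin 3)) (i : Fin 3) :
    permAut τ (gen i) = gen (τ i) := lift_gen _ _ i

theorem aut_gen (ε : ℤˣ × ℤˣ) (τ : Equiv.Perm (Fin 3)) (i : Fin 3) :
    aut ε τ (gen i) = ((signs ε (τ i) : ℤ) : ℂ) • gen (τ i) := by simp [aut]

end BI

/-- The twist `V^ε` of a module `V` by an automorphism `ε`: the same additive group, on which `x`
acts as `ε x` does on `V`. -/
def Twist (_ε : BI ≃ₐ[ℂ] BI) (V : Type*) : Type _ := V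

instance (ε : BI ≃ₐ[ℂ] BI) (V : Type*) [AddCommGroup V] : AddCommGroup (Twist ε V) :=
  inferInstanceAs (AddCommGroup V)

noncomputable instance (ε : BI ≃ₐ[ℂ] BI) (V : Type*) [AddCommGroup V] [Module BI V] :
    Module BI (Twist ε V) :=
  Module.compHom V (ε : BI →+* BI)

theorem Twist.smul_def (ε : BI ≃ₐ[ℂ] BI) (V : Type*) [AddCommGroup V] [Module BI V] (b : BI)
    (v : Twist ε V) : b • v = @HSMul.hSMul BI V V _ (ε b) v := rfl

end Algebra

section OddModules

/-! The `(d+1)`-dimensional modules `O_d(a,b,c)`, `d` even. -/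

/-- The scalars `θ_i = (-1)^i (2a - d + 2i) / 2`. -/
noncomputable def oddTheta (d : ℕ) (a : ℂ) (i : ℕ) : ℂ := (-1) ^ i * (2 * a - d + 2 * i) / 2

/-- The scalars `φ_i`. -/
noncomputable def oddPhi (d : ℕ) (a b c : ℂ) (i : ℕ) : ℂ :=
  if Even i then (i : ℂ) * (d + 1 - 2 * i - 2 * a - 2 * b - 2 * c) / 2
  else ((i : ℂ) - d - 1) * (d + 1 - 2 * i - 2 * a - 2 * b + 2 * c) / 2

/-- The matrix of `X`: diagonal entries `θ_0, …, θ_d` and subdiagonal entries `1`. -/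
noncomputable def oddX (d : ℕ) (a : ℂ) : Matrix (Fin (d + 1)) (Fin (d + 1)) ℂ :=
  Matrix.of fun i j =>
    if i = j then oddTheta d a i else if (i : ℕ) = j + 1 then 1 else 0

/-- The matrix of `Y`: diagonal entries `θ*_0, …, θ*_d` and superdiagonal entries
`φ_1, …, φ_d`. -/
noncomputable def oddY (d : ℕ) (a b c : ℂ) : Matrix (Fin (d + 1)) (Fin (d + 1)) ℂ :=
  Matrix.of fun i j =>
    if i = j then oddTheta d b i else if (j : ℕ) = i + 1 then oddPhi d a b c j else 0

/-- The matrix of `Z`, determined by the requirement that `{X,Y} - Z` acts as the scalar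
`2ab - c(d+1)`. -/
noncomputable def oddZ (d : ℕ) (a b c : ℂ) : Matrix (Fin (d + 1)) (Fin (d + 1)) ℂ :=
  oddX d a * oddY d a b c + oddY d a b c * oddX d a
    - (2 * a * b - c * (d + 1)) • (1 : Matrix (Fin (d + 1)) (Fin (d + 1)) ℂ)

/-! Verification of the relations, carried out on infinite sequences of coordinates. -/

noncomputable def seqX (d : ℕ) (a : ℂ) (F : ℕ → ℂ) : ℕ → ℂ
  | 0 => oddTheta d a 0 * F 0
  | i + 1 => oddTheta d a (i + 1) * F (i + 1) + F i

noncomputable def seqY (d : ℕ) (a b c : ℂ) (F : ℕ → ℂ) (i : ℕ) : ℂ :=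
  oddTheta d b i * F i + oddPhi d a b c (i + 1) * F (i + 1)

noncomputable def seqZ (d : ℕ) (a b c : ℂ) (F : ℕ → ℂ) (i : ℕ) : ℂ :=
  seqX d a (seqY d a b c F) i + seqY d a b c (seqX d a F) i - (2 * a * b - c * (d + 1)) * F i

theorem oddX_mulVec (d : ℕ) (a : ℂ) (F : ℕ → ℂ) :
    (oddX d a).mulVec (fun i => F i) = fun i : Fin (d + 1) => seqX d a F i := by
  ext ⟨i, hi⟩
  simp only [Matrix.mulVec, dotProduct, oddX, Matrix.of_apply, Fin.ext_iff]
  cases i with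
  | zero =>
    rw [Finset.sum_eq_single (⟨0, hi⟩ : Fin (d + 1))]
    · simp [seqX]
    · intro j _ hj
      have : (0 : ℕ) ≠ j := fun h => hj (Fin.ext h.symm)
      simp [this]
    · simp
  | succ i =>
    rw [Finset.sum_eq_add (⟨i + 1, hi⟩ : Fin (d + 1)) ⟨i, by omega⟩]
    · simp [seqX]
    · simp [Fin.ext_iff]
    · intro j _ hj
      have h1 : ¬ (i + 1 = (j : ℕ)) := fun h => hj.1 (Fin.ext h.symm)
      have h2 : ¬ (i + 1 = (j : ℕ) + 1) := fun h => hj.2 (Fin.ext (by simpa using h.symm))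
      simp only [h1, h2, if_false, zero_mul]
    · simp
    · simp

theorem oddPhi_last {d : ℕ} (hd : Even d) (a b c : ℂ) : oddPhi d a b c (d + 1) = 0 := by
  have : ¬ Even (d + 1) := by simpa [Nat.even_add_one] using hd
  simp [oddPhi, this]

theorem oddY_mulVec {d : ℕ} (hd : Even d) (a b c : ℂ) (F : ℕ → ℂ) :
    (oddY d a b c).mulVec (fun i => F i) = fun i : Fin (d + 1) => seqY d a b c F i := by
  ext ⟨i, hi⟩
  simp only [Matrix.mulVec, dotProduct, oddY, Matrix.of_apply, Fin.ext_iff, seqY]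
  by_cases h : i = d
  · subst h
    rw [oddPhi_last hd, Finset.sum_eq_single (⟨i, hi⟩ : Fin (i + 1))]
    · simp
    · intro j _ hj
      have h1 : i ≠ j := fun h => hj (Fin.ext h.symm)
      have h2 : (j : ℕ) ≠ i + 1 := by omega
      simp [h1, h2]
    · simp
  · rw [Finset.sum_eq_add (⟨i, hi⟩ : Fin (d + 1)) ⟨i + 1, by omega⟩]
    · simp
    · simp [Fin.ext_iff]
    · intro j _ hj
      have h1 : i ≠ j := fun h => hj.1 (Fin.ext h.symm)
      have h2 : (j : ℕ) ≠ i + 1 := fun h => hj.2 (Fin.ext h)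
      simp [h1, h2]
    · simp
    · simp

theorem oddZ_mulVec {d : ℕ} (hd : Even d) (a b c : ℂ) (F : ℕ → ℂ) :
    (oddZ d a b c).mulVec (fun i => F i) = fun i : Fin (d + 1) => seqZ d a b c F i := by
  simp only [oddZ, Matrix.sub_mulVec, Matrix.add_mulVec, ← Matrix.mulVec_mulVec, oddX_mulVec,
    oddY_mulVec hd, Matrix.smul_mulVec, Matrix.one_mulVec]
  rfl

theorem ext_mulVec {d : ℕ} {A B : Matrix (Fin (d + 1)) (Fin (d + 1)) ℂ}
    (h : ∀ F : ℕ → ℂ, A.mulVec (fun i => F i) = B.mulVec (fun i => F i)) : A = B := by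
  refine Matrix.ext_of_mulVec_single fun j => ?_
  have : (Pi.single j 1 : Fin (d + 1) → ℂ) =
      fun i : Fin (d + 1) => (fun m : ℕ => if m = j then (1 : ℂ) else 0) i := by
    ext i; simp [Pi.single_apply, Fin.ext_iff]
  rw [this]
  exact h fun m : ℕ => if m = j then (1 : ℂ) else 0

theorem seq_lambda (d : ℕ) (a b c : ℂ) (F : ℕ → ℂ) (i : ℕ) :
    seqY d a b c (seqZ d a b c F) i + seqZ d a b c (seqY d a b c F) i - seqX d a F i =
      (2 * b * c - a * (d + 1)) * F i := by
  rcases i with _ | _ | i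
  · simp [seqX, seqY, seqZ, oddTheta, oddPhi, Nat.even_add_one]
    ring
  · simp [seqX, seqY, seqZ, oddTheta, oddPhi, Nat.even_add_one]
    ring
  · rcases Nat.even_or_odd i with h | h
    · simp [seqX, seqY, seqZ, oddTheta, oddPhi, Nat.even_add_one, h, pow_succ, h.neg_one_pow]
      ring
    · have h' := Nat.not_even_iff_odd.2 h
      simp [seqX, seqY, seqZ, oddTheta, oddPhi, Nat.even_add_one, h, h', pow_succ, h.neg_one_pow]
      ring

theorem seq_mu (d : ℕ) (a b c : ℂ) (F : ℕ → ℂ) (i : ℕ) :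
    seqZ d a b c (seqX d a F) i + seqX d a (seqZ d a b c F) i - seqY d a b c F i =
      (2 * c * a - b * (d + 1)) * F i := by
  rcases i with _ | _ | i
  · simp [seqX, seqY, seqZ, oddTheta, oddPhi, Nat.even_add_one]
    ring
  · simp [seqX, seqY, seqZ, oddTheta, oddPhi, Nat.even_add_one]
    ring
  · rcases Nat.even_or_odd i with h | h
    · simp [seqX, seqY, seqZ, oddTheta, oddPhi, Nat.even_add_one, h, pow_succ, h.neg_one_pow]
      ring
    · have h' := Nat.not_even_iff_odd.2 h
      simp [seqX, seqY, seqZ, oddTheta, oddPhi, Nat.even_add_one, h, h', pow_succ, h.neg_one_pow]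
      ring

theorem odd_kappa (d : ℕ) (a b c : ℂ) :
    oddX d a * oddY d a b c + oddY d a b c * oddX d a - oddZ d a b c =
      (2 * a * b - c * (d + 1)) • (1 : Matrix (Fin (d + 1)) (Fin (d + 1)) ℂ) := by
  simp [oddZ]

theorem odd_lambda {d : ℕ} (hd : Even d) (a b c : ℂ) :
    oddY d a b c * oddZ d a b c + oddZ d a b c * oddY d a b c - oddX d a =
      (2 * b * c - a * (d + 1)) • (1 : Matrix (Fin (d + 1)) (Fin (d + 1)) ℂ) := by
  refine ext_mulVec fun F => ?_
  simp only [Matrix.sub_mulVec, Matrix.add_mulVec, ← Matrix.mulVec_mulVec, oddX_mulVec,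
    oddY_mulVec hd, oddZ_mulVec hd, Matrix.smul_mulVec, Matrix.one_mulVec]
  ext i
  exact seq_lambda d a b c F i

theorem odd_mu {d : ℕ} (hd : Even d) (a b c : ℂ) :
    oddZ d a b c * oddX d a + oddX d a * oddZ d a b c - oddY d a b c =
      (2 * c * a - b * (d + 1)) • (1 : Matrix (Fin (d + 1)) (Fin (d + 1)) ℂ) := by
  refine ext_mulVec fun F => ?_
  simp only [Matrix.sub_mulVec, Matrix.add_mulVec, ← Matrix.mulVec_mulVec, oddX_mulVec,
    oddY_mulVec hd, oddZ_mulVec hd, Matrix.smul_mulVec, Matrix.one_mulVec]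
  ext i
  exact seq_mu d a b c F i

/-- The matrix representation of the Bannai–Ito algebra underlying `O_d(a,b,c)`. -/
noncomputable def oddRep {d : ℕ} (hd : Even d) (a b c : ℂ) :
    BI →ₐ[ℂ] Matrix (Fin (d + 1)) (Fin (d + 1)) ℂ :=
  BI.lift ![oddX d a, oddY d a b c, oddZ d a b c] fun i j => by
    have h : ∃ s : ℂ, cen ![oddX d a, oddY d a b c, oddZ d a b c] i = s • 1 := by
      fin_cases i
      · exact ⟨_, odd_lambda hd a b c⟩
      · exact ⟨_, odd_mu hd a b c⟩
      · exact ⟨_, odd_kappa d a b c⟩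
    obtain ⟨s, hs⟩ := h
    rw [hs, smul_mul_assoc, mul_smul_comm, one_mul, mul_one]

/-- The module `O_d(a,b,c)` for even `d`: column vectors of length `d + 1`, on which `X`, `Y`, `Z`
act through the matrices above. -/
def OddModule (d : ℕ) (_hd : Even d) (_a _b _c : ℂ) : Type := Fin (d + 1) → ℂ

noncomputable instance (d : ℕ) (hd : Even d) (a b c : ℂ) : AddCommGroup (OddModule d hd a b c) :=
  inferInstanceAs (AddCommGroup (Fin (d + 1) → ℂ))

noncomputable instance (d : ℕ) (hd : Even d) (a b c : ℂ) : Module BI (OddModule d hd a b c) :=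
  Module.compHom (Fin (d + 1) → ℂ)
    ((Matrix.toLinAlgEquiv' (R := ℂ) (n := Fin (d + 1))).toAlgHom.comp
      (oddRep hd a b c)).toRingHom

theorem OddModule.gen_smul (d : ℕ) (hd : Even d) (a b c : ℂ) (i : Fin 3)
    (v : OddModule d hd a b c) :
    BI.gen i • v =
      (![oddX d a, oddY d a b c, oddZ d a b c] i).mulVec (v : Fin (d + 1) → ℂ) := by
  change (oddRep hd a b c (BI.gen i)).mulVec v = _
  rw [oddRep, BI.lift_gen]

end OddModules

section Polynomials

/-! Dunkl operators on real polynomials in `x_1, x_2, x_3`, indexed by `0, 1, 2`. -/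

open MvPolynomial

/-- The polynomial ring `ℝ[x_1,x_2,x_3]`. -/
abbrev Poly : Type := MvPolynomial (Fin 3) ℝ

/-- The operator replacing `x_i` by `-x_i`. -/
noncomputable def reflect (i : Fin 3) : Module.End ℝ Poly :=
  (aeval fun j => if j = i then -X j else X j).toLinearMap

/-- Multiplication by `x_i`. -/
noncomputable def mulX (i : Fin 3) : Module.End ℝ Poly := LinearMap.mulLeft ℝ (X i)

/-- The quotient on division by `x_i` (discarding the terms that `x_i` does not divide). -/
noncomputable def divX (i : Fin 3) : Module.End ℝ Poly where
  toFun f := f.divMonomial (Finsupp.single i 1)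
  map_add' f g := MvPolynomial.add_divMonomial f g _
  map_smul' c f := by ext; simp

/-- The Dunkl operator `T_i f = ∂f/∂x_i + k_i (f - f(…,-x_i,…)) / x_i`. The division is exact, see
`mulX_divX`. -/
noncomputable def dunkl (k : Fin 3 → ℝ) (i : Fin 3) : Module.End ℝ Poly :=
  (pderiv i).toLinearMap + k i • (divX i * (1 - reflect i))

/-- The eigenvalue in `T_i x_i^a = (a + (1 - (-1)^a) k_i) x_i^(a-1)`. -/
noncomputable def dunklCoeff (κ : ℝ) (a : ℕ) : ℝ := a + (1 - (-1) ^ a) * κ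

theorem end_ext {S T : Module.End ℝ Poly} (h : ∀ α, S (monomial α 1) = T (monomial α 1)) : S = T :=
  (basisMonomials (Fin 3) ℝ).ext (by simpa using h)

theorem reflect_monomial (i : Fin 3) (α : Fin 3 →₀ ℕ) (c : ℝ) :
    reflect i (monomial α c) = monomial α ((-1) ^ α i * c) := by
  have key : ∀ j, (if j = i then -X j else X j : Poly) = C (if j = i then (-1 : ℝ) else 1) * X j := by
    intro j; split_ifs <;> simp
  simp only [reflect, AlgHom.toLinearMap_apply, aeval_monomial, key, Finsupp.prod_fintype,
    pow_zero, implies_true, mul_pow, Finset.prod_mul_distrib]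
  rw [monomial_eq (a := (-1) ^ α i * c), Finsupp.prod_fintype _ _ (by simp)]
  fin_cases i <;> simp [Fin.prod_univ_three] <;> ring

theorem mulX_monomial (i : Fin 3) (α : Fin 3 →₀ ℕ) (c : ℝ) :
    mulX i (monomial α c) = monomial (α + Finsupp.single i 1) c := by
  simp [mulX, X, monomial_mul, add_comm]

theorem divX_monomial (i : Fin 3) (α : Fin 3 →₀ ℕ) (c : ℝ) (h : α i = 0 → c = 0) :
    divX i (monomial α c) = monomial (α - Finsupp.single i 1) c := by
  by_cases h0 : α i = 0
  · simp [h h0]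
  · have : monomial α c = monomial (Finsupp.single i 1) 1 * monomial (α - Finsupp.single i 1) c := by
      rw [monomial_mul, one_mul, add_tsub_cancel_of_le]
      simpa [Finsupp.single_le_iff] using Nat.one_le_iff_ne_zero.2 h0
    change (monomial α c).divMonomial _ = _
    rw [this, divMonomial_monomial_mul]

theorem sub_reflect_monomial (i : Fin 3) (α : Fin 3 →₀ ℕ) (c : ℝ) :
    monomial α c - reflect i (monomial α c) = monomial α ((1 - (-1) ^ α i) * c) := by
  rw [reflect_monomial, ← map_sub]; congr 1; ring

theorem monomial_congr {α β : Fin 3 →₀ ℕ} {c d : ℝ} (h : c = d) (h2 : c ≠ 0 → α = β) :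
    (monomial α c : Poly) = monomial β d := by
  subst h
  by_cases h0 : c = 0
  · simp [h0]
  · rw [h2 h0]

theorem tsub_add_single {i : Fin 3} {α : Fin 3 →₀ ℕ} (h : α i ≠ 0) :
    α - Finsupp.single i 1 + Finsupp.single i 1 = α :=
  tsub_add_cancel_of_le (by simpa [Finsupp.single_le_iff] using Nat.one_le_iff_ne_zero.2 h)

theorem mulX_divX (i : Fin 3) (f : Poly) :
    X i * divX i (f - reflect i f) = f - reflect i f := by
  have : mulX i * (divX i * (1 - reflect i)) = 1 - reflect i := by
    refine end_ext fun α => ?_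
    simp only [Module.End.mul_apply, LinearMap.sub_apply, Module.End.one_apply,
      sub_reflect_monomial]
    rw [divX_monomial _ _ _ (by intro h; simp [h]), mulX_monomial]
    exact monomial_congr rfl fun h => tsub_add_single fun h0 => h (by simp [h0])
  exact LinearMap.congr_fun this f

theorem dunkl_monomial (k : Fin 3 → ℝ) (i : Fin 3) (α : Fin 3 →₀ ℕ) (c : ℝ) :
    dunkl k i (monomial α c) =
      monomial (α - Finsupp.single i 1) (dunklCoeff (k i) (α i) * c) := by
  simp only [dunkl, LinearMap.add_apply, Derivation.coeFn_coe, pderiv_monomial,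
    LinearMap.smul_apply, Module.End.mul_apply, LinearMap.sub_apply, Module.End.one_apply,
    sub_reflect_monomial]
  rw [divX_monomial _ _ _ (by intro h; simp [h]), smul_monomial, ← map_add, dunklCoeff]
  congr 1; simp; ring

theorem dunklCoeff_zero (κ : ℝ) : dunklCoeff κ 0 = 0 := by simp [dunklCoeff]

theorem reflect_mulX (i j : Fin 3) (h : i ≠ j) : reflect i * mulX j = mulX j * reflect i := by
  refine end_ext fun α => ?_
  simp [reflect_monomial, mulX_monomial, Finsupp.single_apply, h.symm]

theorem reflect_mulX_self (i : Fin 3) : reflect i * mulX i = -(mulX i * reflect i) := by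
  refine end_ext fun α => ?_
  simp [reflect_monomial, mulX_monomial, Finsupp.single_apply, pow_succ]

theorem reflect_dunkl (k : Fin 3 → ℝ) (i j : Fin 3) (h : i ≠ j) :
    reflect i * dunkl k j = dunkl k j * reflect i := by
  refine end_ext fun α => ?_
  simp [reflect_monomial, dunkl_monomial, Finsupp.single_apply, h.symm, mul_comm]

theorem reflect_dunkl_self (k : Fin 3 → ℝ) (i : Fin 3) :
    reflect i * dunkl k i = -(dunkl k i * reflect i) := by
  refine end_ext fun α => ?_
  simp only [Module.End.mul_apply, LinearMap.neg_apply, reflect_monomial, dunkl_monomial, ← map_neg]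
  rcases h : α i with _ | a
  · simp [dunklCoeff_zero]
  · simp [h, pow_succ, mul_comm]

theorem reflect_comm (i j : Fin 3) : reflect i * reflect j = reflect j * reflect i := by
  refine end_ext fun α => ?_
  simp [reflect_monomial, mul_comm]

theorem reflect_sq (i : Fin 3) : reflect i * reflect i = 1 := by
  refine end_ext fun α => ?_
  simp [reflect_monomial, ← mul_pow]

theorem mulX_comm (i j : Fin 3) : mulX i * mulX j = mulX j * mulX i := by
  refine end_ext fun α => ?_
  simp [mulX_monomial, add_right_comm]

theorem dunkl_comm (k : Fin 3 → ℝ) (i j : Fin 3) :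
    dunkl k i * dunkl k j = dunkl k j * dunkl k i := by
  by_cases h : i = j
  · rw [h]
  refine end_ext fun α => ?_
  simp only [Module.End.mul_apply, dunkl_monomial]
  refine monomial_congr ?_ fun _ => tsub_right_comm
  simp [Finsupp.single_apply, h, Ne.symm h, mul_comm]

theorem dunkl_mulX (k : Fin 3 → ℝ) (i j : Fin 3) (h : i ≠ j) :
    dunkl k i * mulX j = mulX j * dunkl k i := by
  refine end_ext fun α => ?_
  simp only [Module.End.mul_apply, dunkl_monomial, mulX_monomial]
  refine monomial_congr (by simp [Finsupp.single_apply, Ne.symm h]) fun _ => ?_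
  ext m
  simp only [Finsupp.coe_tsub, Finsupp.coe_add, Pi.sub_apply, Pi.add_apply, Finsupp.single_apply]
  grind

theorem dunkl_mulX_self (k : Fin 3 → ℝ) (i : Fin 3) :
    dunkl k i * mulX i = mulX i * dunkl k i + 1 + (2 * k i) • reflect i := by
  refine end_ext fun α => ?_
  simp only [Module.End.mul_apply, LinearMap.add_apply, LinearMap.smul_apply, Module.End.one_apply,
    dunkl_monomial, mulX_monomial, reflect_monomial, smul_monomial]
  have : (monomial (α - Finsupp.single i 1 + Finsupp.single i 1) (dunklCoeff (k i) (α i) * 1) : Poly)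
      = monomial α (dunklCoeff (k i) (α i) * 1) :=
    monomial_congr rfl fun h => tsub_add_single fun h0 => h (by simp [h0, dunklCoeff_zero])
  rw [this, ← map_add, ← map_add]
  refine monomial_congr ?_ (by simp)
  simp [dunklCoeff, pow_succ]; ring

/-- The polynomials that are homogeneous of degree `n` in the variables other than `x_j`, and do
not involve `x_j`. -/
noncomputable def homogAway (j : Fin 3) (n : ℕ) : Submodule ℝ Poly :=
  homogeneousSubmodule (Fin 3) ℝ n ⊓ Subalgebra.toSubmodule (supported ℝ ({j}ᶜ : Set (Fin 3)))

/-- The subspace `⨁_{i=t}^n x_j^i · ℝ[the other two variables]_{n-i}`, which is zero if `n < t`. -/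
noncomputable def powSpace (j : Fin 3) (t : ℕ∞) (n : ℕ) : Submodule ℝ Poly :=
  ⨆ (i : ℕ) (_ : t ≤ i ∧ i ≤ n), (homogAway j (n - i)).map (LinearMap.mulLeft ℝ (X j ^ i))

end Polynomials

section CliffordDunkl

/-! The commutation relations of the operators `e_i ⊗ 1`, `1 ⊗ x_i`, `1 ⊗ T_i`, `1 ⊗ R_i`, and the
identities for the Bannai–Ito generators that follow from them. -/

open Complex

structure DCRel {A : Type*} [Ring A] [Algebra ℂ A] (e x t r : Fin 3 → A) (k : Fin 3 → ℂ) : Prop where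
  e_sq : ∀ i, e i * e i = 1
  e_up : ∀ i, e i * e (i + 1) = I • e (i + 2)
  e_down : ∀ i, e (i + 1) * e i = -(I • e (i + 2))
  xe : ∀ i j, x i * e j = e j * x i
  te : ∀ i j, t i * e j = e j * t i
  re : ∀ i j, r i * e j = e j * r i
  xx : ∀ i j, x i * x j = x j * x i
  tt : ∀ i j, t i * t j = t j * t i
  rr : ∀ i j, r i * r j = r j * r i
  r_sq : ∀ i, r i * r i = 1
  tx : ∀ i j, i ≠ j → t i * x j = x j * t i
  tx_self : ∀ i, t i * x i = x i * t i + 1 + (2 * k i) • r i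
  rx : ∀ i j, i ≠ j → r i * x j = x j * r i
  rx_self : ∀ i, r i * x i = -(x i * r i)
  rt : ∀ i j, i ≠ j → r i * t j = t j * r i
  rt_self : ∀ i, r i * t i = -(t i * r i)

theorem assoc_of {A : Type*} [Ring A] {a b c : A} (h : a * b = c) (d : A) :
    a * (b * d) = c * d := by
  rw [← mul_assoc, h]

def abstractDirac {A : Type*} [Ring A] (e t : Fin 3 → A) : A :=
  e 0 * t 0 + e 1 * t 1 + e 2 * t 2

theorem abstractDirac_rotate {A : Type*} [Ring A] (e t : Fin 3 → A) (s : Fin 3) :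
    abstractDirac (fun i => e (i + s)) (fun i => t (i + s)) = abstractDirac e t := by
  fin_cases s <;> simp [abstractDirac, show (1 : Fin 3) + 1 = 2 from rfl,
    show (1 : Fin 3) + 2 = 0 from rfl, show (2 : Fin 3) + 1 = 0 from rfl,
    show (2 : Fin 3) + 2 = 1 from rfl] <;> abel

section
variable {A : Type*} [Ring A] [Algebra ℂ A]

noncomputable def abstractGen (e x t r : Fin 3 → A) (k : Fin 3 → ℂ) (i : Fin 3) : A :=
  (I • e i) * ((x (i + 2) * t (i + 1) - x (i + 1) * t (i + 2)) * (r (i + 1) * r (i + 2))) +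
    ((1 / 2 : ℂ) • (r (i + 1) * r (i + 2)) + k (i + 1) • r (i + 2) + k (i + 2) • r (i + 1))

noncomputable def abstractGamma (e x t : Fin 3 → A) : A :=
  (1 / 2 : ℂ) • (abstractDirac e t * abstractDirac e x - abstractDirac e x * abstractDirac e t - 1)

variable {e x t r : Fin 3 → A} {k : Fin 3 → ℂ}

theorem abstractGen_rotate (e x t r : Fin 3 → A) (k : Fin 3 → ℂ) (i s : Fin 3) :
    abstractGen (fun i => e (i + s)) (fun i => x (i + s)) (fun i => t (i + s)) (fun i => r (i + s))
      (fun i => k (i + s)) i = abstractGen e x t r k (i + s) := by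
  simp only [abstractGen, add_right_comm i s 1, add_right_comm i s 2]

namespace DCRel

theorem rotate (h : DCRel e x t r k) (s : Fin 3) :
    DCRel (fun i => e (i + s)) (fun i => x (i + s)) (fun i => t (i + s)) (fun i => r (i + s))
      (fun i => k (i + s)) where
  e_sq i := h.e_sq _
  e_up i := by
    have := h.e_up (i + s); rwa [add_right_comm i s 1, add_right_comm i s 2] at this
  e_down i := by
    have := h.e_down (i + s); rwa [add_right_comm i s 1, add_right_comm i s 2] at this
  xe i j := h.xe _ _
  te i j := h.te _ _
  re i j := h.re _ _
  xx i j := h.xx _ _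
  tt i j := h.tt _ _
  rr i j := h.rr _ _
  r_sq i := h.r_sq _
  tx i j hij := h.tx _ _ (by simpa using hij)
  tx_self i := h.tx_self _
  rx i j hij := h.rx _ _ (by simpa using hij)
  rx_self i := h.rx_self _
  rt i j hij := h.rt _ _ (by simpa using hij)
  rt_self i := h.rt_self _

theorem basic (h : DCRel e x t r k) :
    abstractDirac e t * abstractGen e x t r k 0 = abstractGen e x t r k 0 * abstractDirac e t ∧
    abstractDirac e x * abstractGen e x t r k 0 = abstractGen e x t r k 0 * abstractDirac e x ∧
    r 0 * (r 1 * r 2) * abstractGen e x t r k 0 = abstractGen e x t r k 0 * (r 0 * (r 1 * r 2)) ∧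
    abstractGen e x t r k 0 * abstractGen e x t r k 1 +
        abstractGen e x t r k 1 * abstractGen e x t r k 0 - abstractGen e x t r k 2 =
      (2 * k 0 * k 1) • 1 + (2 * k 2) • (abstractGamma e x t * (r 0 * (r 1 * r 2))) := by
  obtain ⟨e_sq, e_up, e_down, xe, te, re, xx, tt, rr, r_sq, tx, tx_self, rx, rx_self, rt, rt_self⟩ :=
    h
  have e01 := e_up 0
  have e12 := e_up 1
  have e20 := e_up 2
  have e10 := e_down 0
  have e21 := e_down 1
  have e02 := e_down 2
  have x10 := xx 1 0
  have x20 := xx 2 0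
  have x21 := xx 2 1
  have t10 := tt 1 0
  have t20 := tt 2 0
  have t21 := tt 2 1
  have r10 := rr 1 0
  have r20 := rr 2 0
  have r21 := rr 2 1
  have tx01 := tx 0 1 (by decide)
  have tx02 := tx 0 2 (by decide)
  have tx10 := tx 1 0 (by decide)
  have tx12 := tx 1 2 (by decide)
  have tx20 := tx 2 0 (by decide)
  have tx21 := tx 2 1 (by decide)
  have rx01 := rx 0 1 (by decide)
  have rx02 := rx 0 2 (by decide)
  have rx10 := rx 1 0 (by decide)
  have rx12 := rx 1 2 (by decide)
  have rx20 := rx 2 0 (by decide)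
  have rx21 := rx 2 1 (by decide)
  have rt01 := rt 0 1 (by decide)
  have rt02 := rt 0 2 (by decide)
  have rt10 := rt 1 0 (by decide)
  have rt12 := rt 1 2 (by decide)
  have rt20 := rt 2 0 (by decide)
  have rt21 := rt 2 1 (by decide)
  clear e_up e_down xx tt rr tx rx rt
  simp only [show (0 : Fin 3) + 1 = 1 from rfl, show (0 : Fin 3) + 2 = 2 from rfl,
    show (1 : Fin 3) + 1 = 2 from rfl, show (1 : Fin 3) + 2 = 0 from rfl,
    show (2 : Fin 3) + 1 = 0 from rfl, show (2 : Fin 3) + 2 = 1 from rfl] at *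
  refine ⟨?_, ?_, ?_, ?_⟩ <;>
  · simp only [abstractGen, abstractDirac, abstractGamma,
      show (0 : Fin 3) + 1 = 1 from rfl, show (0 : Fin 3) + 2 = 2 from rfl,
      show (1 : Fin 3) + 1 = 2 from rfl, show (1 : Fin 3) + 2 = 0 from rfl,
      show (2 : Fin 3) + 1 = 0 from rfl, show (2 : Fin 3) + 2 = 1 from rfl]
    simp only [mul_add, add_mul, mul_sub, sub_mul, smul_mul_assoc, mul_smul_comm, mul_assoc,
      mul_one, one_mul, neg_mul, mul_neg, smul_add, smul_sub, smul_neg, smul_smul, neg_neg,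
      e_sq, e01, e12, e20, e10, e21, e02, xe, te, re, x10, x20, x21, t10, t20, t21, r10, r20, r21,
      r_sq, tx01, tx02, tx10, tx12, tx20, tx21, tx_self, rx01, rx02, rx10, rx12, rx20, rx21,
      rx_self, rt01, rt02, rt10, rt12, rt20, rt21, rt_self,
      assoc_of (e_sq _), assoc_of e01, assoc_of e12, assoc_of e20, assoc_of e10, assoc_of e21,
      assoc_of e02, assoc_of (xe _ _), assoc_of (te _ _), assoc_of (re _ _), assoc_of x10,
      assoc_of x20, assoc_of x21, assoc_of t10, assoc_of t20, assoc_of t21, assoc_of r10,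
      assoc_of r20, assoc_of r21, assoc_of (r_sq _), assoc_of tx01, assoc_of tx02, assoc_of tx10,
      assoc_of tx12, assoc_of tx20, assoc_of tx21, assoc_of (tx_self _), assoc_of rx01,
      assoc_of rx02, assoc_of rx10, assoc_of rx12, assoc_of rx20, assoc_of rx21,
      assoc_of (rx_self _), assoc_of rt01, assoc_of rt02, assoc_of rt10, assoc_of rt12,
      assoc_of rt20, assoc_of rt21, assoc_of (rt_self _)]
    all_goals
      match_scalars <;>
        first
        | ring1
        | (ring_nf
           simp only [I_sq, I_pow_three, I_pow_four]
           ring1)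

theorem dirac_comm (h : DCRel e x t r k) (i : Fin 3) :
    abstractDirac e t * abstractGen e x t r k i = abstractGen e x t r k i * abstractDirac e t := by
  have := (h.rotate i).basic.1
  simpa only [abstractDirac_rotate, abstractGen_rotate, zero_add] using this

theorem vec_comm (h : DCRel e x t r k) (i : Fin 3) :
    abstractDirac e x * abstractGen e x t r k i = abstractGen e x t r k i * abstractDirac e x := by
  have := (h.rotate i).basic.2.1
  simpa only [abstractDirac_rotate, abstractGen_rotate, zero_add] using this

theorem rrr_rotate (h : DCRel e x t r k) (i : Fin 3) :
    r (0 + i) * (r (1 + i) * r (2 + i)) = r 0 * (r 1 * r 2) := by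
  fin_cases i
  · rfl
  · change r 1 * (r 2 * r 0) = r 0 * (r 1 * r 2)
    rw [h.rr 2 0, ← mul_assoc, h.rr 1 0, mul_assoc]
  · change r 2 * (r 0 * r 1) = r 0 * (r 1 * r 2)
    rw [← mul_assoc, h.rr 2 0, mul_assoc, h.rr 2 1]

theorem rrr_comm (h : DCRel e x t r k) (i : Fin 3) :
    r 0 * (r 1 * r 2) * abstractGen e x t r k i =
      abstractGen e x t r k i * (r 0 * (r 1 * r 2)) := by
  have := (h.rotate i).basic.2.2.1
  rw [h.rrr_rotate i] at this
  simpa only [abstractGen_rotate, zero_add] using this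

theorem cen_eq (h : DCRel e x t r k) (i : Fin 3) :
    cen (abstractGen e x t r k) i = (2 * k (i + 1) * k (i + 2)) • 1 +
      (2 * k i) • (abstractGamma e x t * (r 0 * (r 1 * r 2))) := by
  have := (h.rotate (i + 1)).basic.2.2.2
  rw [h.rrr_rotate (i + 1)] at this
  simp only [abstractGen_rotate, abstractGamma, abstractDirac_rotate, zero_add] at this
  have h1 : ∀ i : Fin 3, 1 + (i + 1) = i + 2 := by decide
  have h2 : ∀ i : Fin 3, 2 + (i + 1) = i := by decide
  rw [h1, h2] at this
  exact this

theorem cen_comm (h : DCRel e x t r k) (i j : Fin 3) :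
    cen (abstractGen e x t r k) i * abstractGen e x t r k j =
      abstractGen e x t r k j * cen (abstractGen e x t r k) i := by
  have hΓ : abstractGamma e x t * abstractGen e x t r k j =
      abstractGen e x t r k j * abstractGamma e x t := by
    have h1 := h.dirac_comm j
    have h2 := h.vec_comm j
    simp only [abstractGamma, smul_mul_assoc, mul_smul_comm, sub_mul, mul_sub, one_mul, mul_one]
    rw [mul_assoc, h2, ← mul_assoc, h1, mul_assoc, mul_assoc (abstractDirac e x), h1,
      ← mul_assoc (abstractDirac e x), h2, mul_assoc (abstractGen e x t r k j)]
  rw [h.cen_eq]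
  simp only [add_mul, mul_add, smul_mul_assoc, mul_smul_comm, one_mul, mul_one]
  rw [mul_assoc (abstractGamma e x t), h.rrr_comm, ← mul_assoc (abstractGamma e x t), hΓ,
    mul_assoc (abstractGen e x t r k j)]

end DCRel
end

end CliffordDunkl

section Spinors

/-! Spinor-valued polynomials, the Dirac–Dunkl operator and its polynomial null solutions. -/

open Complex MvPolynomial

/-- The Pauli matrices `σ_1, σ_2, σ_3`, through which the Clifford generators `e_1, e_2, e_3` act
on `ℂ²`. -/
noncomputable def pauli : Fin 3 → Matrix (Fin 2) (Fin 2) ℂ :=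
  ![!![0, 1; 1, 0], !![0, -I; I, 0], !![1, 0; 0, -1]]

/-- `ℂ² ⊗ ℝ[x_1,x_2,x_3]` (tensor product over `ℝ`), a complex vector space through the left
factor. -/
def Spinor : Type := (Fin 2 → ℂ) ⊗[ℝ] Poly

noncomputable instance : AddCommGroup Spinor :=
  inferInstanceAs (AddCommGroup ((Fin 2 → ℂ) ⊗[ℝ] Poly))

noncomputable instance : Module ℂ Spinor :=
  inferInstanceAs (Module ℂ ((Fin 2 → ℂ) ⊗[ℝ] Poly))

/-- The pure tensor `v ⊗ p`. -/
noncomputable def pureTensor (v : Fin 2 → ℂ) (p : Poly) : Spinor := v ⊗ₜ[ℝ] p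

/-- The operator `A ⊗ S` on `ℂ² ⊗ ℝ[x_1,x_2,x_3]`. -/
noncomputable def op (A : Matrix (Fin 2) (Fin 2) ℂ) (S : Module.End ℝ Poly) : Module.End ℂ Spinor :=
  (TensorProduct.AlgebraTensorModule.map (Matrix.toLin' A) S :
    (Fin 2 → ℂ) ⊗[ℝ] Poly →ₗ[ℂ] (Fin 2 → ℂ) ⊗[ℝ] Poly)

/-- The Dirac–Dunkl operator `D = e_1 ⊗ T_1 + e_2 ⊗ T_2 + e_3 ⊗ T_3`. -/
noncomputable def diracDunkl (k : Fin 3 → ℝ) : Module.End ℂ Spinor :=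
  op (pauli 0) (dunkl k 0) + op (pauli 1) (dunkl k 1) + op (pauli 2) (dunkl k 2)

/-- The operators by which `X`, `Y`, `Z` (`i = 0, 1, 2`) act. With `(p,q,r)` the cyclic
rearrangement of `(1,2,3)` that starts with the index of `i`, the operator sends `f` to
`(√-1 e_p ⊗ (x_r T_q - x_q T_r)) R_q R_r f + (1/2) R_q R_r f + k_q R_r f + k_r R_q f`,
where `R_q` replaces `x_q` by `-x_q`. -/
noncomputable def genOp (k : Fin 3 → ℝ) (i : Fin 3) : Module.End ℂ Spinor :=
  op (I • pauli i)
      ((mulX (i + 2) * dunkl k (i + 1) - mulX (i + 1) * dunkl k (i + 2)) *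
        (reflect (i + 1) * reflect (i + 2))) +
    op 1 ((1 / 2 : ℝ) • (reflect (i + 1) * reflect (i + 2)) + k (i + 1) • reflect (i + 2) +
      k (i + 2) • reflect (i + 1))

/-- The complex subspace `ℂ² ⊗ W` of `ℂ² ⊗ ℝ[x_1,x_2,x_3]`. -/
noncomputable def tens (W : Submodule ℝ Poly) : Submodule ℂ Spinor :=
  Submodule.span ℂ {z | ∃ v : Fin 2 → ℂ, ∃ p ∈ W, z = pureTensor v p}

/-- The space `M_n` of Dunkl monogenics of degree `n`, as a complex subspace: the kernel of the
Dirac–Dunkl operator on `ℂ² ⊗ ℝ[x_1,x_2,x_3]_n`. -/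
noncomputable def monogenics (k : Fin 3 → ℝ) (n : ℕ) : Submodule ℂ Spinor :=
  LinearMap.ker (diracDunkl k) ⊓ tens (homogeneousSubmodule (Fin 3) ℝ n)

/-- `t = -2κ` if `2κ` is an odd negative integer, and `t = ∞` otherwise. -/
noncomputable def threshold (κ : ℝ) : ℕ∞ :=
  open Classical in
  if ∃ m : ℕ, Odd m ∧ 2 * κ = -(m : ℝ) then ((⌊-(2 * κ)⌋₊ : ℕ) : ℕ∞) else ⊤

theorem threshold_eq_coe_iff (κ : ℝ) (t : ℕ) :
    threshold κ = t ↔ Odd t ∧ 2 * κ = -(t : ℝ) := by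
  unfold threshold
  constructor
  · intro h
    split_ifs at h with h'
    · obtain ⟨m, hm, hκ⟩ := h'
      have : m = t := by simpa [hκ] using h
      exact this ▸ ⟨hm, hκ⟩
    · simp at h
  · rintro ⟨h, hκ⟩
    rw [if_pos ⟨t, h, hκ⟩]
    simp [hκ]

theorem even_sub_of_threshold {κ : ℝ} {t n : ℕ} (ht : threshold κ = t) (hn : Odd n) :
    Even (n - t) :=
  Nat.Odd.sub_odd hn ((threshold_eq_coe_iff κ t).1 ht).1

theorem even_pred_of_threshold {κ : ℝ} {t : ℕ} (ht : threshold κ = t) : Even (t - 1) :=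
  Nat.Odd.sub_odd ((threshold_eq_coe_iff κ t).1 ht).1 odd_one

theorem op_pure (A : Matrix (Fin 2) (Fin 2) ℂ) (S : Module.End ℝ Poly) (v : Fin 2 → ℂ) (p : Poly) :
    op A S (pureTensor v p) = pureTensor (A.mulVec v) (S p) := by
  simp only [op, pureTensor]
  exact TensorProduct.AlgebraTensorModule.map_tmul _ _ _ _

theorem pure_add (v : Fin 2 → ℂ) (p q : Poly) :
    pureTensor v (p + q) = pureTensor v p + pureTensor v q :=
  TensorProduct.tmul_add v p q

theorem pure_neg (v : Fin 2 → ℂ) (p : Poly) : pureTensor v (-p) = -pureTensor v p :=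
  TensorProduct.tmul_neg v p

theorem smul_pure (c : ℂ) (v : Fin 2 → ℂ) (p : Poly) :
    c • pureTensor v p = pureTensor (c • v) p :=
  TensorProduct.smul_tmul' c v p

theorem pure_smul (c : ℝ) (v : Fin 2 → ℂ) (p : Poly) :
    pureTensor v (c • p) = (c : ℂ) • pureTensor v p := by
  rw [smul_pure, Complex.coe_smul]
  exact (TensorProduct.smul_tmul c v p).symm

theorem op_ext {S T : Module.End ℂ Spinor}
    (h : ∀ v p, S (pureTensor v p) = T (pureTensor v p)) : S = T := by
  refine LinearMap.ext fun z => ?_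
  refine TensorProduct.induction_on (motive := fun z => S z = T z) z ?_ h ?_
  · exact (map_zero S).trans (map_zero T).symm
  · intro x y hx hy
    exact (map_add S x y).trans ((congrArg₂ _ hx hy).trans (map_add T x y).symm)

theorem op_mul (A B : Matrix (Fin 2) (Fin 2) ℂ) (S T : Module.End ℝ Poly) :
    op A S * op B T = op (A * B) (S * T) :=
  op_ext fun v p => by
    simp only [Module.End.mul_apply, op_pure, Matrix.mulVec_mulVec]

theorem op_add (A : Matrix (Fin 2) (Fin 2) ℂ) (S T : Module.End ℝ Poly) :
    op A (S + T) = op A S + op A T :=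
  op_ext fun v p => by simp only [op_pure, LinearMap.add_apply, pure_add]

theorem op_neg (A : Matrix (Fin 2) (Fin 2) ℂ) (S : Module.End ℝ Poly) : op A (-S) = -op A S :=
  op_ext fun v p => by simp only [op_pure, LinearMap.neg_apply, pure_neg]

theorem op_sub (A : Matrix (Fin 2) (Fin 2) ℂ) (S T : Module.End ℝ Poly) :
    op A (S - T) = op A S - op A T := by
  rw [sub_eq_add_neg, op_add, op_neg, sub_eq_add_neg]

theorem op_smul_left (c : ℂ) (A : Matrix (Fin 2) (Fin 2) ℂ) (S : Module.End ℝ Poly) :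
    op (c • A) S = c • op A S :=
  op_ext fun v p => by
    simp only [op_pure, LinearMap.smul_apply, Matrix.smul_mulVec, smul_pure]

theorem op_smul (c : ℝ) (A : Matrix (Fin 2) (Fin 2) ℂ) (S : Module.End ℝ Poly) :
    op A (c • S) = (c : ℂ) • op A S :=
  op_ext fun v p => by simp only [op_pure, LinearMap.smul_apply, pure_smul]

theorem op_one : op 1 1 = 1 :=
  op_ext fun v p => by simp only [op_pure, Matrix.one_mulVec, Module.End.one_apply]

theorem dcRel (k : Fin 3 → ℝ) :
    DCRel (fun i => op (pauli i) 1) (fun i => op 1 (mulX i)) (fun i => op 1 (dunkl k i))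
      (fun i => op 1 (reflect i)) (fun i => (k i : ℂ)) where
  e_sq i := by
    have : pauli i * pauli i = 1 := by
      fin_cases i <;> ext a b <;> fin_cases a <;> fin_cases b <;> simp [pauli]
    rw [op_mul, this, one_mul, op_one]
  e_up i := by
    have : pauli i * pauli (i + 1) = I • pauli (i + 2) := by
      fin_cases i <;> ext a b <;> fin_cases a <;> fin_cases b <;> simp [pauli]
    rw [op_mul, this, one_mul, op_smul_left]
  e_down i := by
    have : pauli (i + 1) * pauli i = (-I) • pauli (i + 2) := by
      fin_cases i <;> ext a b <;> fin_cases a <;> fin_cases b <;> simp [pauli]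
    rw [op_mul, this, one_mul, op_smul_left, neg_smul]
  xe i j := by simp only [op_mul, one_mul, mul_one]
  te i j := by simp only [op_mul, one_mul, mul_one]
  re i j := by simp only [op_mul, one_mul, mul_one]
  xx i j := by simp only [op_mul, mulX_comm i j]
  tt i j := by simp only [op_mul, dunkl_comm k i j]
  rr i j := by simp only [op_mul, reflect_comm i j]
  r_sq i := by simp only [op_mul, reflect_sq i, one_mul, op_one]
  tx i j h := by simp only [op_mul, dunkl_mulX k i j h]
  tx_self i := by
    simp only [op_mul, dunkl_mulX_self, op_add, op_smul, one_mul, op_one]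
    push_cast; rfl
  rx i j h := by simp only [op_mul, reflect_mulX i j h]
  rx_self i := by simp only [op_mul, reflect_mulX_self, op_neg]
  rt i j h := by simp only [op_mul, reflect_dunkl k i j h]
  rt_self i := by simp only [op_mul, reflect_dunkl_self, op_neg]

theorem genOp_eq (k : Fin 3 → ℝ) :
    genOp k = abstractGen (fun i => op (pauli i) 1) (fun i => op 1 (mulX i))
      (fun i => op 1 (dunkl k i)) (fun i => op 1 (reflect i)) (fun i => (k i : ℂ)) := by
  funext i
  simp only [genOp, abstractGen, op_add, op_smul, ← op_smul_left, op_mul, ← op_sub, one_mul,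
    mul_one]
  norm_num

theorem diracDunkl_eq (k : Fin 3 → ℝ) :
    diracDunkl k = abstractDirac (fun i => op (pauli i) 1) (fun i => op 1 (dunkl k i)) := by
  simp only [diracDunkl, abstractDirac, op_mul, one_mul, mul_one]

theorem diracDunkl_genOp (k : Fin 3 → ℝ) (i : Fin 3) :
    diracDunkl k * genOp k i = genOp k i * diracDunkl k := by
  rw [diracDunkl_eq, genOp_eq]; exact (dcRel k).dirac_comm i

theorem cen_genOp_comm (k : Fin 3 → ℝ) (i j : Fin 3) :
    cen (genOp k) i * genOp k j = genOp k j * cen (genOp k) i := by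
  rw [genOp_eq]; exact (dcRel k).cen_comm i j

/-- The span of the monomials of degree `n` whose exponent at `x_j` is at least `t`. -/
noncomputable def monoSpan (j : Fin 3) (t : ℕ∞) (n : ℕ) : Submodule ℝ Poly :=
  Submodule.span ℝ {p | ∃ α : Fin 3 →₀ ℕ, α.degree = n ∧ t ≤ (α j : ℕ) ∧ p = monomial α 1}

theorem monomial_mem_monoSpan {j : Fin 3} {t : ℕ∞} {n : ℕ} {α : Fin 3 →₀ ℕ} (h1 : α.degree = n)
    (h2 : t ≤ (α j : ℕ)) (c : ℝ) : monomial α c ∈ monoSpan j t n := by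
  have : (monomial α c : Poly) = c • monomial α 1 := by simp [smul_monomial]
  rw [this]
  exact Submodule.smul_mem _ _ (Submodule.subset_span ⟨α, h1, h2, rfl⟩)

theorem homogeneousSubmodule_eq_monoSpan (n : ℕ) :
    homogeneousSubmodule (Fin 3) ℝ n = monoSpan 0 0 n := by
  apply le_antisymm
  · intro p hp
    rw [p.as_sum]
    refine Submodule.sum_mem _ fun α hα => monomial_mem_monoSpan ?_ (by simp) _
    by_contra h
    exact (mem_support_iff.1 hα) (((mem_homogeneousSubmodule n p).1 hp).coeff_eq_zero h)
  · refine Submodule.span_le.2 ?_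
    rintro _ ⟨α, h, -, rfl⟩
    exact (mem_homogeneousSubmodule _ _).2 (isHomogeneous_monomial _ h)

theorem powSpace_eq_monoSpan (j : Fin 3) (t : ℕ∞) (n : ℕ) : powSpace j t n = monoSpan j t n := by
  apply le_antisymm
  · refine iSup₂_le fun i hi => ?_
    rw [Submodule.map_le_iff_le_comap]
    rintro p ⟨hp, hs⟩
    change X j ^ i * p ∈ monoSpan j t n
    rw [p.as_sum, Finset.mul_sum]
    refine Submodule.sum_mem _ fun α hα => ?_
    have hα0 : α j = 0 := by
      by_contra h
      have h1 : j ∈ p.vars := (mem_vars_iff_mem_support j).2 ⟨α, hα, Finsupp.mem_support_iff.2 h⟩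
      exact (mem_supported.1 hs h1) rfl
    have hdeg : α.degree = n - i := by
      by_contra h
      exact (mem_support_iff.1 hα) (((mem_homogeneousSubmodule _ p).1 hp).coeff_eq_zero h)
    rw [X_pow_eq_monomial, monomial_mul]
    refine monomial_mem_monoSpan ?_ ?_ _
    · rw [map_add, hdeg, Finsupp.degree_single]; omega
    · simpa [hα0] using hi.1
  · refine Submodule.span_le.2 ?_
    rintro _ ⟨α, h, ht, rfl⟩
    have hle : α j ≤ n := h ▸ Finsupp.le_degree j α
    refine (le_iSup₂ (f := fun (i : ℕ) (_ : t ≤ i ∧ i ≤ n) =>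
      (homogAway j (n - i)).map (LinearMap.mulLeft ℝ (X j ^ i))) (α j) ⟨ht, hle⟩) ?_
    have hα : Finsupp.single j (α j) + α.erase j = α := Finsupp.single_add_erase j α
    refine ⟨monomial (α.erase j) 1, ⟨?_, ?_⟩, ?_⟩
    · refine (mem_homogeneousSubmodule _ _).2 (isHomogeneous_monomial _ ?_)
      have := congrArg Finsupp.degree hα
      rw [map_add, Finsupp.degree_single, h] at this
      omega
    · refine mem_supported.2 fun m hm => ?_
      rw [vars_monomial one_ne_zero] at hm
      intro hmj
      rw [Set.mem_singleton_iff.1 hmj] at hm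
      simp at hm
    · rw [LinearMap.mulLeft_apply, X_pow_eq_monomial, monomial_mul, hα, one_mul]

theorem reflect_mem {j : Fin 3} {t : ℕ∞} {n : ℕ} (i : Fin 3) {p : Poly} (hp : p ∈ monoSpan j t n) :
    reflect i p ∈ monoSpan j t n := by
  induction hp using Submodule.span_induction with
  | mem p hp =>
    obtain ⟨α, h1, h2, rfl⟩ := hp
    rw [reflect_monomial]; exact monomial_mem_monoSpan h1 h2 _
  | zero => rw [map_zero]; exact zero_mem _
  | add p q _ _ hp hq => rw [map_add]; exact add_mem hp hq
  | smul c p _ hp => rw [map_smul]; exact Submodule.smul_mem _ _ hp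

theorem mulX_dunkl_mem {k : Fin 3 → ℝ} {j : Fin 3} {t : ℕ∞} {n : ℕ}
    (h : ∀ a : ℕ, t = a → dunklCoeff (k j) a = 0) {i m : Fin 3} {p : Poly}
    (hp : p ∈ monoSpan j t n) : mulX i (dunkl k m p) ∈ monoSpan j t n := by
  induction hp using Submodule.span_induction with
  | mem p hp =>
    obtain ⟨α, h1, h2, rfl⟩ := hp
    rw [dunkl_monomial, mulX_monomial, mul_one]
    by_cases h0 : dunklCoeff (k m) (α m) = 0
    · rw [h0, map_zero]; exact zero_mem _
    have hm : α m ≠ 0 := fun h => h0 (by rw [h, dunklCoeff_zero])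
    refine monomial_mem_monoSpan ?_ ?_ _
    · have := congrArg Finsupp.degree (tsub_add_single hm)
      rw [map_add, Finsupp.degree_single] at this ⊢
      omega
    · by_cases hmj : m = j
      · subst hmj
        have hne : t ≠ (α m : ℕ) := fun he => h0 (h _ he)
        have hlt := lt_of_le_of_ne h2 hne
        obtain ⟨s, rfl⟩ := ENat.ne_top_iff_exists.1 (ne_top_of_lt hlt)
        have hlt' : s < α m := by exact_mod_cast hlt
        refine Nat.cast_le.2 ?_
        simp only [Finsupp.coe_tsub, Finsupp.coe_add, Pi.sub_apply, Pi.add_apply,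
          Finsupp.single_eq_same]
        omega
      · refine h2.trans (Nat.cast_le.2 ?_)
        simp only [Finsupp.coe_tsub, Finsupp.coe_add, Pi.sub_apply, Pi.add_apply,
          Finsupp.single_apply, if_neg hmj]
        omega
  | zero => rw [map_zero, map_zero]; exact zero_mem _
  | add p q _ _ hp hq => rw [map_add, map_add]; exact add_mem hp hq
  | smul c p _ hp => rw [map_smul, map_smul]; exact Submodule.smul_mem _ _ hp

theorem pure_mem_tens {W : Submodule ℝ Poly} (v : Fin 2 → ℂ) {p : Poly} (hp : p ∈ W) :
    pureTensor v p ∈ tens W :=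
  Submodule.subset_span ⟨v, p, hp, rfl⟩

theorem genOp_mem_tens {k : Fin 3 → ℝ} {j : Fin 3} {t : ℕ∞} {n : ℕ}
    (h : ∀ a : ℕ, t = a → dunklCoeff (k j) a = 0) (i : Fin 3) {f : Spinor}
    (hf : f ∈ tens (monoSpan j t n)) : genOp k i f ∈ tens (monoSpan j t n) := by
  induction hf using Submodule.span_induction with
  | mem f hf =>
    obtain ⟨v, p, hp, rfl⟩ := hf
    rw [genOp, LinearMap.add_apply, op_pure, op_pure]
    have hr := reflect_mem (i + 1) (reflect_mem (i + 2) hp)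
    refine add_mem (pure_mem_tens _ ?_) (pure_mem_tens _ ?_)
    · exact sub_mem (mulX_dunkl_mem h hr) (mulX_dunkl_mem h hr)
    · exact add_mem (add_mem (Submodule.smul_mem _ _ hr)
        (Submodule.smul_mem _ _ (reflect_mem _ hp))) (Submodule.smul_mem _ _ (reflect_mem _ hp))
  | zero => rw [map_zero]; exact zero_mem _
  | add p q _ _ hp hq => rw [map_add]; exact add_mem hp hq
  | smul c p _ hp => rw [map_smul]; exact Submodule.smul_mem _ _ hp

theorem genOp_mem_monogenics (k : Fin 3 → ℝ) (n : ℕ) (i : Fin 3) {f : Spinor}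
    (hf : f ∈ monogenics k n) : genOp k i f ∈ monogenics k n := by
  refine ⟨?_, ?_⟩
  · have := LinearMap.congr_fun (diracDunkl_genOp k i) f
    change diracDunkl k (genOp k i f) = 0
    rw [Module.End.mul_apply, Module.End.mul_apply, show diracDunkl k f = 0 from hf.1, map_zero] at this
    exact this
  · have h2 := hf.2
    rw [homogeneousSubmodule_eq_monoSpan] at h2 ⊢
    refine genOp_mem_tens (fun a ha => ?_) i h2
    have : a = 0 := by exact_mod_cast ha.symm
    rw [this, dunklCoeff_zero]

/-- The `ℂ`-linear maps of `M_n` by which `X`, `Y`, `Z` act. -/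
noncomputable def genRes (k : Fin 3 → ℝ) (n : ℕ) (i : Fin 3) : Module.End ℂ (monogenics k n) :=
  (genOp k i).restrict fun _ hf => genOp_mem_monogenics k n i hf

theorem genRes_coe (k : Fin 3 → ℝ) (n : ℕ) (i : Fin 3) (f : monogenics k n) :
    (genRes k n i f : Spinor) = genOp k i f := rfl

/-- The representation of the Bannai–Ito algebra on `M_n`. -/
noncomputable def monogenicsRep (k : Fin 3 → ℝ) (n : ℕ) : BI →ₐ[ℂ] Module.End ℂ (monogenics k n) :=
  BI.lift (genRes k n) fun i j => by
    refine LinearMap.ext fun f => Subtype.ext ?_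
    exact LinearMap.congr_fun (cen_genOp_comm k i j) (f : Spinor)

/-- The space `M_n` of Dunkl monogenics of degree `n`, as a module over the Bannai–Ito algebra. -/
def Monogenics (k : Fin 3 → ℝ) (n : ℕ) : Type := monogenics k n

noncomputable instance (k : Fin 3 → ℝ) (n : ℕ) : AddCommGroup (Monogenics k n) :=
  inferInstanceAs (AddCommGroup (monogenics k n))

noncomputable instance (k : Fin 3 → ℝ) (n : ℕ) : Module BI (Monogenics k n) :=
  Module.compHom (monogenics k n) (monogenicsRep k n).toRingHom

/-- The underlying spinor-valued polynomial. -/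
def Monogenics.val {k : Fin 3 → ℝ} {n : ℕ} (f : Monogenics k n) : Spinor :=
  Subtype.val (p := fun z => z ∈ monogenics k n) f

theorem Monogenics.gen_smul_val {k : Fin 3 → ℝ} {n : ℕ} (i : Fin 3) (f : Monogenics k n) :
    (BI.gen i • f).val = genOp k i f.val := by
  change (monogenicsRep k n (BI.gen i) f : monogenics k n).1 = _
  rw [monogenicsRep, BI.lift_gen]; rfl

theorem threshold_dunklCoeff (κ : ℝ) (a : ℕ) (h : threshold κ = a) : dunklCoeff κ a = 0 := by
  obtain ⟨ho, hκ⟩ := (threshold_eq_coe_iff κ a).1 h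
  rw [dunklCoeff, ho.neg_one_pow]; linarith

/-- The submodule `M_n(x_j)` of `M_n`: the intersection of `M_n` with
`⨁_{i=t_j}^n ℂ² ⊗ (x_j^i · ℝ[the other two variables]_{n-i})`. -/
noncomputable def monogenicsAt (k : Fin 3 → ℝ) (n : ℕ) (j : Fin 3) :
    Submodule BI (Monogenics k n) where
  carrier := {f | f.val ∈ tens (powSpace j (threshold (k j)) n)}
  add_mem' hf hg := (tens (powSpace j (threshold (k j)) n)).add_mem hf hg
  zero_mem' := zero_mem (tens (powSpace j (threshold (k j)) n))
  smul_mem' b f hf := by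
    induction b using BI.induction generalizing f with
    | algebraMap c =>
      have : (algebraMap ℂ BI c • f).val = c • f.val := by
        change (monogenicsRep k n (algebraMap ℂ BI c) f : monogenics k n).1 = _
        rw [AlgHom.commutes]; rfl
      change (algebraMap ℂ BI c • f).val ∈ tens (powSpace j (threshold (k j)) n)
      rw [this]
      exact Submodule.smul_mem _ _ hf
    | gen i =>
      change (BI.gen i • f).val ∈ tens (powSpace j (threshold (k j)) n)
      rw [Monogenics.gen_smul_val, powSpace_eq_monoSpan]
      refine genOp_mem_tens (threshold_dunklCoeff (k j)) i ?_
      rw [← powSpace_eq_monoSpan]; exact hf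
    | add a b ha hb =>
      rw [add_smul]
      exact (tens (powSpace j (threshold (k j)) n)).add_mem (ha f hf) (hb f hf)
    | mul a b ha hb =>
      rw [mul_smul]; exact ha _ (hb f hf)

end Spinors

end BannaiIto

namespace BannaiIto

section ComplexStructure

/-! The complex vector space structures underlying modules over the Bannai–Ito algebra. -/

noncomputable instance (d : ℕ) (hd : Even d) (a b c : ℂ) : Module ℂ (OddModule d hd a b c) :=
  inferInstanceAs (Module ℂ (Fin (d + 1) → ℂ))

instance (d : ℕ) (hd : Even d) (a b c : ℂ) : IsScalarTower ℂ BI (OddModule d hd a b c) where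
  smul_assoc s x v := by
    have h : ∀ w : Fin (d + 1) → ℂ,
        (oddRep hd a b c (s • x)).mulVec w = s • (oddRep hd a b c x).mulVec w := by
      intro w; rw [map_smul, Matrix.smul_mulVec]
    exact h v

noncomputable instance (ε : BI ≃ₐ[ℂ] BI) (V : Type*) [AddCommGroup V] [Module ℂ V] :
    Module ℂ (Twist ε V) :=
  inferInstanceAs (Module ℂ V)

instance (ε : BI ≃ₐ[ℂ] BI) (V : Type*) [AddCommGroup V] [Module BI V] [Module ℂ V]
    [IsScalarTower ℂ BI V] : IsScalarTower ℂ BI (Twist ε V) where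
  smul_assoc s x v := by
    have h : ∀ w : V, ε (s • x) • w = s • ε x • w := by
      intro w; rw [map_smul, smul_assoc]
    exact h v

noncomputable instance (k : Fin 3 → ℝ) (n : ℕ) : Module ℂ (Monogenics k n) :=
  inferInstanceAs (Module ℂ (monogenics k n))

instance (k : Fin 3 → ℝ) (n : ℕ) : IsScalarTower ℂ BI (Monogenics k n) where
  smul_assoc s x f := by
    change monogenicsRep k n (s • x) f = s • monogenicsRep k n x f
    rw [map_smul]; rfl

variable {M N : Type*} [AddCommGroup M] [Module ℂ M] [Module BI M] [IsScalarTower ℂ BI M]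
  [AddCommGroup N] [Module ℂ N] [Module BI N] [IsScalarTower ℂ BI N]

/-- A complex linear map that commutes with the generators is linear over the Bannai–Ito
algebra. -/
def BI.linearMapOfGen (f : M →ₗ[ℂ] N) (h : ∀ i m, f (BI.gen i • m) = BI.gen i • f m) :
    M →ₗ[BI] N where
  toFun := f
  map_add' := f.map_add
  map_smul' b m := by
    change f (b • m) = b • f m
    induction b using BI.induction generalizing m with
    | algebraMap c => rw [algebraMap_smul, algebraMap_smul, map_smul]
    | gen i => exact h i m
    | add a b ha hb => rw [add_smul, add_smul, map_add, ha, hb]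
    | mul a b ha hb => rw [mul_smul, mul_smul, ha, hb]

theorem BI.nonempty_linearEquiv (f : M →ₗ[ℂ] N) (h : ∀ i m, f (BI.gen i • m) = BI.gen i • f m)
    (hf : Function.Bijective f) : Nonempty (M ≃ₗ[BI] N) :=
  ⟨LinearEquiv.ofBijective (BI.linearMapOfGen f h) hf⟩

theorem Twist.isSimpleModule (ε : BI ≃ₐ[ℂ] BI) (V : Type*) [AddCommGroup V] [Module BI V]
    [hV : IsSimpleModule BI V] : IsSimpleModule BI (Twist ε V) := by
  rw [isSimpleModule_iff_toSpanSingleton_surjective] at hV ⊢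
  refine ⟨hV.1, fun m hm x => ?_⟩
  obtain ⟨b, hb⟩ := hV.2 m hm x
  refine ⟨ε.symm b, ?_⟩
  change @HSMul.hSMul BI V V _ (ε (ε.symm b)) m = x
  rw [ε.apply_symm_apply]; exact hb

end ComplexStructure

section OddOperators

/-- The operators by which `X`, `Y`, `Z` act on `O_d(a,b,c)`. -/
noncomputable def oddOp (d : ℕ) (a b c : ℂ) (i : Fin 3) : Module.End ℂ (Fin (d + 1) → ℂ) :=
  Matrix.toLin' (![oddX d a, oddY d a b c, oddZ d a b c] i)

/-- The scalars by which `{Y,Z} - X`, `{Z,X} - Y`, `{X,Y} - Z` act on `O_d(a,b,c)`. -/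
noncomputable def oddScalar (d : ℕ) (a b c : ℂ) : Fin 3 → ℂ :=
  ![2 * b * c - a * (d + 1), 2 * c * a - b * (d + 1), 2 * a * b - c * (d + 1)]

theorem cen_oddOp {d : ℕ} (hd : Even d) (a b c : ℂ) (i : Fin 3) :
    cen (oddOp d a b c) i = oddScalar d a b c i • 1 := by
  have h : ∀ {P Q R : Matrix (Fin (d + 1)) (Fin (d + 1)) ℂ} {s : ℂ},
      P * Q + Q * P - R = s • (1 : Matrix (Fin (d + 1)) (Fin (d + 1)) ℂ) →
      Matrix.toLin' P * Matrix.toLin' Q + Matrix.toLin' Q * Matrix.toLin' P - Matrix.toLin' R =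
        s • (1 : Module.End ℂ (Fin (d + 1) → ℂ)) := by
    intro P Q R s h
    rw [Module.End.mul_eq_comp, Module.End.mul_eq_comp, ← Matrix.toLin'_mul, ← Matrix.toLin'_mul,
      ← map_add, ← map_sub, h, map_smul, Matrix.toLin'_one]; rfl
  fin_cases i
  · exact h (odd_lambda hd a b c)
  · exact h (odd_mu hd a b c)
  · exact h (odd_kappa d a b c)

theorem exists_seq {d : ℕ} (v : Fin (d + 1) → ℂ) :
    ∃ F : ℕ → ℂ, v = fun i : Fin (d + 1) => F i :=
  ⟨fun m => if h : m < d + 1 then v ⟨m, h⟩ else 0, by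
    ext i; simp [i.2]⟩

theorem oddOp_zero (d : ℕ) (a b c : ℂ) (F : ℕ → ℂ) :
    oddOp d a b c 0 (fun i => F i) = fun i : Fin (d + 1) => seqX d a F i :=
  oddX_mulVec d a F

theorem oddOp_one {d : ℕ} (hd : Even d) (a b c : ℂ) (F : ℕ → ℂ) :
    oddOp d a b c 1 (fun i => F i) = fun i : Fin (d + 1) => seqY d a b c F i :=
  oddY_mulVec hd a b c F

theorem oddOp_two {d : ℕ} (hd : Even d) (a b c : ℂ) (F : ℕ → ℂ) :
    oddOp d a b c 2 (fun i => F i) = fun i : Fin (d + 1) => seqZ d a b c F i :=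
  oddZ_mulVec hd a b c F

/-- The scalar by which the Casimir element `X² + Y² + Z²` acts on `O_d(a,b,c)`. -/
noncomputable def oddCasimir (d : ℕ) (a b c : ℂ) : ℂ :=
  a ^ 2 + b ^ 2 + c ^ 2 + ((d + 1) ^ 2 - 1) / 4

theorem seq_casimir (d : ℕ) (a b c : ℂ) (F : ℕ → ℂ) (i : ℕ) :
    seqX d a (seqX d a F) i + seqY d a b c (seqY d a b c F) i + seqZ d a b c (seqZ d a b c F) i =
      oddCasimir d a b c * F i := by
  rcases i with _ | _ | i
  · simp [seqX, seqY, seqZ, oddTheta, oddPhi, Nat.even_add_one, oddCasimir]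
    ring
  · simp [seqX, seqY, seqZ, oddTheta, oddPhi, Nat.even_add_one, oddCasimir]
    ring
  · rcases Nat.even_or_odd i with h | h
    · simp [seqX, seqY, seqZ, oddTheta, oddPhi, Nat.even_add_one, h, pow_succ, h.neg_one_pow,
        oddCasimir]
      ring
    · have h' := Nat.not_even_iff_odd.2 h
      simp [seqX, seqY, seqZ, oddTheta, oddPhi, Nat.even_add_one, h, h', pow_succ, h.neg_one_pow,
        oddCasimir]
      ring

theorem oddOp_casimir {d : ℕ} (hd : Even d) (a b c : ℂ) (v : Fin (d + 1) → ℂ) :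
    oddOp d a b c 0 (oddOp d a b c 0 v) + oddOp d a b c 1 (oddOp d a b c 1 v) +
      oddOp d a b c 2 (oddOp d a b c 2 v) = oddCasimir d a b c • v := by
  obtain ⟨F, rfl⟩ := exists_seq v
  simp only [oddOp_zero, oddOp_one hd, oddOp_two hd]
  ext i
  exact seq_casimir d a b c F i

theorem cen_apply {V : Type*} [AddCommGroup V] [Module ℂ V] {A : Fin 3 → Module.End ℂ V}
    {s : Fin 3 → ℂ} (h : ∀ i, cen A i = s i • 1) (i : Fin 3) (v : V) :
    A (i + 1) (A (i + 2) v) + A (i + 2) (A (i + 1) v) - A i v = s i • v :=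
  LinearMap.congr_fun (h i) v

end OddOperators

section Chain

variable {V : Type*} [AddCommGroup V] [Module ℂ V]

/-- The vectors `u`, `(T - θ_0) u`, `(T - θ_1) (T - θ_0) u`, …. -/
def chain (T : Module.End ℂ V) (θ : ℕ → ℂ) (u : V) : ℕ → V
  | 0 => u
  | i + 1 => T (chain T θ u i) - θ i • chain T θ u i

theorem apply_chain (T : Module.End ℂ V) (θ : ℕ → ℂ) (u : V) (i : ℕ) :
    T (chain T θ u i) = chain T θ u (i + 1) + θ i • chain T θ u i := by
  simp [chain]

variable {A : Fin 3 → Module.End ℂ V} {d : ℕ} {a b c : ℂ}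

theorem chain_lowering (hA : ∀ i, cen A i = oddScalar d a b c i • 1) {u : V}
    (h0 : A 1 u = oddTheta d b 0 • u)
    (h1 : A 1 (chain (A 0) (oddTheta d a) u 1) =
      oddTheta d b 1 • chain (A 0) (oddTheta d a) u 1 + oddPhi d a b c 1 • u) (i : ℕ) :
    A 1 (chain (A 0) (oddTheta d a) u (i + 1)) =
      oddTheta d b (i + 1) • chain (A 0) (oddTheta d a) u (i + 1) +
        oddPhi d a b c (i + 1) • chain (A 0) (oddTheta d a) u i := by
  have key : ∀ v, A 1 (A 0 (A 0 v)) = oddScalar d a b c 1 • v + A 1 v +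
      (2 * oddScalar d a b c 2) • A 0 v - A 0 (A 0 (A 1 v)) - (2 : ℂ) • A 0 (A 1 (A 0 v)) := by
    intro v
    have e1 := cen_apply hA 1 v
    have e2 := cen_apply hA 2
    simp only [show (1 : Fin 3) + 1 = 2 from rfl, show (1 : Fin 3) + 2 = 0 from rfl,
      show (2 : Fin 3) + 1 = 0 from rfl, show (2 : Fin 3) + 2 = 1 from rfl] at e1 e2
    have e3 : ∀ v, A 2 v = A 0 (A 1 v) + A 1 (A 0 v) - oddScalar d a b c 2 • v := by
      intro v; rw [← e2 v]; abel
    rw [e3, e3] at e1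
    simp only [map_add, map_sub, map_smul] at e1
    rw [← e1]; module
  have hx := apply_chain (A 0) (oddTheta d a) u
  generalize hU : chain (A 0) (oddTheta d a) u = U at *
  have hU0 : U 0 = u := by rw [← hU]; rfl
  rw [← hU0] at h0 h1
  have s2 : ∀ i, A 1 (U (i + 2)) = oddScalar d a b c 1 • U i + A 1 (U i) +
      (2 * oddScalar d a b c 2) • A 0 (U i) - A 0 (A 0 (A 1 (U i))) - (2 : ℂ) • A 0 (A 1 (A 0 (U i)))
      - (oddTheta d a i + oddTheta d a (i + 1)) • A 1 (A 0 (U i))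
      + (oddTheta d a i * oddTheta d a (i + 1)) • A 1 (U i) := by
    intro i
    have e1 := hx i
    have e2 := hx (i + 1)
    have e1' : U (i + 1) = A 0 (U i) - oddTheta d a i • U i := by rw [e1]; abel
    have e2' : U (i + 2) = A 0 (U (i + 1)) - oddTheta d a (i + 1) • U (i + 1) := by rw [e2]; abel
    rw [e2', e1', ← key]
    simp only [map_sub, map_smul]
    module
  induction i using Nat.twoStepInduction with
  | zero => exact h1
  | one =>
    have x0 : A 0 (U 0) = U 1 + oddTheta d a 0 • U 0 := hx 0
    have x1 : A 0 (U 1) = U 2 + oddTheta d a 1 • U 1 := hx 1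
    change A 1 (U 2) = oddTheta d b 2 • U 2 + oddPhi d a b c 2 • U 1
    refine (s2 0).trans ?_
    simp only [map_add, map_sub, map_smul, h0, h1, x0, x1, smul_add, smul_sub, zero_add]
    match_scalars <;> (simp only [oddTheta, oddPhi, oddScalar, Matrix.cons_val] <;> norm_num <;> ring1)
  | more i ih1 ih2 =>
    have x0 : A 0 (U i) = U (i + 1) + oddTheta d a i • U i := hx i
    have x1 : A 0 (U (i + 1)) = U (i + 2) + oddTheta d a (i + 1) • U (i + 1) := hx (i + 1)
    have x2 : A 0 (U (i + 2)) = U (i + 3) + oddTheta d a (i + 2) • U (i + 2) := hx (i + 2)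
    have ih2 : A 1 (U (i + 2)) =
      oddTheta d b (i + 2) • U (i + 2) + oddPhi d a b c (i + 2) • U (i + 1) := ih2
    change A 1 (U (i + 3)) = oddTheta d b (i + 3) • U (i + 3) + oddPhi d a b c (i + 3) • U (i + 2)
    refine (s2 (i + 1)).trans ?_
    simp only [map_add, map_sub, map_smul, ih1, ih2, x0, x1, x2, smul_add, smul_sub,
      Nat.add_assoc, Nat.reduceAdd]
    rcases Nat.even_or_odd i with h | h
    · match_scalars <;> (simp only [oddTheta, oddPhi, oddScalar, Matrix.cons_val, h, pow_add, h.neg_one_pow, Nat.even_add] <;> norm_num <;> ring1)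
    · have h' := Nat.not_even_iff_odd.2 h
      match_scalars <;> (simp only [oddTheta, oddPhi, oddScalar, Matrix.cons_val, h', pow_add, h.neg_one_pow, Nat.even_add] <;> norm_num <;> ring1)

end Chain

section Intertwiners

variable {V : Type*} [AddCommGroup V] [Module ℂ V]
variable {A : Fin 3 → Module.End ℂ V} {d : ℕ} {a b c : ℂ}

/-- A vector of lowest weight for `Y` whose chain under `X` ends after `d + 1` steps is the image of
the first basis vector under an intertwining map from `O_d(a,b,c)`. -/
theorem exists_intertwiner (hd : Even d) (hA : ∀ i, cen A i = oddScalar d a b c i • 1) {u : V}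
    (h0 : A 1 u = oddTheta d b 0 • u)
    (h1 : A 1 (chain (A 0) (oddTheta d a) u 1) =
      oddTheta d b 1 • chain (A 0) (oddTheta d a) u 1 + oddPhi d a b c 1 • u)
    (hlast : chain (A 0) (oddTheta d a) u (d + 1) = 0) :
    ∃ f : (Fin (d + 1) → ℂ) →ₗ[ℂ] V, f (fun i => if (i : ℕ) = 0 then 1 else 0) = u ∧
      ∀ i v, f (oddOp d a b c i v) = A i (f v) := by
  have hx := apply_chain (A 0) (oddTheta d a) u
  have hy := chain_lowering hA h0 h1
  have hU0 : chain (A 0) (oddTheta d a) u 0 = u := rfl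
  generalize chain (A 0) (oddTheta d a) u = U at *
  let f : (Fin (d + 1) → ℂ) →ₗ[ℂ] V := Fintype.linearCombination ℂ (fun i : Fin (d + 1) => U i)
  have hf : ∀ F : ℕ → ℂ, f (fun i => F i) = ∑ i ∈ Finset.range (d + 1), F i • U i := by
    intro F
    rw [Finset.sum_range (fun i => F i • U i)]
    exact Fintype.linearCombination_apply ℂ _ _
  have fx : ∀ v, f (oddOp d a b c 0 v) = A 0 (f v) := by
    intro v
    obtain ⟨F, rfl⟩ := exists_seq v
    rw [oddOp_zero, hf, hf, map_sum]
    have : ∀ m, ∑ i ∈ Finset.range (m + 1), seqX d a F i • U i =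
        ∑ i ∈ Finset.range (m + 1), A 0 (F i • U i) - F m • U (m + 1) := by
      intro m
      induction m with
      | zero => simp [seqX, hx, smul_smul, mul_comm]
      | succ m ih =>
        rw [Finset.sum_range_succ, ih, Finset.sum_range_succ _ (m + 1), map_smul, hx (m + 1)]
        simp only [seqX]
        module
    rw [this, hlast, smul_zero, sub_zero]
  have fy : ∀ v, f (oddOp d a b c 1 v) = A 1 (f v) := by
    intro v
    obtain ⟨F, rfl⟩ := exists_seq v
    rw [oddOp_one hd, hf, hf, map_sum]
    have : ∀ m, ∑ i ∈ Finset.range (m + 1), seqY d a b c F i • U i =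
        ∑ i ∈ Finset.range (m + 1), A 1 (F i • U i) +
          (oddPhi d a b c (m + 1) * F (m + 1)) • U m := by
      intro m
      induction m with
      | zero => simp [seqY, hU0, h0, smul_smul, mul_comm, add_smul]
      | succ m ih =>
        rw [Finset.sum_range_succ, ih, Finset.sum_range_succ _ (m + 1), map_smul, hy]
        simp only [seqY]
        module
    rw [this, oddPhi_last hd, zero_mul, zero_smul, add_zero]
  refine ⟨f, ?_, fun i v => ?_⟩
  · rw [hf (fun i => if i = 0 then 1 else 0)]
    simp [Finset.sum_range_succ', hU0]
  · fin_cases i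
    · exact fx v
    · exact fy v
    · have e1 := cen_apply (cen_oddOp hd a b c) 2 v
      have e2 := cen_apply hA 2 (f v)
      simp only [show (2 : Fin 3) + 1 = 0 from rfl, show (2 : Fin 3) + 2 = 1 from rfl] at e1 e2
      have e3 : oddOp d a b c 2 v = oddOp d a b c 0 (oddOp d a b c 1 v) +
          oddOp d a b c 1 (oddOp d a b c 0 v) - oddScalar d a b c 2 • v := by rw [← e1]; abel
      have e4 : A 2 (f v) = A 0 (A 1 (f v)) + A 1 (A 0 (f v)) - oddScalar d a b c 2 • f v := by
        rw [← e2]; abel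
      change f (oddOp d a b c 2 v) = A 2 (f v)
      rw [e3, e4, map_sub, map_add, map_smul, fx, fy, fy, fx]

theorem chain_base (hA : ∀ i, cen A i = oddScalar d a b c i • 1) {u : V}
    (h0 : A 1 u = oddTheta d b 0 • u)
    (hprev : ∀ w, A 1 w = (1 - oddTheta d b 0) • w → w = 0) :
    A 1 (chain (A 0) (oddTheta d a) u 1) =
      oddTheta d b 1 • chain (A 0) (oddTheta d a) u 1 + oddPhi d a b c 1 • u := by
  have e0 := cen_apply hA 0 u
  have e2 := cen_apply hA 2 u
  simp only [show (0 : Fin 3) + 1 = 1 from rfl, show (0 : Fin 3) + 2 = 2 from rfl,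
    show (2 : Fin 3) + 1 = 0 from rfl, show (2 : Fin 3) + 2 = 1 from rfl, h0, map_smul] at e0 e2
  have e0' : A 1 (A 2 u) = oddScalar d a b c 0 • u + A 0 u - oddTheta d b 0 • A 2 u := by
    rw [← e0]; abel
  have e2' : A 1 (A 0 u) = oddScalar d a b c 2 • u + A 2 u - oddTheta d b 0 • A 0 u := by
    rw [← e2]; abel
  have hz : A 2 u = (a + c) • u - A 0 u := by
    refine sub_eq_zero.1 (hprev _ ?_)
    simp only [map_sub, map_smul, e0', e2', h0]
    match_scalars <;> simp only [oddScalar, oddTheta, Matrix.cons_val] <;> norm_num <;> ring1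
  simp only [chain, map_sub, map_smul, e2', h0, hz]
  match_scalars <;> simp only [oddScalar, oddTheta, oddPhi, Matrix.cons_val] <;> norm_num <;> ring1

end Intertwiners

section Charpoly

open Polynomial

/-- The polynomial with roots `θ_0, …, θ_d`. -/
noncomputable def oddPoly (d : ℕ) (a : ℂ) : ℂ[X] :=
  ∏ i ∈ Finset.range (d + 1), (X - C (oddTheta d a i))

theorem chain_eq_aeval {V : Type*} [AddCommGroup V] [Module ℂ V] (T : Module.End ℂ V) (θ : ℕ → ℂ)
    (u : V) (m : ℕ) :
    chain T θ u m = aeval T (∏ i ∈ Finset.range m, (X - C (θ i))) u := by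
  induction m with
  | zero => simp [chain]
  | succ m ih =>
    rw [Finset.prod_range_succ, mul_comm, map_mul, Module.End.mul_apply, ← ih]
    simp [chain, Module.algebraMap_end_apply]

theorem oddTheta_neg {d : ℕ} (hd : Even d) (a : ℂ) {i : ℕ} (hi : i ≤ d) :
    oddTheta d (-a) (d - i) = -oddTheta d a i := by
  have h : ((-1 : ℂ)) ^ (d - i) = (-1) ^ i := by
    rcases Nat.even_or_odd i with h | h
    · rw [h.neg_one_pow, (Nat.even_sub hi |>.2 (by simp [hd, h])).neg_one_pow]
    · rw [h.neg_one_pow, (Nat.Even.sub_odd hi hd h).neg_one_pow]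
  rw [oddTheta, oddTheta, h, Nat.cast_sub hi]
  ring

theorem oddPoly_neg {d : ℕ} (hd : Even d) (a : ℂ) :
    oddPoly d (-a) = ∏ i ∈ Finset.range (d + 1), (X - C (-oddTheta d a i)) := by
  rw [oddPoly, ← Finset.prod_range_reflect]
  refine Finset.prod_congr rfl fun i hi => ?_
  rw [← oddTheta_neg hd a (Nat.lt_succ_iff.1 (Finset.mem_range.1 hi))]
  rfl

theorem charpoly_smul_oddOp_zero (d : ℕ) (a b c s : ℂ) :
    (s • oddOp d a b c 0).charpoly =
      ∏ i ∈ Finset.range (d + 1), (X - C (s * oddTheta d a i)) := by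
  have : s • oddOp d a b c 0 = Matrix.toLin' (s • oddX d a) := by rw [map_smul]; rfl
  rw [this, Matrix.charpoly_toLin', ← Matrix.charpoly_transpose, Matrix.charpoly_of_isUpperTriangular]
  · rw [Finset.prod_range]
    simp [oddX]
  · intro i j hij
    have h1 : j ≠ i := hij.ne
    have h2 : ¬ ((j : ℕ) = i + 1) := by have : (j : ℕ) < i := hij; omega
    simp [oddX, h1, h2]

theorem charpoly_smul_oddOp_one (d : ℕ) (a b c s : ℂ) :
    (s • oddOp d a b c 1).charpoly =
      ∏ i ∈ Finset.range (d + 1), (X - C (s * oddTheta d b i)) := by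
  have : s • oddOp d a b c 1 = Matrix.toLin' (s • oddY d a b c) := by rw [map_smul]; rfl
  rw [this, Matrix.charpoly_toLin', Matrix.charpoly_of_isUpperTriangular]
  · rw [Finset.prod_range]
    simp [oddY]
  · intro i j hij
    have h1 : i ≠ j := hij.ne'
    have h2 : ¬ ((j : ℕ) = i + 1) := by have : (j : ℕ) < i := hij; omega
    simp [oddY, h1, h2]

theorem oddPoly_isRoot_iff {d : ℕ} {a s : ℂ} :
    (oddPoly d a).IsRoot s ↔ ∃ i ≤ d, s = oddTheta d a i := by
  simp [oddPoly, IsRoot, eval_prod, Finset.prod_eq_zero_iff, sub_eq_zero, Nat.lt_succ_iff]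

end Charpoly

section Simplicity

variable {V : Type*} [AddCommGroup V] [Module ℂ V]
variable {A : Fin 3 → Module.End ℂ V} {d : ℕ} {a b c : ℂ}

/-- On a `Y`-eigenvector `w` of eigenvalue `λ`, the operator `X - Z - γ` for suitable `γ` takes
`w` to the eigenvalue `-1 - λ`, and kills it only if `λ + 1/2` is special. -/
theorem ladder_sub (hA : ∀ i, cen A i = oddScalar d a b c i • 1)
    (hω : ∀ v, A 0 (A 0 v) + A 1 (A 1 v) + A 2 (A 2 v) = oddCasimir d a b c • v)
    {ℓ : ℂ} (hℓ : ℓ ≠ 0) (h1 : ℓ ≠ a - c) (h2 : ℓ ≠ c - a) (h3 : ℓ ≠ b + (d + 1) / 2)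
    (h4 : ℓ ≠ -(b + (d + 1) / 2)) {w : V} (hw : A 1 w = (ℓ - 1 / 2) • w) (hw0 : w ≠ 0) :
    ∃ γ : ℂ, A 1 (A 0 w - A 2 w - γ • w) = (-1 / 2 - ℓ) • (A 0 w - A 2 w - γ • w) ∧
      A 0 w - A 2 w - γ • w ≠ 0 := by
  have e0 := cen_apply hA 0 w
  have e1 := cen_apply hA 1 w
  have e2 := cen_apply hA 2 w
  have eω := hω w
  simp only [show (0 : Fin 3) + 1 = 1 from rfl, show (0 : Fin 3) + 2 = 2 from rfl,
    show (1 : Fin 3) + 1 = 2 from rfl, show (1 : Fin 3) + 2 = 0 from rfl,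
    show (2 : Fin 3) + 1 = 0 from rfl, show (2 : Fin 3) + 2 = 1 from rfl, hw, map_smul]
    at e0 e1 e2 eω
  obtain ⟨γ, hγ⟩ : ∃ γ, γ * ℓ = (a - c) * (b + (d + 1) / 2) :=
    ⟨(a - c) * (b + (d + 1) / 2) / ℓ, div_mul_cancel₀ _ hℓ⟩
  refine ⟨γ, ?_, fun h => ?_⟩
  · have e0' : A 1 (A 2 w) = oddScalar d a b c 0 • w + A 0 w - (ℓ - 1 / 2) • A 2 w := by
      rw [← e0]; abel
    have e2' : A 1 (A 0 w) = oddScalar d a b c 2 • w + A 2 w - (ℓ - 1 / 2) • A 0 w := by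
      rw [← e2]; abel
    simp only [map_sub, map_smul, e0', e2', hw]
    match_scalars <;> first
      | ring1
      | (simp only [oddScalar, Matrix.cons_val]
         linear_combination -2 * hγ)
  · have hz : A 2 w = A 0 w - γ • w := by
      rw [sub_eq_zero] at h; rw [← h]; abel
    have ez : A 2 (A 2 w) = A 2 (A 0 w) - γ • A 2 w := by
      conv_lhs => rw [hz]
      rw [map_sub, map_smul]
    have ex : A 0 (A 2 w) = A 0 (A 0 w) - γ • A 0 w := by
      rw [hz, map_sub, map_smul]
    have : (oddCasimir d a b c - (ℓ - 1 / 2) ^ 2 - (ℓ - 1 / 2) - oddScalar d a b c 1 - γ ^ 2) • w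
        = 0 := by
      have k1 : A 0 (A 0 w) + A 2 (A 2 w) - A 2 (A 0 w) - A 0 (A 2 w) = (γ ^ 2) • w := by
        rw [ez, ex, hz]; module
      have k2 : A 0 (A 0 w) + A 2 (A 2 w) = oddCasimir d a b c • w - ((ℓ - 1 / 2) ^ 2) • w := by
        rw [← eω]; module
      have k3 : A 2 (A 0 w) + A 0 (A 2 w) = (ℓ - 1 / 2) • w + oddScalar d a b c 1 • w := by
        rw [← e1]; module
      calc _ = (A 0 (A 0 w) + A 2 (A 2 w)) - (A 2 (A 0 w) + A 0 (A 2 w)) - (γ ^ 2) • w := by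
            rw [k2, k3]; module
        _ = 0 := by rw [← k1]; abel
    have hs := (smul_eq_zero.1 this).resolve_right hw0
    have key : (ℓ - (a - c)) * (ℓ - (c - a)) * ((ℓ - (b + (d + 1) / 2)) *
        (ℓ + (b + (d + 1) / 2))) = 0 := by
      simp only [oddScalar, oddCasimir, Matrix.cons_val] at hs
      linear_combination (-ℓ ^ 2) * hs - (γ * ℓ + (a - c) * (b + (d + 1) / 2)) * hγ
    rcases mul_eq_zero.1 key with h | h <;> rcases mul_eq_zero.1 h with h | h
    · exact h1 (sub_eq_zero.1 h)
    · exact h2 (sub_eq_zero.1 h)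
    · exact h3 (sub_eq_zero.1 h)
    · exact h4 (eq_neg_of_add_eq_zero_left h)

/-- On a `Y`-eigenvector `w` of eigenvalue `λ`, the operator `X + Z - γ` for suitable `γ` takes
`w` to the eigenvalue `1 - λ`, and kills it only if `λ - 1/2` is special. -/
theorem ladder_add (hA : ∀ i, cen A i = oddScalar d a b c i • 1)
    (hω : ∀ v, A 0 (A 0 v) + A 1 (A 1 v) + A 2 (A 2 v) = oddCasimir d a b c • v)
    {ℓ : ℂ} (hℓ : ℓ ≠ 0) (h1 : ℓ ≠ a + c) (h2 : ℓ ≠ -(a + c)) (h3 : ℓ ≠ b - (d + 1) / 2)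
    (h4 : ℓ ≠ -(b - (d + 1) / 2)) {w : V} (hw : A 1 w = (ℓ + 1 / 2) • w) (hw0 : w ≠ 0) :
    ∃ γ : ℂ, A 1 (A 0 w + A 2 w - γ • w) = (1 / 2 - ℓ) • (A 0 w + A 2 w - γ • w) ∧
      A 0 w + A 2 w - γ • w ≠ 0 := by
  have e0 := cen_apply hA 0 w
  have e1 := cen_apply hA 1 w
  have e2 := cen_apply hA 2 w
  have eω := hω w
  simp only [show (0 : Fin 3) + 1 = 1 from rfl, show (0 : Fin 3) + 2 = 2 from rfl,
    show (1 : Fin 3) + 1 = 2 from rfl, show (1 : Fin 3) + 2 = 0 from rfl,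
    show (2 : Fin 3) + 1 = 0 from rfl, show (2 : Fin 3) + 2 = 1 from rfl, hw, map_smul]
    at e0 e1 e2 eω
  obtain ⟨γ, hγ⟩ : ∃ γ, γ * ℓ = (a + c) * (b - (d + 1) / 2) :=
    ⟨(a + c) * (b - (d + 1) / 2) / ℓ, div_mul_cancel₀ _ hℓ⟩
  refine ⟨γ, ?_, fun h => ?_⟩
  · have e0' : A 1 (A 2 w) = oddScalar d a b c 0 • w + A 0 w - (ℓ + 1 / 2) • A 2 w := by
      rw [← e0]; abel
    have e2' : A 1 (A 0 w) = oddScalar d a b c 2 • w + A 2 w - (ℓ + 1 / 2) • A 0 w := by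
      rw [← e2]; abel
    simp only [map_sub, map_add, map_smul, e0', e2', hw]
    match_scalars <;> first
      | ring1
      | (simp only [oddScalar, Matrix.cons_val]
         linear_combination -2 * hγ)
  · have hz : A 2 w = γ • w - A 0 w := by
      rw [sub_eq_zero] at h; rw [← h]; abel
    have ez : A 2 (A 2 w) = γ • A 2 w - A 2 (A 0 w) := by
      conv_lhs => rw [hz]
      rw [map_sub, map_smul]
    have ex : A 0 (A 2 w) = γ • A 0 w - A 0 (A 0 w) := by
      rw [hz, map_sub, map_smul]
    have : (oddCasimir d a b c - (ℓ + 1 / 2) ^ 2 + (ℓ + 1 / 2) + oddScalar d a b c 1 - γ ^ 2) • w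
        = 0 := by
      have k1 : A 0 (A 0 w) + A 2 (A 2 w) + A 2 (A 0 w) + A 0 (A 2 w) = (γ ^ 2) • w := by
        rw [ez, ex, hz]; module
      have k2 : A 0 (A 0 w) + A 2 (A 2 w) = oddCasimir d a b c • w - ((ℓ + 1 / 2) ^ 2) • w := by
        rw [← eω]; module
      have k3 : A 2 (A 0 w) + A 0 (A 2 w) = (ℓ + 1 / 2) • w + oddScalar d a b c 1 • w := by
        rw [← e1]; module
      calc _ = (A 0 (A 0 w) + A 2 (A 2 w)) + (A 2 (A 0 w) + A 0 (A 2 w)) - (γ ^ 2) • w := by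
            rw [k2, k3]; module
        _ = 0 := by rw [← k1]; abel
    have hs := (smul_eq_zero.1 this).resolve_right hw0
    have key : (ℓ - (a + c)) * (ℓ + (a + c)) * ((ℓ - (b - (d + 1) / 2)) *
        (ℓ + (b - (d + 1) / 2))) = 0 := by
      simp only [oddScalar, oddCasimir, Matrix.cons_val] at hs
      linear_combination (-ℓ ^ 2) * hs - (γ * ℓ + (a + c) * (b - (d + 1) / 2)) * hγ
    rcases mul_eq_zero.1 key with h | h <;> rcases mul_eq_zero.1 h with h | h
    · exact h1 (sub_eq_zero.1 h)
    · exact h2 (eq_neg_of_add_eq_zero_left h)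
    · exact h3 (sub_eq_zero.1 h)
    · exact h4 (eq_neg_of_add_eq_zero_left h)

/-- The first basis vector of `O_d(a,b,c)` generates it under `X`. -/
theorem eq_top_of_first_mem (U : Submodule ℂ (Fin (d + 1) → ℂ))
    (hU : ∀ v ∈ U, oddOp d a b c 0 v ∈ U)
    (h0 : (fun i : Fin (d + 1) => if (i : ℕ) = 0 then (1 : ℂ) else 0) ∈ U) : U = ⊤ := by
  have h : ∀ m < d + 1, (fun i : Fin (d + 1) => if (i : ℕ) = m then (1 : ℂ) else 0) ∈ U := by
    intro m hm
    induction m with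
    | zero => exact h0
    | succ m ih =>
      have h1 := ih (by omega)
      have h2 := U.sub_mem (hU _ h1) (U.smul_mem (oddTheta d a m) h1)
      rw [oddOp_zero d a b c (fun i => if i = m then (1 : ℂ) else 0)] at h2
      convert h2 using 1
      ext ⟨i, hi⟩
      rcases i with _ | i
      · by_cases hm0 : 0 = m
        · subst hm0; simp [seqX]
        · simp [seqX, hm0]
      · by_cases h3 : i + 1 = m
        · subst h3; simp [seqX]
        · simp [seqX, h3]
  refine (Submodule.eq_top_iff').2 fun v => ?_
  have : v = ∑ m : Fin (d + 1), v m • (fun i : Fin (d + 1) => if (i : ℕ) = m then (1 : ℂ) else 0) := by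
    ext i
    simp [Finset.sum_apply, ← Fin.ext_iff]
  rw [this]
  exact U.sum_mem fun m _ => U.smul_mem _ (h m m.2)

theorem eq_smul_first {w : Fin (d + 1) → ℂ} (hd : Even d)
    (hne : ∀ i ≤ d, i ≠ 0 → oddTheta d b i ≠ oddTheta d b 0)
    (hw : oddOp d a b c 1 w = oddTheta d b 0 • w) :
    w = w 0 • fun i : Fin (d + 1) => if (i : ℕ) = 0 then (1 : ℂ) else 0 := by
  obtain ⟨F, rfl⟩ := exists_seq w
  rw [oddOp_one hd] at hw
  have hi : ∀ i ≤ d, oddTheta d b i * F i + oddPhi d a b c (i + 1) * F (i + 1) =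
      oddTheta d b 0 * F i := fun i hi => congrFun hw ⟨i, Nat.lt_succ_iff.2 hi⟩
  have h : ∀ m i, i ≠ 0 → i ≤ d → d ≤ i + m → F i = 0 := by
    intro m
    induction m with
    | zero =>
      intro i h0 h1 h2
      have := hi i h1
      rw [show i = d by omega, oddPhi_last hd, zero_mul, add_zero] at this
      rw [show i = d by omega]
      by_contra hF
      exact hne d le_rfl (by omega) (mul_right_cancel₀ hF this)
    | succ m ih =>
      intro i h0 h1 h2
      have := hi i h1
      have hz : oddPhi d a b c (i + 1) * F (i + 1) = 0 := by
        rcases h1.eq_or_lt with rfl | h1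
        · rw [oddPhi_last hd, zero_mul]
        · rw [ih (i + 1) (by omega) (by omega) (by omega), mul_zero]
      rw [hz, add_zero] at this
      by_contra hF
      exact hne i h1 h0 (mul_right_cancel₀ hF this)
  ext ⟨i, hi⟩
  by_cases h0 : i = 0
  · subst h0; simp
  · simp [h0, h d i h0 (by omega) (by omega)]

/-- Conditions on real parameters under which `O_d(a,b,c)` is irreducible and `Y` acts on it with
simple spectrum. -/
structure OddRegular (d : ℕ) (a b c : ℝ) : Prop where
  abs_add_lt : |a + c| < 1 / 2 - b - d / 2
  abs_sub : |a - c| < 1 / 2 - b - d / 2 ∨ d / 2 - b - 1 / 2 < |a - c|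

theorem OddRegular.eq_bot_or_eq_top {d : ℕ} (hd : Even d) {a b c : ℝ} (h : OddRegular d a b c)
    (U : Submodule ℂ (Fin (d + 1) → ℂ)) (hU : ∀ i, ∀ v ∈ U, oddOp d a b c i v ∈ U) :
    U = ⊥ ∨ U = ⊤ := by
  by_cases hbot : U = ⊥
  · exact Or.inl hbot
  right
  have hneg : b + d / 2 - 1 / 2 < 0 := by linarith [h.abs_add_lt, abs_nonneg (a + c)]
  have hnt : Nontrivial U := (Submodule.nontrivial_iff_ne_bot).2 hbot
  have step : ∀ i ≤ d, ∀ w ∈ U, w ≠ 0 → oddOp d a b c 1 w = oddTheta d b i • w →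
      ∃ w ∈ U, w ≠ 0 ∧ oddOp d a b c 1 w = oddTheta d b 0 • w := by
    intro i
    induction i with
    | zero => exact fun _ w hw h0 h1 => ⟨w, hw, h0, h1⟩
    | succ i ih =>
      intro hi w hw hw0 h1
      have hid : (i : ℝ) + 1 ≤ d := by exact_mod_cast hi
      have hi0 : (0 : ℝ) ≤ i := Nat.cast_nonneg i
      set x : ℝ := b - d / 2 + i + 1 / 2 with hx
      have hx0 : x < 0 := by rw [hx]; linarith
      have hxc : (x : ℂ) ≠ 0 := by exact_mod_cast hx0.ne
      have habs := h.abs_add_lt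
      rcases Nat.even_or_odd i with hei | hoi
      · have hlt : (i : ℝ) + 2 ≤ d := by
          have : i + 1 ≠ d := fun hh => by simp [← hh, Nat.even_add_one, hei] at hd
          exact_mod_cast (show i + 2 ≤ d by omega)
        have hpar : (i : ℝ) ≠ -2 * b - 1 := by intro hb; linarith
        have hsub : x ≠ a - c ∧ x ≠ c - a := by
          rcases h.abs_sub with h | h
          · constructor <;> intro hh <;>
              linarith [le_abs_self (a - c), neg_abs_le (a - c)]
          · constructor <;> intro hh
            · have : |a - c| = -x := by rw [← hh, abs_of_neg hx0]
              linarith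
            · have : |a - c| = -x := by rw [← neg_sub, ← hh, abs_neg, abs_of_neg hx0]
              linarith
        obtain ⟨γ, hγ, hne⟩ := ladder_sub (cen_oddOp hd (a : ℂ) b c) (oddOp_casimir hd (a : ℂ) b c)
          (ℓ := -x) (neg_ne_zero.2 hxc) (fun hh => hsub.2 (by
            have : -x = a - c := by exact_mod_cast hh
            linarith)) (fun hh => hsub.1 (by
            have : -x = c - a := by exact_mod_cast hh
            linarith)) (fun hh => by
            have : -x = b + (d + 1) / 2 :=
              Complex.ofReal_injective (by push_cast; exact hh)
            exact hpar (by linarith)) (fun hh => by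
            have : -x = -(b + (d + 1) / 2) :=
              Complex.ofReal_injective (by push_cast; exact hh)
            linarith) (w := w) (by
            rw [h1]; congr 1
            rw [oddTheta, pow_succ, hei.neg_one_pow, hx]; push_cast; ring) hw0
        refine ih (by omega) _ (U.sub_mem (U.sub_mem (hU 0 w hw) (hU 2 w hw)) (U.smul_mem γ hw)) hne
          (hγ.trans ?_)
        congr 1
        rw [oddTheta, hei.neg_one_pow, hx]; push_cast; ring
      · have hi1 : (1 : ℝ) ≤ i := by exact_mod_cast hoi.pos
        obtain ⟨γ, hγ, hne⟩ := ladder_add (cen_oddOp hd (a : ℂ) b c) (oddOp_casimir hd (a : ℂ) b c)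
          (ℓ := x) hxc (fun hh => by
            have : x = a + c := by exact_mod_cast hh
            linarith [neg_abs_le (a + c)]) (fun hh => by
            have : x = -(a + c) := by exact_mod_cast hh
            linarith [le_abs_self (a + c)]) (fun hh => by
            have : x = b - (d + 1) / 2 :=
              Complex.ofReal_injective (by push_cast; exact hh)
            linarith) (fun hh => by
            have : x = -(b - (d + 1) / 2) :=
              Complex.ofReal_injective (by push_cast; exact hh)
            linarith) (w := w) (by
            rw [h1]; congr 1
            rw [oddTheta, pow_succ, hoi.neg_one_pow, hx]; push_cast; ring) hw0
        refine ih (by omega) _ (U.sub_mem (U.add_mem (hU 0 w hw) (hU 2 w hw)) (U.smul_mem γ hw)) hne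
          (hγ.trans ?_)
        congr 1
        rw [oddTheta, hoi.neg_one_pow, hx]; push_cast; ring
  obtain ⟨s, hs⟩ := Module.End.exists_eigenvalue ((oddOp d (a : ℂ) b c 1).restrict (hU 1))
  obtain ⟨w, hw⟩ := hs.exists_hasEigenvector
  have hw1 : oddOp d (a : ℂ) b c 1 w = s • (w : Fin (d + 1) → ℂ) :=
    congrArg Subtype.val hw.apply_eq_smul
  have hw0 : (w : Fin (d + 1) → ℂ) ≠ 0 := fun hh => hw.2 (Subtype.ext hh)
  have hroot : (oddPoly d (b : ℂ)).IsRoot s := by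
    have h1 : (oddOp d (a : ℂ) b c 1).charpoly = oddPoly d b := by
      simpa [oddPoly] using charpoly_smul_oddOp_one d (a : ℂ) b c 1
    rw [← h1, ← Module.End.hasEigenvalue_iff_isRoot_charpoly]
    exact Module.End.hasEigenvalue_of_hasEigenvector ⟨Module.End.mem_eigenspace_iff.2 hw1, hw0⟩
  obtain ⟨i, hi, rfl⟩ := oddPoly_isRoot_iff.1 hroot
  obtain ⟨w', hwU, hw'0, hw'⟩ := step i hi w w.2 hw0 hw1
  have hne : ∀ i ≤ d, i ≠ 0 → oddTheta d (b : ℂ) i ≠ oddTheta d b 0 := by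
    intro i hi h0 hh
    have hid : (i : ℝ) ≤ d := by exact_mod_cast hi
    have hi0 : (1 : ℝ) ≤ i := by exact_mod_cast Nat.pos_of_ne_zero h0
    rcases Nat.even_or_odd i with h | h
    · rw [oddTheta, oddTheta, h.neg_one_pow] at hh
      have : (1 : ℝ) * (2 * b - d + 2 * i) / 2 = (-1) ^ 0 * (2 * b - d + 2 * (0 : ℕ)) / 2 := by
        exact_mod_cast hh
      simp only [pow_zero, Nat.cast_zero] at this; linarith
    · rw [oddTheta, oddTheta, h.neg_one_pow] at hh
      have : (-1 : ℝ) * (2 * b - d + 2 * i) / 2 = (-1) ^ 0 * (2 * b - d + 2 * (0 : ℕ)) / 2 := by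
        exact_mod_cast hh
      simp only [pow_zero, Nat.cast_zero] at this; linarith
  have hfirst := eq_smul_first hd hne hw'
  refine eq_top_of_first_mem U (hU 0) ?_
  have hw00 : w' 0 ≠ 0 := fun hh => hw'0 (by rw [hfirst, hh, zero_smul])
  rw [hfirst] at hwU
  exact (U.smul_mem_iff hw00).1 hwU

end Simplicity

section Isomorphisms

open Polynomial

variable {d : ℕ} {a b c : ℂ}

/-- On `O_d(a,b,c)` the operator `Z` is similar to the operator `X` on `O_d(c,b,a)`. -/
theorem exists_equiv_swap (hd : Even d) (hb : ∀ i ≤ d, Even i → 2 * b + i + 1 ≠ 0) :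
    ∃ e : (Fin (d + 1) → ℂ) ≃ₗ[ℂ] (Fin (d + 1) → ℂ),
      ∀ v, e (oddOp d c b a 0 v) = oddOp d a b c 2 (e v) := by
  let A : Fin 3 → Module.End ℂ (Fin (d + 1) → ℂ) := ![oddOp d a b c 2, oddOp d a b c 1,
    oddOp d a b c 0]
  have hA : ∀ i, cen A i = oddScalar d c b a i • 1 := by
    have h := cen_oddOp hd a b c
    have h0 := h 0
    have h1 := h 1
    have h2 := h 2
    have comm : ∀ {P Q R : Module.End ℂ (Fin (d + 1) → ℂ)} {s t : ℂ},
        P * Q + Q * P - R = s • 1 → s = t → Q * P + P * Q - R = t • 1 := by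
      rintro P Q R s _ h rfl
      rw [← h, add_comm (Q * P)]
    intro i
    fin_cases i
    · exact comm h2 (by simp [oddScalar]; ring)
    · exact comm h1 (by simp [oddScalar]; ring)
    · exact comm h0 (by simp [oddScalar]; ring)
  let F : ℕ → ℂ := fun i => if i = 0 then 1 else 0
  let u : Fin (d + 1) → ℂ := fun i => F i
  have h0 : A 1 u = oddTheta d b 0 • u := by
    change oddOp d a b c 1 u = _
    rw [oddOp_one hd]
    ext ⟨i, hi⟩
    rcases i with _ | i <;> simp [seqY, F, u]
  have h1 : A 1 (chain (A 0) (oddTheta d c) u 1) =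
      oddTheta d b 1 • chain (A 0) (oddTheta d c) u 1 + oddPhi d c b a 1 • u := by
    simp only [chain, map_sub, map_smul, h0]
    change oddOp d a b c 1 (oddOp d a b c 2 u) - _ = oddTheta d b 1 • (oddOp d a b c 2 u - _) + _
    rw [oddOp_two hd, oddOp_one hd]
    ext ⟨i, hi⟩
    rcases i with _ | _ | _ | i
    · simp [seqX, seqY, seqZ, F, u, oddTheta, oddPhi, Nat.even_add_one]
      ring
    · simp [seqX, seqY, seqZ, F, u, oddTheta, oddPhi, Nat.even_add_one]
    · simp [seqX, seqY, seqZ, F, u]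
    · simp [seqX, seqY, seqZ, F, u]
  have hlast : chain (A 0) (oddTheta d c) u (d + 1) = 0 := by
    have h := chain_lowering hA h0 h1 d
    rw [oddPhi_last hd, zero_smul, add_zero] at h
    by_contra hne
    have hroot : (oddPoly d b).IsRoot (oddTheta d b (d + 1)) := by
      have h1 : (oddOp d a b c 1).charpoly = oddPoly d b := by
        simpa [oddPoly] using charpoly_smul_oddOp_one d a b c 1
      rw [← h1, ← Module.End.hasEigenvalue_iff_isRoot_charpoly]
      exact Module.End.hasEigenvalue_of_hasEigenvector ⟨Module.End.mem_eigenspace_iff.2 h, hne⟩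
    obtain ⟨i, hi, he⟩ := oddPoly_isRoot_iff.1 hroot
    rw [oddTheta, oddTheta, pow_succ, hd.neg_one_pow] at he
    rcases Nat.even_or_odd i with hp | hp
    · rw [hp.neg_one_pow] at he
      refine hb i hi hp ?_
      push_cast at he
      linear_combination -he
    · rw [hp.neg_one_pow] at he
      have : ((d + 1 : ℕ) : ℂ) = i := by push_cast at he ⊢; linear_combination -he
      have := Nat.cast_injective this
      omega
  obtain ⟨f, hfu, hf⟩ := exists_intertwiner hd hA h0 h1 hlast
  have hZ : ∀ v, f (oddOp d c b a 0 v) = oddOp d a b c 2 (f v) := hf 0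
  have hX : ∀ v, f (oddOp d c b a 2 v) = oddOp d a b c 0 (f v) := hf 2
  have hsurj : Function.Surjective f := by
    rw [← LinearMap.range_eq_top]
    refine eq_top_of_first_mem (d := d) (a := a) (b := b) (c := c) _ ?_ ⟨_, hfu⟩
    rintro _ ⟨v, rfl⟩
    exact ⟨_, hX v⟩
  exact ⟨LinearEquiv.ofBijective f ⟨LinearMap.injective_iff_surjective.2 hsurj, hsurj⟩, hZ⟩

theorem charpoly_smul_oddOp_two (hd : Even d) (hb : ∀ i ≤ d, Even i → 2 * b + i + 1 ≠ 0) (s : ℂ) :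
    (s • oddOp d a b c 2).charpoly =
      ∏ i ∈ Finset.range (d + 1), (X - C (s * oddTheta d c i)) := by
  obtain ⟨e, he⟩ := exists_equiv_swap (a := a) (c := c) hd hb
  rw [← charpoly_smul_oddOp_zero d c b a s, ← LinearEquiv.charpoly_conj e (s • oddOp d c b a 0)]
  congr 1
  refine LinearMap.ext fun v => ?_
  rw [LinearEquiv.conj_apply_apply]
  simp [he]

theorem OddRegular.exists_equiv {a b c : ℝ} (hd : Even d) (h : OddRegular d a b c)
    {A : Fin 3 → Module.End ℂ (Fin (d + 1) → ℂ)} (hA : ∀ i, cen A i = oddScalar d a b c i • 1)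
    (hX : (A 0).charpoly = oddPoly d a) (hY : (A 1).charpoly = oddPoly d b) :
    ∃ e : (Fin (d + 1) → ℂ) ≃ₗ[ℂ] (Fin (d + 1) → ℂ),
      ∀ i v, e (oddOp d a b c i v) = A i (e v) := by
  have heig : ∀ {s w}, A 1 w = s • w → w ≠ 0 → ∃ i ≤ d, s = oddTheta d (b : ℂ) i := by
    intro s w hw hne
    rw [← oddPoly_isRoot_iff, ← hY, ← Module.End.hasEigenvalue_iff_isRoot_charpoly]
    exact Module.End.hasEigenvalue_of_hasEigenvector ⟨Module.End.mem_eigenspace_iff.2 hw, hne⟩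
  obtain ⟨u, hu⟩ : ∃ u, Module.End.HasEigenvector (A 1) (oddTheta d (b : ℂ) 0) u := by
    refine Module.End.HasEigenvalue.exists_hasEigenvector ?_
    rw [Module.End.hasEigenvalue_iff_isRoot_charpoly, hY, oddPoly_isRoot_iff]
    exact ⟨0, Nat.zero_le _, rfl⟩
  have h0 := hu.apply_eq_smul
  have hprev : ∀ w, A 1 w = (1 - oddTheta d (b : ℂ) 0) • w → w = 0 := by
    intro w hw
    by_contra hne
    obtain ⟨i, hi, he⟩ := heig hw hne
    have hid : (i : ℝ) ≤ d := by exact_mod_cast hi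
    have hi0 : (0 : ℝ) ≤ i := Nat.cast_nonneg i
    have hneg : b + d / 2 - 1 / 2 < 0 := by linarith [h.abs_add_lt, abs_nonneg (a + c)]
    rw [oddTheta, oddTheta] at he
    have he' : 1 - (-1) ^ 0 * (2 * b - d + 2 * (0 : ℕ)) / 2 = (-1) ^ i * (2 * b - d + 2 * i) / 2 := by
      exact_mod_cast he
    rw [pow_zero, Nat.cast_zero] at he'
    rcases Nat.even_or_odd i with hp | hp
    · rw [hp.neg_one_pow] at he'; linarith
    · rw [hp.neg_one_pow] at he'; linarith
  have hlast : chain (A 0) (oddTheta d (a : ℂ)) u (d + 1) = 0 := by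
    rw [chain_eq_aeval]
    change aeval (A 0) (oddPoly d (a : ℂ)) u = 0
    rw [← hX, LinearMap.aeval_self_charpoly, LinearMap.zero_apply]
  obtain ⟨f, hfu, hf⟩ := exists_intertwiner hd hA h0 (chain_base hA h0 hprev) hlast
  have hinj : Function.Injective f := by
    rw [← LinearMap.ker_eq_bot]
    refine (h.eq_bot_or_eq_top hd (LinearMap.ker f) fun i v hv => ?_).resolve_right fun ht => ?_
    · rw [LinearMap.mem_ker] at hv ⊢
      rw [hf, hv, map_zero]
    · rw [LinearMap.ker_eq_top] at ht
      rw [ht] at hfu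
      exact hu.2 hfu.symm
  exact ⟨LinearEquiv.ofBijective f ⟨hinj, LinearMap.injective_iff_surjective.1 hinj⟩, hf⟩

/-- The parameters `a, b, c` are real and satisfy the conditions of `OddRegular`. -/
def IsOddRegular (d : ℕ) (a b c : ℂ) : Prop :=
  ∃ x y z : ℝ, a = x ∧ b = y ∧ c = z ∧ OddRegular d x y z

theorem OddModule.gen_smul_eq (hd : Even d) (i : Fin 3) (v : OddModule d hd a b c) :
    BI.gen i • v = oddOp d a b c i v :=
  OddModule.gen_smul d hd a b c i v

theorem IsOddRegular.isSimpleModule (hd : Even d) (h : IsOddRegular d a b c) :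
    IsSimpleModule BI (OddModule d hd a b c) := by
  obtain ⟨a, b, c, rfl, rfl, rfl, h⟩ := h
  have : Nontrivial (OddModule d hd (a : ℂ) b c) :=
    inferInstanceAs (Nontrivial (Fin (d + 1) → ℂ))
  refine isSimpleModule_iff _ _ |>.2 ⟨fun U => ?_⟩
  have key : ∀ i, ∀ v : OddModule d hd (a : ℂ) b c, v ∈ U → BI.gen i • v ∈ U :=
    fun i v hv => U.smul_mem _ hv
  simp only [OddModule.gen_smul_eq] at key
  exact (h.eq_bot_or_eq_top hd (U.restrictScalars ℂ) key).imp
    (fun h => (Submodule.restrictScalars_eq_bot_iff ..).1 h)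
    (fun h => (Submodule.restrictScalars_eq_top_iff ..).1 h)

theorem IsOddRegular.nonempty_equiv_twist (hd : Even d) (h : IsOddRegular d a b c) {a' b' c' : ℂ}
    {g : BI ≃ₐ[ℂ] BI} {σ : Fin 3 → ℂ} {τ : Fin 3 → Fin 3} (m : Fin 3)
    (hg : ∀ i, g (BI.gen i) = σ (τ i) • BI.gen (τ i)) (hτ : ∀ i, τ i + m = i)
    (hσ : ∀ i, σ (i + 1) * σ (i + 2) = σ i) (hσ' : ∀ i, σ i * σ i = 1)
    (hs : ∀ i, σ i * oddScalar d a' b' c' (i + m) = oddScalar d a b c i)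
    (hX : (σ 0 • oddOp d a' b' c' (0 + m)).charpoly = oddPoly d a)
    (hY : (σ 1 • oddOp d a' b' c' (1 + m)).charpoly = oddPoly d b) :
    Nonempty (Twist g (OddModule d hd a b c) ≃ₗ[BI] OddModule d hd a' b' c') := by
  obtain ⟨a, b, c, rfl, rfl, rfl, h⟩ := h
  have hA : ∀ i, cen (fun j => σ j • oddOp d a' b' c' (j + m)) i = oddScalar d a b c i • 1 := by
    intro i
    have h1 := cen_oddOp hd a' b' c' (i + m)
    rw [← hs, mul_smul, ← h1]
    simp only [cen, smul_mul_smul_comm, hσ, mul_comm (σ (i + 2)), smul_sub, smul_add,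
      add_right_comm i _ m]
  obtain ⟨e, he⟩ := h.exists_equiv hd hA hX hY
  let f : Twist g (OddModule d hd (a : ℂ) b c) →ₗ[ℂ] OddModule d hd a' b' c' := e.toLinearMap
  refine BI.nonempty_linearEquiv f (fun i v => ?_) e.bijective
  have key : ∀ v : Fin (d + 1) → ℂ, e (σ (τ i) • oddOp d a b c (τ i) v) = oddOp d a' b' c' i (e v) := by
    intro v
    rw [map_smul, he, LinearMap.smul_apply, smul_smul, hσ', one_smul, hτ]
  have hgv : ∀ v : OddModule d hd (a : ℂ) b c, g (BI.gen i) • v = σ (τ i) • oddOp d a b c (τ i) v := by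
    intro v
    rw [hg, smul_assoc, OddModule.gen_smul_eq]
    rfl
  rw [OddModule.gen_smul_eq]
  exact (congrArg e (hgv v)).trans (key v)

end Isomorphisms

section Coefficients

open Complex MvPolynomial

theorem coeff_reflect (i : Fin 3) (α : Fin 3 →₀ ℕ) (p : Poly) :
    coeff α (reflect i p) = (-1) ^ α i * coeff α p := by
  have : (lcoeff ℝ α) ∘ₗ reflect i = ((-1 : ℝ) ^ α i) • lcoeff ℝ α := by
    refine (basisMonomials (Fin 3) ℝ).ext fun β => ?_
    simp only [coe_basisMonomials, LinearMap.comp_apply, reflect_monomial, LinearMap.smul_apply,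
      lcoeff_apply, coeff_monomial]
    split_ifs with h
    · rw [h]; simp
    · simp
  exact LinearMap.congr_fun this p

theorem coeff_dunkl (k : Fin 3 → ℝ) (i : Fin 3) (α : Fin 3 →₀ ℕ) (p : Poly) :
    coeff α (dunkl k i p) = dunklCoeff (k i) (α i + 1) * coeff (α + Finsupp.single i 1) p := by
  have : (lcoeff ℝ α) ∘ₗ dunkl k i =
      (dunklCoeff (k i) (α i + 1)) • lcoeff ℝ (α + Finsupp.single i 1) := by
    refine (basisMonomials (Fin 3) ℝ).ext fun β => ?_
    simp only [coe_basisMonomials, LinearMap.comp_apply, dunkl_monomial, LinearMap.smul_apply,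
      lcoeff_apply, coeff_monomial, smul_eq_mul, mul_one]
    by_cases h : β = α + Finsupp.single i 1
    · subst h; simp
    · rw [if_neg h, mul_zero]
      by_cases h0 : β i = 0
      · rw [h0, dunklCoeff_zero, ite_self]
      · rw [if_neg]
        intro h'
        exact h (by rw [← h', tsub_add_single h0])
  exact LinearMap.congr_fun this p

/-- The coefficient in `ℂ²` of a monomial in a spinor-valued polynomial. -/
noncomputable def coef (α : Fin 3 →₀ ℕ) : Spinor →ₗ[ℂ] (Fin 2 → ℂ) :=
  ((TensorProduct.AlgebraTensorModule.rid ℝ ℂ (Fin 2 → ℂ)).toLinearMap ∘ₗ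
    TensorProduct.AlgebraTensorModule.map LinearMap.id (lcoeff ℝ α) :
      (Fin 2 → ℂ) ⊗[ℝ] Poly →ₗ[ℂ] (Fin 2 → ℂ))

theorem coef_pure (α : Fin 3 →₀ ℕ) (v : Fin 2 → ℂ) (p : Poly) :
    coef α (pureTensor v p) = ((coeff α p : ℝ) : ℂ) • v := by
  have h : TensorProduct.AlgebraTensorModule.rid ℝ ℂ (Fin 2 → ℂ)
      (TensorProduct.AlgebraTensorModule.map (LinearMap.id (R := ℂ)) (lcoeff ℝ α) (v ⊗ₜ[ℝ] p)) =
        (coeff α p : ℝ) • v := by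
    rw [TensorProduct.AlgebraTensorModule.map_tmul, TensorProduct.AlgebraTensorModule.rid_tmul]
    rfl
  refine Eq.trans h ?_
  ext i
  simp

theorem spinor_induction {P : Spinor → Prop} (f : Spinor) (zero : P 0)
    (pure : ∀ v p, P (pureTensor v p)) (add : ∀ f g, P f → P g → P (f + g)) : P f :=
  TensorProduct.induction_on f zero pure add

theorem exists_eq_sum (f : Spinor) : ∃ s : Finset (Fin 3 →₀ ℕ), ∀ t, s ⊆ t →
    f = ∑ α ∈ t, pureTensor (coef α f) (monomial α (1 : ℝ)) := by
  classical
  induction f using spinor_induction with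
  | zero =>
    refine ⟨∅, fun t _ => ?_⟩
    rw [Finset.sum_eq_zero]
    intro α _
    rw [map_zero]
    exact TensorProduct.zero_tmul _ _
  | pure v p =>
    refine ⟨p.support, fun t ht => ?_⟩
    simp only [coef_pure, ← smul_pure, ← pure_smul, smul_monomial, smul_eq_mul, mul_one]
    have h : p = ∑ α ∈ t, monomial α (coeff α p : ℝ) := by
      conv_lhs => rw [p.as_sum]
      exact Finset.sum_subset ht fun α _ hα => by simp [notMem_support_iff.1 hα]
    conv_lhs => rw [h]
    exact TensorProduct.tmul_sum _ _ _
  | add f g hf hg =>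
    obtain ⟨s, hs⟩ := hf
    obtain ⟨t, ht⟩ := hg
    refine ⟨s ∪ t, fun u hu => ?_⟩
    conv_lhs => rw [hs u (Finset.union_subset_left hu), ht u (Finset.union_subset_right hu),
      ← Finset.sum_add_distrib]
    refine Finset.sum_congr rfl fun α _ => ?_
    rw [map_add]
    exact (TensorProduct.add_tmul _ _ _).symm

theorem coef_ext {f g : Spinor} (h : ∀ α, coef α f = coef α g) : f = g := by
  classical
  obtain ⟨s, hs⟩ := exists_eq_sum f
  obtain ⟨t, ht⟩ := exists_eq_sum g
  rw [hs (s ∪ t) Finset.subset_union_left, ht (s ∪ t) Finset.subset_union_right]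
  exact Finset.sum_congr rfl fun α _ => by rw [h]

theorem mem_tens_monoSpan_iff {j : Fin 3} {t : ℕ∞} {n : ℕ} {f : Spinor} :
    f ∈ tens (monoSpan j t n) ↔ ∀ α, coef α f ≠ 0 → α.degree = n ∧ t ≤ (α j : ℕ) := by
  constructor
  · intro hf
    induction hf using Submodule.span_induction with
    | mem f hf =>
      obtain ⟨v, p, hp, rfl⟩ := hf
      intro α hα
      rw [coef_pure] at hα
      have hα' : coeff α p ≠ 0 := fun h => hα (by rw [h]; simp)
      clear hα
      induction hp using Submodule.span_induction with
      | mem p hp =>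
        obtain ⟨β, h1, h2, rfl⟩ := hp
        rw [coeff_monomial] at hα'
        have : β = α := by by_contra h; simp [h] at hα'
        exact this ▸ ⟨h1, h2⟩
      | zero => simp at hα'
      | add p q _ _ hp hq =>
        by_cases h : coeff α p = 0
        · refine hq fun h' => hα' ?_
          rw [coeff_add, h, h', add_zero]
        · exact hp h
      | smul c p _ hp =>
        refine hp fun h => hα' ?_
        rw [coeff_smul, h, smul_zero]
    | zero => intro α hα; simp at hα
    | add f g _ _ hf hg =>
      intro α hα
      by_cases h : coef α f = 0
      · refine hg α fun h' => hα ?_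
        rw [map_add, h, h', add_zero]
      · exact hf α h
    | smul c f _ hf =>
      intro α hα
      refine hf α fun h => hα ?_
      rw [map_smul, h, smul_zero]
  · intro h
    obtain ⟨s, hs⟩ := exists_eq_sum f
    rw [hs s subset_rfl]
    refine Submodule.sum_mem _ fun α _ => ?_
    by_cases h0 : coef α f = 0
    · rw [h0]
      have : pureTensor 0 (monomial α (1 : ℝ)) = 0 := TensorProduct.zero_tmul _ _
      rw [this]
      exact zero_mem _
    · exact pure_mem_tens _ (monomial_mem_monoSpan (h α h0).1 (h α h0).2 1)

theorem coef_op {A : Matrix (Fin 2) (Fin 2) ℂ} {S : Module.End ℝ Poly} {α β : Fin 3 →₀ ℕ} {c : ℝ}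
    (h : ∀ p, coeff α (S p) = c * coeff β p) (f : Spinor) :
    coef α (op A S f) = (c : ℂ) • A.mulVec (coef β f) := by
  induction f using spinor_induction with
  | zero => simp
  | pure v p =>
    rw [op_pure, coef_pure, coef_pure, h, Matrix.mulVec_smul, smul_smul]
    push_cast; rfl
  | add f g hf hg => rw [map_add, map_add, map_add, hf, hg, Matrix.mulVec_add, smul_add]

theorem coef_pauli (i : Fin 3) (α : Fin 3 →₀ ℕ) (f : Spinor) :
    coef α (op (pauli i) 1 f) = (pauli i).mulVec (coef α f) := by
  rw [coef_op (β := α) (c := 1) (by simp)]; simp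

theorem coef_mulX_add (i : Fin 3) (α : Fin 3 →₀ ℕ) (f : Spinor) :
    coef (α + Finsupp.single i 1) (op 1 (mulX i) f) = coef α f := by
  rw [coef_op (β := α) (c := 1) (fun p => by simp [mulX, add_comm α])]; simp

theorem coef_mulX_of_eq_zero {i : Fin 3} {α : Fin 3 →₀ ℕ} (h : α i = 0) (f : Spinor) :
    coef α (op 1 (mulX i) f) = 0 := by
  rw [coef_op (β := α) (c := 0) (fun p => by simp [mulX, coeff_X_mul', h])]; simp

theorem coef_dunkl (k : Fin 3 → ℝ) (i : Fin 3) (α : Fin 3 →₀ ℕ) (f : Spinor) :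
    coef α (op 1 (dunkl k i) f) =
      (dunklCoeff (k i) (α i + 1) : ℂ) • coef (α + Finsupp.single i 1) f := by
  rw [coef_op (coeff_dunkl k i α), Matrix.one_mulVec]

theorem coef_reflect (i : Fin 3) (α : Fin 3 →₀ ℕ) (f : Spinor) :
    coef α (op 1 (reflect i) f) = (-1 : ℂ) ^ α i • coef α f := by
  rw [coef_op (coeff_reflect i α), Matrix.one_mulVec]; push_cast; rfl

theorem genOp_apply (k : Fin 3 → ℝ) (i : Fin 3) (f : Spinor) :
    genOp k i f =
      I • op (pauli i) 1 (op 1 (mulX (i + 2)) (op 1 (dunkl k (i + 1))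
          (op 1 (reflect (i + 1)) (op 1 (reflect (i + 2)) f))) -
        op 1 (mulX (i + 1)) (op 1 (dunkl k (i + 2))
          (op 1 (reflect (i + 1)) (op 1 (reflect (i + 2)) f)))) +
      ((1 / 2 : ℂ) • op 1 (reflect (i + 1)) (op 1 (reflect (i + 2)) f) +
        (k (i + 1) : ℂ) • op 1 (reflect (i + 2)) f + (k (i + 2) : ℂ) • op 1 (reflect (i + 1)) f) := by
  rw [genOp_eq]
  simp only [abstractGen, LinearMap.add_apply, LinearMap.smul_apply, Module.End.mul_apply,
    LinearMap.sub_apply]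

/-- The exponent of `x_{j+1}^m x_{j+2}^a x_j^b`. -/
noncomputable def expo (j : Fin 3) (m a b : ℕ) : Fin 3 →₀ ℕ :=
  Finsupp.single (j + 1) m + Finsupp.single (j + 2) a + Finsupp.single j b

variable (j : Fin 3) (m a b : ℕ)

theorem fin_three_ne : j + 1 ≠ j ∧ j + 2 ≠ j ∧ j + 1 ≠ j + 2 := by revert j; decide

theorem expo_zero : expo j m a b j = b := by
  obtain ⟨h1, h2, h3⟩ := fin_three_ne j
  simp [expo, Finsupp.single_apply, h1, h2, h3]

theorem expo_one : expo j m a b (j + 1) = m := by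
  obtain ⟨h1, h2, h3⟩ := fin_three_ne j
  simp [expo, Finsupp.single_apply, h1.symm, h2, h3.symm]

theorem expo_two : expo j m a b (j + 2) = a := by
  obtain ⟨h1, h2, h3⟩ := fin_three_ne j
  simp [expo, Finsupp.single_apply, h1, h2.symm, h3]

theorem expo_add_zero : expo j m a b + Finsupp.single j 1 = expo j m a (b + 1) := by
  simp [expo, Finsupp.single_add, add_assoc]

theorem expo_add_one : expo j m a b + Finsupp.single (j + 1) 1 = expo j (m + 1) a b := by
  simp only [expo, Finsupp.single_add]; abel

theorem expo_add_two : expo j m a b + Finsupp.single (j + 2) 1 = expo j m (a + 1) b := by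
  simp only [expo, Finsupp.single_add]; abel

theorem degree_expo : (expo j m a b).degree = m + a + b := by
  simp [expo]

theorem eq_expo (α : Fin 3 →₀ ℕ) : α = expo j (α (j + 1)) (α (j + 2)) (α j) := by
  have hj : ∀ j i : Fin 3, i = j ∨ i = j + 1 ∨ i = j + 2 := by decide
  ext i
  rcases hj j i with rfl | rfl | rfl
  · rw [expo_zero]
  · rw [expo_one]
  · rw [expo_two]

variable {j m a b}

theorem coef_mulX_expo_zero (f : Spinor) :
    coef (expo j m a b) (op 1 (mulX j) f) = if b = 0 then 0 else coef (expo j m a (b - 1)) f := by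
  split_ifs with h
  · exact coef_mulX_of_eq_zero (by rw [expo_zero, h]) f
  · obtain ⟨b, rfl⟩ := Nat.exists_eq_succ_of_ne_zero h
    rw [← expo_add_zero, coef_mulX_add]; rfl

theorem coef_mulX_expo_one (f : Spinor) :
    coef (expo j 0 a b) (op 1 (mulX (j + 1)) f) = 0 :=
  coef_mulX_of_eq_zero (by rw [expo_one]) f

theorem coef_mulX_expo_two (f : Spinor) :
    coef (expo j m a b) (op 1 (mulX (j + 2)) f) =
      if a = 0 then 0 else coef (expo j m (a - 1) b) f := by
  split_ifs with h
  · exact coef_mulX_of_eq_zero (by rw [expo_two, h]) f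
  · obtain ⟨a, rfl⟩ := Nat.exists_eq_succ_of_ne_zero h
    rw [← expo_add_two, coef_mulX_add]; rfl

theorem coef_dunkl_expo_zero (k : Fin 3 → ℝ) (f : Spinor) :
    coef (expo j m a b) (op 1 (dunkl k j) f) =
      (dunklCoeff (k j) (b + 1) : ℂ) • coef (expo j m a (b + 1)) f := by
  rw [coef_dunkl, expo_zero, expo_add_zero]

theorem coef_dunkl_expo_one (k : Fin 3 → ℝ) (f : Spinor) :
    coef (expo j m a b) (op 1 (dunkl k (j + 1)) f) =
      (dunklCoeff (k (j + 1)) (m + 1) : ℂ) • coef (expo j (m + 1) a b) f := by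
  rw [coef_dunkl, expo_one, expo_add_one]

theorem coef_dunkl_expo_two (k : Fin 3 → ℝ) (f : Spinor) :
    coef (expo j m a b) (op 1 (dunkl k (j + 2)) f) =
      (dunklCoeff (k (j + 2)) (a + 1) : ℂ) • coef (expo j m (a + 1) b) f := by
  rw [coef_dunkl, expo_two, expo_add_two]

theorem coef_reflect_expo_zero (f : Spinor) :
    coef (expo j m a b) (op 1 (reflect j) f) = (-1 : ℂ) ^ b • coef (expo j m a b) f := by
  rw [coef_reflect, expo_zero]

theorem coef_reflect_expo_one (f : Spinor) :
    coef (expo j m a b) (op 1 (reflect (j + 1)) f) = (-1 : ℂ) ^ m • coef (expo j m a b) f := by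
  rw [coef_reflect, expo_one]

theorem coef_reflect_expo_two (f : Spinor) :
    coef (expo j m a b) (op 1 (reflect (j + 2)) f) = (-1 : ℂ) ^ a • coef (expo j m a b) f := by
  rw [coef_reflect, expo_two]

theorem diracDunkl_rotate (k : Fin 3 → ℝ) (j : Fin 3) :
    diracDunkl k = op (pauli (j + 1)) 1 * op 1 (dunkl k (j + 1)) +
      op (pauli (j + 2)) 1 * op 1 (dunkl k (j + 2)) + op (pauli j) 1 * op 1 (dunkl k j) := by
  rw [diracDunkl_eq]
  fin_cases j
  · change _ = op (pauli 1) 1 * op 1 (dunkl k 1) +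
      op (pauli 2) 1 * op 1 (dunkl k 2) + op (pauli 0) 1 * op 1 (dunkl k 0)
    simp only [abstractDirac]; abel
  · change _ = op (pauli 2) 1 * op 1 (dunkl k 2) +
      op (pauli 0) 1 * op 1 (dunkl k 0) + op (pauli 1) 1 * op 1 (dunkl k 1)
    simp only [abstractDirac]; abel
  · change _ = op (pauli 0) 1 * op 1 (dunkl k 0) +
      op (pauli 1) 1 * op 1 (dunkl k 1) + op (pauli 2) 1 * op 1 (dunkl k 2)
    simp only [abstractDirac]

theorem coef_diracDunkl (k : Fin 3 → ℝ) (f : Spinor) :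
    coef (expo j m a b) (diracDunkl k f) =
      (dunklCoeff (k (j + 1)) (m + 1) : ℂ) • (pauli (j + 1)).mulVec (coef (expo j (m + 1) a b) f) +
      (dunklCoeff (k (j + 2)) (a + 1) : ℂ) • (pauli (j + 2)).mulVec (coef (expo j m (a + 1) b) f) +
      (dunklCoeff (k j) (b + 1) : ℂ) • (pauli j).mulVec (coef (expo j m a (b + 1)) f) := by
  rw [diracDunkl_rotate k j]
  simp only [LinearMap.add_apply, Module.End.mul_apply, map_add, coef_pauli, coef_dunkl_expo_zero,
    coef_dunkl_expo_one, coef_dunkl_expo_two, Matrix.mulVec_smul]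

end Coefficients

section CauchyKovalevskaya

open Complex MvPolynomial

theorem pauli_mul_self (i : Fin 3) : pauli i * pauli i = 1 := by
  fin_cases i <;> ext a b <;> fin_cases a <;> fin_cases b <;> simp [pauli]

theorem pauli_zero_one (j : Fin 3) : pauli j * pauli (j + 1) = I • pauli (j + 2) := by
  fin_cases j <;> ext a b <;> fin_cases a <;> fin_cases b <;> simp [pauli]

theorem pauli_two_zero (j : Fin 3) : pauli (j + 2) * pauli j = I • pauli (j + 1) := by
  fin_cases j <;> ext a b <;> fin_cases a <;> fin_cases b <;> simp [pauli]

theorem pauli_zero_two (j : Fin 3) : pauli j * pauli (j + 2) = (-I) • pauli (j + 1) := by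
  fin_cases j <;> ext a b <;> fin_cases a <;> fin_cases b <;> simp [pauli]

theorem pauli_two_one (j : Fin 3) : pauli (j + 2) * pauli (j + 1) = (-I) • pauli j := by
  fin_cases j <;> ext a b <;> fin_cases a <;> fin_cases b <;> simp [pauli]

/-- The Pauli matrices are diagonalizable with eigenvalues `1` and `-1`. -/
theorem exists_pauli_diag (p : Fin 3) : ∃ Q : (Fin 2 → ℂ) ≃ₗ[ℂ] ℂ × ℂ,
    ∀ v, Q ((pauli p).mulVec v) = ((Q v).1, -(Q v).2) := by
  have hI : I * I = -1 := I_mul_I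
  have build : ∀ (x y z w : ℂ) (_ : x * w - y * z ≠ 0), ∃ Q : (Fin 2 → ℂ) ≃ₗ[ℂ] ℂ × ℂ,
      ∀ v, Q v = (x * v 0 + y * v 1, z * v 0 + w * v 1) := by
    intro x y z w h
    let f : (Fin 2 → ℂ) →ₗ[ℂ] ℂ × ℂ :=
      { toFun := fun v => (x * v 0 + y * v 1, z * v 0 + w * v 1)
        map_add' := fun u v => by simp; constructor <;> ring
        map_smul' := fun c v => by simp; constructor <;> ring }
    have hf : Function.Injective f := by
      rw [injective_iff_map_eq_zero]
      intro v hv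
      have h1 : x * v 0 + y * v 1 = 0 := congrArg Prod.fst hv
      have h2 : z * v 0 + w * v 1 = 0 := congrArg Prod.snd hv
      have h3 : v 0 = 0 := (mul_eq_zero.1 (show (x * w - y * z) * v 0 = 0 by
        linear_combination w * h1 - y * h2)).resolve_left h
      have h4 : v 1 = 0 := (mul_eq_zero.1 (show (x * w - y * z) * v 1 = 0 by
        linear_combination x * h2 - z * h1)).resolve_left h
      ext i; fin_cases i
      · exact h3
      · exact h4
    exact ⟨LinearEquiv.ofInjectiveOfFinrankEq f hf (by simp), fun v => rfl⟩
  fin_cases p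
  · obtain ⟨Q, hQ⟩ := build 1 1 1 (-1) (by norm_num)
    refine ⟨Q, fun v => ?_⟩
    simp [hQ, pauli, Matrix.mulVec, dotProduct, Fin.sum_univ_two]
    ring
  · obtain ⟨Q, hQ⟩ := build 1 (-I) 1 I (by
      intro h
      have : (2 : ℂ) * I = 0 := by linear_combination h
      simp at this)
    refine ⟨Q, fun v => ?_⟩
    simp [hQ, pauli, Matrix.mulVec, dotProduct, Fin.sum_univ_two]
    constructor
    · linear_combination (-v 0) * hI
    · linear_combination (v 0) * hI
  · obtain ⟨Q, hQ⟩ := build 1 0 0 1 (by norm_num)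
    refine ⟨Q, fun v => ?_⟩
    simp [hQ, pauli, Matrix.mulVec, dotProduct, Fin.sum_univ_two]

variable {k : Fin 3 → ℝ} {n : ℕ} {f : Spinor}

theorem mem_monogenics_iff (j : Fin 3) : f ∈ monogenics k n ↔
    (∀ α, coef α f ≠ 0 → α.degree = n) ∧ ∀ m a b,
      (dunklCoeff (k (j + 1)) (m + 1) : ℂ) • (pauli (j + 1)).mulVec (coef (expo j (m + 1) a b) f) +
      (dunklCoeff (k (j + 2)) (a + 1) : ℂ) • (pauli (j + 2)).mulVec (coef (expo j m (a + 1) b) f) +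
      (dunklCoeff (k j) (b + 1) : ℂ) • (pauli j).mulVec (coef (expo j m a (b + 1)) f) = 0 := by
  rw [monogenics, Submodule.mem_inf, and_comm, homogeneousSubmodule_eq_monoSpan,
    mem_tens_monoSpan_iff, LinearMap.mem_ker]
  refine and_congr (by simp) ⟨fun h m a b => ?_, fun h => coef_ext fun α => ?_⟩
  · rw [← coef_diracDunkl, h, map_zero]
  · rw [eq_expo j α, coef_diracDunkl, h, map_zero]

/-- If the restriction of a monogenic to `x_{j+1} = 0` has no terms with exponent of `x_j` in a set
that is stable under the Dunkl operator, then neither has the monogenic itself. -/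
theorem coef_eq_zero_of_restrict (j : Fin 3) (hf : f ∈ monogenics k n)
    (hp : ∀ m, 0 < m → m ≤ n → dunklCoeff (k (j + 1)) m ≠ 0) {S : ℕ → Prop}
    (hS : ∀ b, S b → S (b + 1) ∨ dunklCoeff (k j) (b + 1) = 0)
    (h0 : ∀ a b, S b → coef (expo j 0 a b) f = 0) (m : ℕ) :
    ∀ a b, S b → coef (expo j m a b) f = 0 := by
  obtain ⟨hdeg, hD⟩ := (mem_monogenics_iff j).1 hf
  induction m with
  | zero => exact h0
  | succ m ih =>
    intro a b hb
    by_cases hm : m + 1 ≤ n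
    · have h := hD m a b
      have h2 : (dunklCoeff (k j) (b + 1) : ℂ) • (pauli j).mulVec (coef (expo j m a (b + 1)) f)
          = 0 := by
        rcases hS b hb with h | h
        · rw [ih a (b + 1) h, Matrix.mulVec_zero, smul_zero]
        · rw [h, ofReal_zero, zero_smul]
      rw [h2, ih (a + 1) b hb, Matrix.mulVec_zero, smul_zero, add_zero, add_zero, smul_eq_zero] at h
      have h3 := h.resolve_left (by exact_mod_cast hp (m + 1) (by omega) hm)
      have h4 := congrArg (pauli (j + 1)).mulVec h3
      rwa [Matrix.mulVec_mulVec, pauli_mul_self, Matrix.one_mulVec, Matrix.mulVec_zero] at h4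
    · by_contra hne
      have := hdeg _ hne
      rw [degree_expo] at this
      omega

/-- The coefficients of the monogenic extension of a spinor-valued polynomial in `x_{j+2}, x_j`. -/
noncomputable def ckCoef (k : Fin 3 → ℝ) (j : Fin 3) (c : ℕ → ℕ → Fin 2 → ℂ) :
    ℕ → ℕ → ℕ → Fin 2 → ℂ
  | 0 => c
  | m + 1 => fun a b => -((dunklCoeff (k (j + 1)) (m + 1) : ℂ)⁻¹ • (pauli (j + 1)).mulVec
      ((dunklCoeff (k (j + 2)) (a + 1) : ℂ) • (pauli (j + 2)).mulVec (ckCoef k j c m (a + 1) b) +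
      (dunklCoeff (k j) (b + 1) : ℂ) • (pauli j).mulVec (ckCoef k j c m a (b + 1))))

theorem ckCoef_eq_zero (j : Fin 3) {c : ℕ → ℕ → Fin 2 → ℂ}
    (hc : ∀ a b, a + b ≠ n → c a b = 0) (m : ℕ) :
    ∀ a b, m + a + b ≠ n → ckCoef k j c m a b = 0 := by
  induction m with
  | zero => exact fun a b h => hc a b (by omega)
  | succ m ih =>
    intro a b h
    simp [ckCoef, ih (a + 1) b (by omega), ih a (b + 1) (by omega)]

/-- The Cauchy–Kovalevskaya extension: any homogeneous spinor-valued polynomial in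
`x_{j+2}, x_j` is the restriction of a monogenic to `x_{j+1} = 0`. -/
theorem exists_monogenic (j : Fin 3) (hp : ∀ m, 0 < m → m ≤ n → dunklCoeff (k (j + 1)) m ≠ 0)
    {c : ℕ → ℕ → Fin 2 → ℂ} (hc : ∀ a b, a + b ≠ n → c a b = 0) :
    ∃ f ∈ monogenics k n, ∀ a b, coef (expo j 0 a b) f = c a b := by
  classical
  let G := ckCoef k j c
  let R := Finset.range (n + 1)
  have hG := ckCoef_eq_zero (k := k) j hc
  let f : Spinor := ∑ x ∈ R ×ˢ R ×ˢ R,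
    pureTensor (G x.1 x.2.1 x.2.2) (monomial (expo j x.1 x.2.1 x.2.2) (1 : ℝ))
  have hcoef : ∀ m a b, coef (expo j m a b) f = G m a b := by
    intro m a b
    have hterm : ∀ x : ℕ × ℕ × ℕ, coef (expo j m a b)
        (pureTensor (G x.1 x.2.1 x.2.2) (monomial (expo j x.1 x.2.1 x.2.2) (1 : ℝ))) =
        if x = (m, a, b) then G m a b else 0 := by
      rintro ⟨m', a', b'⟩
      rw [coef_pure, coeff_monomial]
      by_cases h : (m', a', b') = (m, a, b)
      · obtain ⟨rfl, rfl, rfl⟩ : m' = m ∧ a' = a ∧ b' = b := by simpa using h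
        simp
      · rw [if_neg h, if_neg, ofReal_zero, zero_smul]
        intro he
        refine h ?_
        have h0 := DFunLike.congr_fun he j
        have h1 := DFunLike.congr_fun he (j + 1)
        have h2 := DFunLike.congr_fun he (j + 2)
        rw [expo_zero, expo_zero] at h0
        rw [expo_one, expo_one] at h1
        rw [expo_two, expo_two] at h2
        simp only at h0 h1 h2
        rw [h0, h1, h2]
    rw [map_sum, Finset.sum_congr rfl fun x _ => hterm x, Finset.sum_ite_eq']
    split_ifs with h
    · rfl
    · refine (hG m a b fun hs => h ?_).symm
      simp only [R, Finset.mem_product, Finset.mem_range]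
      omega
  refine ⟨f, (mem_monogenics_iff j).2 ⟨fun α hα => ?_, fun m a b => ?_⟩, hcoef 0⟩
  · rw [eq_expo j α, hcoef] at hα
    rw [eq_expo j α, degree_expo]
    by_contra h
    exact hα (hG _ _ _ h)
  · simp only [hcoef]
    by_cases hm : m + 1 ≤ n
    · have hne : (dunklCoeff (k (j + 1)) (m + 1) : ℂ) ≠ 0 := by
        exact_mod_cast hp (m + 1) (by omega) hm
      have : G (m + 1) a b = -((dunklCoeff (k (j + 1)) (m + 1) : ℂ)⁻¹ • (pauli (j + 1)).mulVec
        ((dunklCoeff (k (j + 2)) (a + 1) : ℂ) • (pauli (j + 2)).mulVec (G m (a + 1) b) +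
        (dunklCoeff (k j) (b + 1) : ℂ) • (pauli j).mulVec (G m a (b + 1)))) := rfl
      rw [this, Matrix.mulVec_neg, Matrix.mulVec_smul, Matrix.mulVec_mulVec, pauli_mul_self,
        Matrix.one_mulVec, smul_neg, smul_smul, mul_inv_cancel₀ hne, one_smul]
      abel
    · have h1 : G (m + 1) a b = 0 := hG _ _ _ (by omega)
      have h2 : G m (a + 1) b = 0 := hG _ _ _ (by omega)
      have h3 : G m a (b + 1) = 0 := hG _ _ _ (by omega)
      rw [h1, h2, h3]
      simp

theorem dirac_restrict (j : Fin 3) (hf : f ∈ monogenics k n) (a b : ℕ) :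
    (dunklCoeff (k (j + 1)) 1 : ℂ) • coef (expo j 1 a b) f =
      -((pauli (j + 1)).mulVec
        ((dunklCoeff (k (j + 2)) (a + 1) : ℂ) • (pauli (j + 2)).mulVec (coef (expo j 0 (a + 1) b) f) +
        (dunklCoeff (k j) (b + 1) : ℂ) • (pauli j).mulVec (coef (expo j 0 a (b + 1)) f))) := by
  have h := ((mem_monogenics_iff j).1 hf).2 0 a b
  rw [add_assoc, ← eq_neg_iff_add_eq_zero] at h
  rw [← Matrix.mulVec_neg, ← h, Matrix.mulVec_smul, Matrix.mulVec_mulVec, pauli_mul_self,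
    Matrix.one_mulVec]

theorem coef_genOp_zero (j : Fin 3) (hf : f ∈ monogenics k n) (a b : ℕ) :
    coef (expo j 0 a b) (genOp k j f) =
      ((-1 : ℂ) ^ a * (dunklCoeff (k (j + 2)) a + 1 / 2 + k (j + 1)) + k (j + 2)) •
          coef (expo j 0 a b) f +
        if a = 0 then 0 else (I * (-1) ^ a * dunklCoeff (k j) (b + 1)) •
          (pauli (j + 1)).mulVec (coef (expo j 0 (a - 1) (b + 1)) f) := by
  rw [genOp_apply]
  simp only [map_add, map_sub, map_smul, coef_pauli, coef_mulX_expo_one, coef_mulX_expo_two,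
    coef_dunkl_expo_one, coef_reflect_expo_one, coef_reflect_expo_two]
  rcases a with _ | a
  · simp [dunklCoeff_zero]
    module
  · have h := dirac_restrict j hf a b
    simp only [if_neg (Nat.succ_ne_zero a), Nat.add_sub_cancel]
    have e : (pauli j).mulVec ((dunklCoeff (k (j + 1)) 1 : ℂ) • coef (expo j 1 a b) f) =
        -(I * dunklCoeff (k (j + 2)) (a + 1)) • coef (expo j 0 (a + 1) b) f +
          (dunklCoeff (k j) (b + 1) : ℂ) • (pauli (j + 1)).mulVec (coef (expo j 0 a (b + 1)) f) := by
      rw [h, Matrix.mulVec_neg, Matrix.mulVec_mulVec, pauli_zero_one, Matrix.mulVec_add,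
        Matrix.mulVec_smul, Matrix.mulVec_smul, Matrix.mulVec_mulVec, Matrix.mulVec_mulVec,
        smul_mul_assoc, smul_mul_assoc, pauli_mul_self, pauli_two_zero, smul_smul,
        Matrix.smul_mulVec, Matrix.smul_mulVec, Matrix.one_mulVec, I_mul_I]
      module
    simp only [zero_add, sub_zero, Matrix.mulVec_zero, Matrix.mulVec_smul, smul_smul] at e ⊢
    have e' : (I * ((dunklCoeff (k (j + 1)) 1 : ℂ) * ((-1) ^ 1 * (-1) ^ a))) •
        (pauli j).mulVec (coef (expo j 1 a b) f) = (I * (-1) ^ (a + 1)) •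
        ((dunklCoeff (k (j + 1)) 1 : ℂ) • (pauli j).mulVec (coef (expo j 1 a b) f)) := by
      module
    rw [e', e]
    match_scalars
    · ring_nf; simp only [I_sq]; ring
    · ring

theorem coef_genOp_two (j : Fin 3) (hf : f ∈ monogenics k n) (a b : ℕ) :
    coef (expo j 0 a b) (genOp k (j + 2) f) =
      ((-1 : ℂ) ^ b * (dunklCoeff (k j) b + 1 / 2 + k (j + 1)) + k j) • coef (expo j 0 a b) f -
        if b = 0 then 0 else (I * (-1) ^ b * dunklCoeff (k (j + 2)) (a + 1)) •
          (pauli (j + 1)).mulVec (coef (expo j 0 (a + 1) (b - 1)) f) := by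
  rw [genOp_apply]
  have i1 : j + 2 + 1 = j := by revert j; decide
  have i2 : j + 2 + 2 = j + 1 := by revert j; decide
  simp only [i1, i2, map_add, map_sub, map_smul, coef_pauli, coef_mulX_expo_one,
    coef_mulX_expo_zero, coef_dunkl_expo_one, coef_reflect_expo_one, coef_reflect_expo_zero]
  rcases b with _ | b
  · simp [dunklCoeff_zero]
    module
  · have h := dirac_restrict j hf a b
    simp only [if_neg (Nat.succ_ne_zero b), Nat.add_sub_cancel]
    have e : (pauli (j + 2)).mulVec ((dunklCoeff (k (j + 1)) 1 : ℂ) • coef (expo j 1 a b) f) =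
        (I * dunklCoeff (k j) (b + 1)) • coef (expo j 0 a (b + 1)) f +
          (dunklCoeff (k (j + 2)) (a + 1) : ℂ) •
            (pauli (j + 1)).mulVec (coef (expo j 0 (a + 1) b) f) := by
      rw [h, Matrix.mulVec_neg, Matrix.mulVec_mulVec, pauli_two_one, Matrix.mulVec_add,
        Matrix.mulVec_smul, Matrix.mulVec_smul, Matrix.mulVec_mulVec, Matrix.mulVec_mulVec,
        smul_mul_assoc, smul_mul_assoc, pauli_mul_self, pauli_zero_two, smul_smul,
        Matrix.smul_mulVec, Matrix.smul_mulVec, Matrix.one_mulVec, neg_mul_neg, I_mul_I]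
      module
    simp only [zero_add, zero_sub, Matrix.mulVec_zero, Matrix.mulVec_smul, smul_smul] at e ⊢
    have e' : I • (-(((dunklCoeff (k (j + 1)) 1 : ℂ) * ((-1) ^ b * (-1) ^ 1)) •
        (pauli (j + 2)).mulVec (coef (expo j 1 a b) f))) = (-(I * (-1) ^ (b + 1))) •
        ((dunklCoeff (k (j + 1)) 1 : ℂ) • (pauli (j + 2)).mulVec (coef (expo j 1 a b) f)) := by
      module
    rw [e', e]
    match_scalars
    · ring_nf; simp only [I_sq]; ring
    · ring

theorem coef_genOp_one (j : Fin 3) (a b : ℕ) :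
    coef (expo j 0 a b) (genOp k (j + 1) f) =
      (1 / 2 * (-1 : ℂ) ^ (a + b) + k (j + 2) * (-1) ^ b + k j * (-1) ^ a) •
          coef (expo j 0 a b) f +
        (if b = 0 then 0 else (I * (-1) ^ (a + b) * dunklCoeff (k (j + 2)) (a + 1)) •
          (pauli (j + 1)).mulVec (coef (expo j 0 (a + 1) (b - 1)) f)) -
        if a = 0 then 0 else (I * (-1) ^ (a + b) * dunklCoeff (k j) (b + 1)) •
          (pauli (j + 1)).mulVec (coef (expo j 0 (a - 1) (b + 1)) f) := by
  rw [genOp_apply]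
  have i1 : j + 1 + 1 = j + 2 := by revert j; decide
  have i2 : j + 1 + 2 = j := by revert j; decide
  simp only [i1, i2, map_add, map_sub, map_smul, coef_pauli, coef_mulX_expo_two,
    coef_mulX_expo_zero, coef_dunkl_expo_two, coef_dunkl_expo_zero, coef_reflect_expo_two,
    coef_reflect_expo_zero]
  rcases a with _ | a <;> rcases b with _ | b <;>
    simp only [if_neg (Nat.succ_ne_zero _), if_true, Nat.add_sub_cancel, Matrix.mulVec_sub,
      Matrix.mulVec_smul, Matrix.mulVec_zero, smul_sub, smul_zero] <;> module

end CauchyKovalevskaya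

section Components

open Complex MvPolynomial

theorem ofReal_dunklCoeff (κ : ℝ) (m : ℕ) :
    ((dunklCoeff κ m : ℝ) : ℂ) = m + (1 - (-1) ^ m) * κ := by
  simp [dunklCoeff]

/-- The weights by which the monomials `x_{j+2}^{n-b} x_j^b` are rescaled. -/
noncomputable def weight (κ : ℝ) (n : ℕ) (τ : ℂ) (b : ℕ) : ℂ :=
  ∏ m ∈ Finset.range b, (τ * I * (-1) ^ m * dunklCoeff κ (n - m))

theorem weight_succ (κ : ℝ) (n : ℕ) (τ : ℂ) (b : ℕ) :
    weight κ n τ (b + 1) = weight κ n τ b * (τ * I * (-1) ^ b * dunklCoeff κ (n - b)) :=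
  Finset.prod_range_succ _ _

theorem weight_ne_zero {κ : ℝ} {n : ℕ} (hκ : ∀ m, 0 < m → m ≤ n → dunklCoeff κ m ≠ 0) {τ : ℂ}
    (hτ : τ ≠ 0) {b : ℕ} (hb : b ≤ n) : weight κ n τ b ≠ 0 := by
  refine Finset.prod_ne_zero_iff.2 fun m hm => ?_
  have hm := Finset.mem_range.1 hm
  have : (dunklCoeff κ (n - m) : ℂ) ≠ 0 := by exact_mod_cast hκ (n - m) (by omega) (by omega)
  simp [hτ, this]

/-- The rescaled coefficients of the restriction to `x_{j+1} = 0`, in the direction of `ψ`. -/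
noncomputable def component (k : Fin 3 → ℝ) (n : ℕ) (j : Fin 3) (ψ : (Fin 2 → ℂ) →ₗ[ℂ] ℂ) (τ : ℂ)
    (b : ℕ) : Spinor →ₗ[ℂ] ℂ :=
  (weight (k (j + 2)) n τ b)⁻¹ • (ψ ∘ₗ coef (expo j 0 (n - b) b))

theorem component_apply (k : Fin 3 → ℝ) (n : ℕ) (j : Fin 3) (ψ : (Fin 2 → ℂ) →ₗ[ℂ] ℂ) (τ : ℂ)
    (b : ℕ) (f : Spinor) :
    component k n j ψ τ b f =
      (weight (k (j + 2)) n τ b)⁻¹ * ψ (coef (expo j 0 (n - b) b) f) := rfl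

variable {k : Fin 3 → ℝ} {n : ℕ} {f : Spinor} {j : Fin 3} {ψ : (Fin 2 → ℂ) →ₗ[ℂ] ℂ} {σ s : ℂ}

theorem component_genOp_two (hf : f ∈ monogenics k n)
    (hr : ∀ m, 0 < m → m ≤ n → dunklCoeff (k (j + 2)) m ≠ 0)
    (hψ : ∀ v, ψ ((pauli (j + 1)).mulVec v) = σ * ψ v) (hσ : σ * σ = 1) (hs : s * s = 1) {b : ℕ}
    (hb : b ≤ n) :
    component k n j ψ (s * σ) b (genOp k (j + 2) f) =
      ((-1) ^ b * (dunklCoeff (k j) b + 1 / 2 + k (j + 1)) + k j) * component k n j ψ (s * σ) b f +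
        s * (if b = 0 then 0 else component k n j ψ (s * σ) (b - 1) f) := by
  have hτ : s * σ ≠ 0 := fun h => by
    have : (s * σ) * (s * σ) = 1 := by linear_combination s * s * hσ + hs
    rw [h] at this; simp at this
  rw [component_apply, coef_genOp_two j hf, component_apply]
  rcases b with _ | b
  · simp; ring
  · simp only [if_neg (Nat.succ_ne_zero b), Nat.add_sub_cancel, map_sub, map_smul, hψ, smul_eq_mul,
      component_apply]
    rw [show n - (b + 1) + 1 = n - b by omega]
    have h1 := weight_ne_zero hr hτ (show b ≤ n by omega)
    have h2 := weight_ne_zero hr hτ hb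
    have h3 := weight_succ (k (j + 2)) n (s * σ) b
    have key : (weight (k (j + 2)) n (s * σ) (b + 1))⁻¹ * (I * (-1) ^ (b + 1) *
        dunklCoeff (k (j + 2)) (n - b) * σ) = -s * (weight (k (j + 2)) n (s * σ) b)⁻¹ := by
      rw [inv_mul_eq_iff_eq_mul₀ h2, ← mul_assoc, eq_mul_inv_iff_mul_eq₀ h1, h3, pow_succ]
      linear_combination (weight (k (j + 2)) n (s * σ) b * I * (-1) ^ b * σ *
        dunklCoeff (k (j + 2)) (n - b)) * hs
    linear_combination (-ψ (coef (expo j 0 (n - b) b) f)) * key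

theorem component_genOp_zero (hn : Odd n) (hf : f ∈ monogenics k n)
    (hr : ∀ m, 0 < m → m ≤ n → dunklCoeff (k (j + 2)) m ≠ 0)
    (hψ : ∀ v, ψ ((pauli (j + 1)).mulVec v) = σ * ψ v) (hσ : σ * σ = 1) (hs : s * s = 1) {b : ℕ}
    (hb : b ≤ n) :
    component k n j ψ (s * σ) b (genOp k j f) =
      ((-1) ^ (n - b) * (dunklCoeff (k (j + 2)) (n - b) + 1 / 2 + k (j + 1)) + k (j + 2)) *
        component k n j ψ (s * σ) b f +
        s * dunklCoeff (k j) (b + 1) * dunklCoeff (k (j + 2)) (n - b) *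
          component k n j ψ (s * σ) (b + 1) f := by
  have hτ : s * σ ≠ 0 := fun h => by
    have : (s * σ) * (s * σ) = 1 := by linear_combination s * s * hσ + hs
    rw [h] at this; simp at this
  rw [component_apply, coef_genOp_zero j hf, component_apply]
  obtain ⟨a, rfl⟩ := Nat.exists_eq_add_of_le hb
  rw [Nat.add_sub_cancel_left]
  rcases a with _ | a
  · simp [dunklCoeff_zero]; ring
  · simp only [if_neg (Nat.succ_ne_zero a), Nat.add_sub_cancel, map_add, map_smul, hψ, smul_eq_mul,
      component_apply]
    rw [show b + (a + 1) - (b + 1) = a by omega]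
    have h1 := weight_ne_zero hr hτ (show b ≤ b + (a + 1) by omega)
    have h2 := weight_ne_zero hr hτ (show b + 1 ≤ b + (a + 1) by omega)
    have h3 := weight_succ (k (j + 2)) (b + (a + 1)) (s * σ) b
    rw [Nat.add_sub_cancel_left] at h3
    have hpar : (-1 : ℂ) ^ (a + 1) * (-1) ^ b = -1 := by
      rw [← pow_add, add_comm, hn.neg_one_pow]
    have key : (weight (k (j + 2)) (b + (a + 1)) (s * σ) b)⁻¹ * (I * (-1) ^ (a + 1) * σ) =
        s * dunklCoeff (k (j + 2)) (a + 1) *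
          (weight (k (j + 2)) (b + (a + 1)) (s * σ) (b + 1))⁻¹ := by
      rw [inv_mul_eq_iff_eq_mul₀ h1, ← mul_assoc, eq_mul_inv_iff_mul_eq₀ h2, h3]
      linear_combination (weight (k (j + 2)) (b + (a + 1)) (s * σ) b) * s *
        dunklCoeff (k (j + 2)) (a + 1) * (I * I * σ * σ * hpar - σ * σ * I_mul_I + hσ)
    linear_combination dunklCoeff (k j) (b + 1) * ψ (coef (expo j 0 a (b + 1)) f) * key

theorem component_genOp_one (hn : Odd n)
    (hr : ∀ m, 0 < m → m ≤ n → dunklCoeff (k (j + 2)) m ≠ 0)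
    (hψ : ∀ v, ψ ((pauli (j + 1)).mulVec v) = σ * ψ v) (hσ : σ * σ = 1) (hs : s * s = 1) {b : ℕ}
    (hb : b ≤ n) :
    component k n j ψ (s * σ) b (genOp k (j + 1) f) =
      (-(1 / 2) + k (j + 2) * (-1) ^ b + k j * (-1) ^ (n - b)) * component k n j ψ (s * σ) b f +
        s * (-1) ^ b * (if b = 0 then 0 else component k n j ψ (s * σ) (b - 1) f) -
        s * (-1) ^ b * dunklCoeff (k j) (b + 1) * dunklCoeff (k (j + 2)) (n - b) *
          component k n j ψ (s * σ) (b + 1) f := by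
  have hτ : s * σ ≠ 0 := fun h => by
    have : (s * σ) * (s * σ) = 1 := by linear_combination s * s * hσ + hs
    rw [h] at this; simp at this
  rw [component_apply, coef_genOp_one j, component_apply]
  rw [Nat.sub_add_cancel hb, hn.neg_one_pow, map_sub, map_add]
  have e1 : (weight (k (j + 2)) n (s * σ) b)⁻¹ * ψ (if b = 0 then 0 else
      (I * -1 * dunklCoeff (k (j + 2)) (n - b + 1)) •
        (pauli (j + 1)).mulVec (coef (expo j 0 (n - b + 1) (b - 1)) f)) =
      s * (-1) ^ b * (if b = 0 then 0 else component k n j ψ (s * σ) (b - 1) f) := by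
    rcases b with _ | b
    · simp
    · simp only [if_neg (Nat.succ_ne_zero b), Nat.add_sub_cancel, map_smul, hψ, smul_eq_mul,
        component_apply]
      rw [show n - (b + 1) + 1 = n - b by omega]
      have h1 := weight_ne_zero hr hτ (show b ≤ n by omega)
      have h2 := weight_ne_zero hr hτ hb
      have h3 := weight_succ (k (j + 2)) n (s * σ) b
      have hpar : (-1 : ℂ) ^ b * (-1) ^ b = 1 := by
        rw [← mul_pow]; simp
      have key : (weight (k (j + 2)) n (s * σ) (b + 1))⁻¹ * (I * -1 *
          dunklCoeff (k (j + 2)) (n - b) * σ) =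
          s * (-1) ^ (b + 1) * (weight (k (j + 2)) n (s * σ) b)⁻¹ := by
        rw [inv_mul_eq_iff_eq_mul₀ h2, ← mul_assoc, eq_mul_inv_iff_mul_eq₀ h1, h3, pow_succ]
        linear_combination (weight (k (j + 2)) n (s * σ) b * I * σ *
          dunklCoeff (k (j + 2)) (n - b)) * (s * s * hpar + hs)
      linear_combination (ψ (coef (expo j 0 (n - b) b) f)) * key
  have e2 : (weight (k (j + 2)) n (s * σ) b)⁻¹ * ψ (if n - b = 0 then 0 else
      (I * -1 * dunklCoeff (k j) (b + 1)) •
        (pauli (j + 1)).mulVec (coef (expo j 0 (n - b - 1) (b + 1)) f)) =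
      s * (-1) ^ b * dunklCoeff (k j) (b + 1) * dunklCoeff (k (j + 2)) (n - b) *
          component k n j ψ (s * σ) (b + 1) f := by
    by_cases h0 : n - b = 0
    · simp [h0, dunklCoeff_zero]
    · simp only [if_neg h0, map_smul, hψ, smul_eq_mul, component_apply, Nat.sub_sub]
      have h1 := weight_ne_zero hr hτ hb
      have h2 := weight_ne_zero hr hτ (show b + 1 ≤ n by omega)
      have h3 := weight_succ (k (j + 2)) n (s * σ) b
      have hpar : (-1 : ℂ) ^ b * (-1) ^ b = 1 := by
        rw [← mul_pow]; simp
      have key : (weight (k (j + 2)) n (s * σ) b)⁻¹ * (I * -1 * σ) =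
          s * (-1) ^ b * dunklCoeff (k (j + 2)) (n - b) *
            (weight (k (j + 2)) n (s * σ) (b + 1))⁻¹ := by
        rw [inv_mul_eq_iff_eq_mul₀ h1, ← mul_assoc, eq_mul_inv_iff_mul_eq₀ h2, h3]
        linear_combination (weight (k (j + 2)) n (s * σ) b * s * (-1) ^ b *
          dunklCoeff (k (j + 2)) (n - b)) * (hσ - σ * σ * I_mul_I)
      linear_combination dunklCoeff (k j) (b + 1) * ψ (coef (expo j 0 (n - (b + 1)) (b + 1)) f) * key
  rw [mul_sub, mul_add, e1, e2, map_smul, smul_eq_mul, component_apply]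
  ring

end Components

section Matching

theorem seqX_eq (d : ℕ) (a : ℂ) (F : ℕ → ℂ) (i : ℕ) :
    seqX d a F i = oddTheta d a i * F i + if i = 0 then 0 else F (i - 1) := by
  cases i <;> simp [seqX]

theorem seqZ_eq (d : ℕ) (a b c : ℂ) (F : ℕ → ℂ) (i : ℕ) :
    seqZ d a b c F i = (-1) ^ i * (if i = 0 then 0 else F (i - 1)) +
      (2 * oddTheta d a i * oddTheta d b i + oddPhi d a b c i + oddPhi d a b c (i + 1) -
        (2 * a * b - c * (d + 1))) * F i - (-1) ^ i * oddPhi d a b c (i + 1) * F (i + 1) := by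
  rcases i with _ | i
  · simp [seqX, seqY, seqZ, oddTheta, oddPhi, Nat.even_add_one]
    ring
  · simp only [seqX, seqY, seqZ, oddTheta, if_neg (Nat.succ_ne_zero i), Nat.add_sub_cancel]
    rcases Nat.even_or_odd i with h | h
    · simp only [pow_succ, h.neg_one_pow]; push_cast; ring
    · simp only [pow_succ, h.neg_one_pow]; push_cast; ring

end Matching

section Arithmetic

theorem seqY_eq (d : ℕ) (a b c : ℂ) (F : ℕ → ℂ) (i : ℕ) :
    seqY d a b c F i = oddTheta d b i * F i + oddPhi d a b c (i + 1) * F (i + 1) := rfl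

variable {n d i t : ℕ} {κ p r : ℝ}

theorem oddPhi_quotient (hn : Odd n) (hi : i ≤ n) (hκ : 2 * (κ : ℂ) = -(d + 1)) :
    oddPhi d p (-r - κ - p - n - 1) r (i + 1) =
      dunklCoeff κ (i + 1) * dunklCoeff r (n - i) := by
  obtain ⟨m, rfl⟩ := Nat.exists_eq_add_of_le hi
  have hd : (d : ℂ) = -2 * κ - 1 := by linear_combination hκ
  rw [Nat.add_sub_cancel_left, ofReal_dunklCoeff, ofReal_dunklCoeff, oddPhi, hd]
  rcases Nat.even_or_odd i with h | h
  · have hm : Odd m := (Nat.odd_add'.1 hn).2 h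
    rw [if_neg (by simpa [Nat.even_add_one] using h), pow_succ, h.neg_one_pow, hm.neg_one_pow]
    push_cast; ring
  · have hm : Even m := (Nat.odd_add.1 hn).1 h
    rw [if_pos h.add_one, pow_succ, h.neg_one_pow, hm.neg_one_pow]
    push_cast; ring

theorem oddPhi_sub (hn : Odd n) (ht : Odd t) (hd : d + t = n) (hi : i ≤ d)
    (hκ : 2 * (κ : ℂ) = -t) :
    oddPhi d (p + (n + 1) / 2) (-r - κ - p - (n + 1) / 2) (-r - (n + 1) / 2) (i + 1) =
      dunklCoeff κ (t + i + 1) * dunklCoeff r (n - (t + i)) := by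
  obtain ⟨m, rfl⟩ := Nat.exists_eq_add_of_le hi
  have hm' : n - (t + i) = m := by omega
  have hκ' : (t : ℂ) = -2 * κ := by linear_combination hκ
  have hn' : (n : ℂ) = i + m - 2 * κ := by rw [← hd]; push_cast; rw [hκ']; ring
  have hdm : Even (i + m) := by
    rcases Nat.even_or_odd (i + m) with h | h
    · exact h
    · exact absurd (h.add_odd ht) (by rw [hd]; exact Nat.not_even_iff_odd.2 hn)
  rw [hm', ofReal_dunklCoeff, ofReal_dunklCoeff, oddPhi, hn']
  rcases Nat.even_or_odd i with h | h
  · have hm : Even m := (Nat.even_add.1 hdm).1 h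
    rw [if_neg (by simpa [Nat.even_add_one] using h), pow_succ, pow_add, h.neg_one_pow,
      hm.neg_one_pow, ht.neg_one_pow]
    push_cast; rw [hκ']; ring
  · have hm : Odd m := Nat.not_even_iff_odd.1 fun hm =>
      Nat.not_even_iff_odd.2 h ((Nat.even_add.1 hdm).2 hm)
    rw [if_pos h.add_one, pow_succ, pow_add, h.neg_one_pow, hm.neg_one_pow, ht.neg_one_pow]
    push_cast; rw [hκ']; ring

end Arithmetic

section Matching

variable {k : Fin 3 → ℝ} {n : ℕ} {f : Spinor} {j : Fin 3} {ψ : (Fin 2 → ℂ) →ₗ[ℂ] ℂ} {σ : ℂ}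

/-- The vector of the components with index in `[t, t + d]`. -/
noncomputable def componentVec (k : Fin 3 → ℝ) (n : ℕ) (j : Fin 3) (ψ : (Fin 2 → ℂ) →ₗ[ℂ] ℂ) (τ : ℂ)
    (t d : ℕ) : Spinor →ₗ[ℂ] (Fin (d + 1) → ℂ) :=
  LinearMap.pi fun i => component k n j ψ τ (t + i)

theorem componentVec_genOp_quotient (hn : Odd n) (hf : f ∈ monogenics k n)
    (hr : ∀ m, 0 < m → m ≤ n → dunklCoeff (k (j + 2)) m ≠ 0)
    (hψ : ∀ v, ψ ((pauli (j + 1)).mulVec v) = σ * ψ v) (hσ : σ * σ = 1) {d : ℕ} (hd : Even d)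
    (hdn : d ≤ n) (hκ : 2 * (k j : ℂ) = -(d + 1)) (i : Fin 3) :
    componentVec k n j ψ σ 0 d (genOp k (i + (j + 2)) f) =
      oddOp d (k (j + 1)) (-k (j + 2) - k j - k (j + 1) - n - 1) (k (j + 2)) i
        (componentVec k n j ψ σ 0 d f) := by
  have hd' : (d : ℂ) = -2 * k j - 1 := by linear_combination hκ
  obtain ⟨G, hG⟩ : ∃ G : ℕ → ℂ, ∀ b, G b = component k n j ψ σ b f := ⟨_, fun _ => rfl⟩
  have hv : componentVec k n j ψ σ 0 d f = fun i : Fin (d + 1) => G i := by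
    funext i; simp [componentVec, hG]
  rw [hv]
  have h3 : ∀ j : Fin 3, 0 + (j + 2) = j + 2 ∧ 1 + (j + 2) = j ∧ 2 + (j + 2) = j + 1 := by decide
  obtain ⟨e0, e1, e2⟩ := h3 j
  fin_cases i
  · change componentVec k n j ψ σ 0 d (genOp k (0 + (j + 2)) f) = oddOp _ _ _ _ 0 _
    rw [oddOp_zero]
    funext ⟨b, hb⟩
    have h := component_genOp_two (s := 1) hf hr hψ hσ (one_mul 1) (b := b) (by omega)
    rw [one_mul, one_mul] at h
    simp only [e0, componentVec, LinearMap.pi_apply, zero_add, h, hG, seqX_eq, oddTheta,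
      ofReal_dunklCoeff, hd']
    have hpar : (-1 : ℂ) ^ b * (-1) ^ b = 1 := by rw [← mul_pow]; simp
    linear_combination (-(k j : ℂ) * component k n j ψ σ b f) * hpar
  · change componentVec k n j ψ σ 0 d (genOp k (1 + (j + 2)) f) = oddOp _ _ _ _ 1 _
    rw [oddOp_one hd]
    funext ⟨b, hb⟩
    have h := component_genOp_zero (s := 1) hn hf hr hψ hσ (one_mul 1) (b := b) (by omega)
    rw [one_mul] at h
    simp only [e1, componentVec, LinearMap.pi_apply, zero_add, h, hG, seqY_eq,
      oddPhi_quotient hn (show b ≤ n by omega) hκ]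
    obtain ⟨m, rfl⟩ := Nat.exists_eq_add_of_le (show b ≤ n by omega)
    have hpar : (-1 : ℂ) ^ m * (-1) ^ b = -1 := by rw [← pow_add, add_comm, hn.neg_one_pow]
    have hm : (-1 : ℂ) ^ m * (-1) ^ m = 1 := by rw [← mul_pow]; simp
    have hb : (-1 : ℂ) ^ b = -(-1) ^ m := by linear_combination (-1 : ℂ) ^ m * hpar - (-1) ^ b * hm
    simp only [Nat.add_sub_cancel_left, oddTheta, ofReal_dunklCoeff, hd', hb]
    push_cast
    linear_combination (-(k (j + 2) : ℂ) * component k (b + m) j ψ σ b f) * hm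
  · change componentVec k n j ψ σ 0 d (genOp k (2 + (j + 2)) f) = oddOp _ _ _ _ 2 _
    rw [oddOp_two hd]
    funext ⟨b, hb⟩
    have h := component_genOp_one (s := 1) (f := f) hn hr hψ hσ (one_mul 1) (b := b) (by omega)
    rw [one_mul] at h
    have key : (2 * oddTheta d (k (j + 1)) b *
        oddTheta d (-k (j + 2) - k j - k (j + 1) - n - 1) b +
        oddPhi d (k (j + 1)) (-k (j + 2) - k j - k (j + 1) - n - 1) (k (j + 2)) b +
        oddPhi d (k (j + 1)) (-k (j + 2) - k j - k (j + 1) - n - 1) (k (j + 2)) (b + 1) -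
        (2 * k (j + 1) * (-k (j + 2) - k j - k (j + 1) - n - 1) - k (j + 2) * (d + 1)) : ℂ) =
        -(1 / 2) + k (j + 2) * (-1) ^ b + k j * (-1) ^ (n - b) := by
      obtain ⟨m, hm⟩ := Nat.exists_eq_add_of_le (show b ≤ n by omega)
      have hpar : (-1 : ℂ) ^ b * (-1) ^ m = -1 := by rw [← pow_add, ← hm, hn.neg_one_pow]
      have e : n - b = m := by omega
      rw [e]
      rcases Nat.even_or_odd b with h | h
      · rw [h.neg_one_pow, one_mul] at hpar
        simp only [oddTheta, oddPhi, h, if_true, Nat.even_add_one, not_true, if_false,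
          h.neg_one_pow, hpar, hd']
        push_cast; ring
      · have h' : ¬ Even b := Nat.not_even_iff_odd.2 h
        have hpar : (-1 : ℂ) ^ m = 1 := by
          rw [h.neg_one_pow] at hpar; linear_combination -hpar
        simp only [oddTheta, oddPhi, h', if_true, Nat.even_add_one, not_false_eq_true, if_false,
          h.neg_one_pow, hpar, hd']
        push_cast; ring
    simp only [e2, componentVec, LinearMap.pi_apply, zero_add, h, hG, seqZ_eq, key]
    rw [oddPhi_quotient hn (show b ≤ n by omega) hκ]
    ring

theorem componentVec_genOp_sub (hn : Odd n) (hf : f ∈ monogenics k n)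
    (hr : ∀ m, 0 < m → m ≤ n → dunklCoeff (k (j + 2)) m ≠ 0)
    (hψ : ∀ v, ψ ((pauli (j + 1)).mulVec v) = σ * ψ v) (hσ : σ * σ = 1) {d t : ℕ} (hd : Even d)
    (ht : Odd t) (hdn : d + t = n) (hκ : 2 * (k j : ℂ) = -t)
    (h0 : component k n j ψ (-σ) (t - 1) f = 0) (i : Fin 3) :
    componentVec k n j ψ (-σ) t d (genOp k (i + (j + 2)) f) =
      (![-1, -1, 1] i : ℂ) • oddOp d (k (j + 1) + (n + 1) / 2)
        (-k (j + 2) - k j - k (j + 1) - (n + 1) / 2) (-k (j + 2) - (n + 1) / 2) i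
        (componentVec k n j ψ (-σ) t d f) := by
  have hκ' : (t : ℂ) = -2 * k j := by linear_combination hκ
  have hn' : (n : ℂ) = d - 2 * k j := by rw [← hdn]; push_cast; rw [hκ']; ring
  obtain ⟨G, hG⟩ : ∃ G : ℕ → ℂ, ∀ b, G b = component k n j ψ (-σ) (t + b) f := ⟨_, fun _ => rfl⟩
  have hv : componentVec k n j ψ (-σ) t d f = fun i : Fin (d + 1) => G i := by
    funext i; simp [componentVec, hG]
  rw [hv]
  have h3 : ∀ j : Fin 3, 0 + (j + 2) = j + 2 ∧ 1 + (j + 2) = j ∧ 2 + (j + 2) = j + 1 := by decide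
  obtain ⟨e0, e1, e2⟩ := h3 j
  have ht0 : ∀ b, t + b ≠ 0 := fun b h => by
    have := ht.pos; omega
  have hlow : ∀ b, component k n j ψ (-σ) (t + b - 1) f =
      if b = 0 then 0 else component k n j ψ (-σ) (t + (b - 1)) f := by
    rintro (_ | b)
    · simpa using h0
    · rfl
  have hs : (-1 : ℂ) * -1 = 1 := by norm_num
  fin_cases i
  · change componentVec k n j ψ (-σ) t d (genOp k (0 + (j + 2)) f) = (-1 : ℂ) • oddOp _ _ _ _ 0 _
    rw [oddOp_zero]
    funext ⟨b, hb⟩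
    have h := component_genOp_two hf hr hψ hσ hs (b := t + b) (by omega)
    rw [neg_one_mul, if_neg (ht0 b), hlow] at h
    simp only [e0, componentVec, LinearMap.pi_apply, h, hG, seqX_eq, oddTheta, Pi.smul_apply,
      ofReal_dunklCoeff, hn', pow_add, ht.neg_one_pow, smul_eq_mul]
    have hpar : (-1 : ℂ) ^ b * (-1) ^ b = 1 := by rw [← mul_pow]; simp
    push_cast
    rw [hκ']
    linear_combination (-(k j : ℂ) * component k n j ψ (-σ) (t + b) f) * hpar
  · change componentVec k n j ψ (-σ) t d (genOp k (1 + (j + 2)) f) = (-1 : ℂ) • oddOp _ _ _ _ 1 _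
    rw [oddOp_one hd]
    funext ⟨b, hb⟩
    have h := component_genOp_zero hn hf hr hψ hσ hs (b := t + b) (by omega)
    rw [neg_one_mul] at h
    simp only [e1, componentVec, LinearMap.pi_apply, h, hG, seqY_eq, Pi.smul_apply, smul_eq_mul,
      oddPhi_sub hn ht hdn (show b ≤ d by omega) hκ]
    obtain ⟨m, rfl⟩ := Nat.exists_eq_add_of_le (show b ≤ d by omega)
    have e : n - (t + b) = m := by omega
    have hb : (-1 : ℂ) ^ b = (-1) ^ m := by
      have h1 : (-1 : ℂ) ^ b * (-1) ^ m = 1 := by rw [← pow_add, hd.neg_one_pow]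
      have h2 : (-1 : ℂ) ^ m * (-1) ^ m = 1 := by rw [← mul_pow]; simp
      linear_combination (-1 : ℂ) ^ m * h1 - (-1) ^ b * h2
    have hm : (-1 : ℂ) ^ m * (-1) ^ m = 1 := by rw [← mul_pow]; simp
    simp only [e, oddTheta, ofReal_dunklCoeff, hb, hn']
    push_cast
    linear_combination (-(k (j + 2) : ℂ) * component k n j ψ (-σ) (t + b) f) * hm
  · change componentVec k n j ψ (-σ) t d (genOp k (2 + (j + 2)) f) = (1 : ℂ) • oddOp _ _ _ _ 2 _
    rw [oddOp_two hd, one_smul]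
    funext ⟨b, hb⟩
    have h := component_genOp_one (f := f) hn hr hψ hσ hs (b := t + b) (by omega)
    rw [neg_one_mul, if_neg (ht0 b), hlow] at h
    have key : (2 * oddTheta d (k (j + 1) + (n + 1) / 2) b *
        oddTheta d (-k (j + 2) - k j - k (j + 1) - (n + 1) / 2) b +
        oddPhi d (k (j + 1) + (n + 1) / 2)
          (-k (j + 2) - k j - k (j + 1) - (n + 1) / 2) (-k (j + 2) - (n + 1) / 2) b +
        oddPhi d (k (j + 1) + (n + 1) / 2)
          (-k (j + 2) - k j - k (j + 1) - (n + 1) / 2) (-k (j + 2) - (n + 1) / 2) (b + 1) -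
        (2 * (k (j + 1) + (n + 1) / 2) * (-k (j + 2) - k j - k (j + 1) - (n + 1) / 2) -
          (-k (j + 2) - (n + 1) / 2) * (d + 1)) : ℂ) =
        -(1 / 2) + k (j + 2) * (-1) ^ (t + b) + k j * (-1) ^ (n - (t + b)) := by
      obtain ⟨m, hm⟩ := Nat.exists_eq_add_of_le (show b ≤ d by omega)
      have hpar : (-1 : ℂ) ^ b * (-1) ^ m = 1 := by rw [← pow_add, ← hm, hd.neg_one_pow]
      have e : n - (t + b) = m := by omega
      rw [e, pow_add, ht.neg_one_pow]
      rcases Nat.even_or_odd b with h | h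
      · rw [h.neg_one_pow, one_mul] at hpar
        simp only [oddTheta, oddPhi, h, if_true, Nat.even_add_one, not_true, if_false,
          h.neg_one_pow, hpar, hn']
        push_cast; ring
      · have h' : ¬ Even b := Nat.not_even_iff_odd.2 h
        have hpar : (-1 : ℂ) ^ m = -1 := by
          rw [h.neg_one_pow] at hpar; linear_combination -hpar
        simp only [oddTheta, oddPhi, h', if_true, Nat.even_add_one, not_false_eq_true, if_false,
          h.neg_one_pow, hpar, hn']
        push_cast; ring
    simp only [e2, componentVec, LinearMap.pi_apply, h, hG, seqZ_eq, key]
    rw [oddPhi_sub hn ht hdn (show b ≤ d by omega) hκ, pow_add, ht.neg_one_pow]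
    ring_nf

end Matching

section MonogenicModules

open Complex MvPolynomial

theorem dunklCoeff_ne_zero {κ : ℝ} {n : ℕ} (h : (n : ℕ∞) < threshold κ) :
    ∀ m, 0 < m → m ≤ n → dunklCoeff κ m ≠ 0 := by
  intro m hm hmn h0
  rcases Nat.even_or_odd m with he | ho
  · rw [dunklCoeff, he.neg_one_pow] at h0
    have : (m : ℝ) = 0 := by linarith
    exact hm.ne' (by exact_mod_cast this)
  · rw [dunklCoeff, ho.neg_one_pow] at h0
    rw [(threshold_eq_coe_iff κ m).2 ⟨ho, by linarith⟩] at h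
    exact absurd (Nat.cast_lt.1 h) (by omega)

variable {k : Fin 3 → ℝ} {n : ℕ} {j : Fin 3}

/-- The inclusion of the monogenics into the spinor-valued polynomials. -/
noncomputable def Monogenics.valHom (k : Fin 3 → ℝ) (n : ℕ) : Monogenics k n →ₗ[ℂ] Spinor :=
  (monogenics k n).subtype

theorem Monogenics.val_mem (f : Monogenics k n) : f.val ∈ monogenics k n := f.2

theorem coef_expo_zero_eq_zero {f : Spinor} (hf : f ∈ monogenics k n) {a b : ℕ} (h : a + b ≠ n) :
    coef (expo j 0 a b) f = 0 := by
  by_contra hne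
  have := ((mem_monogenics_iff j).1 hf).1 _ hne
  rw [degree_expo] at this
  omega

theorem mem_monogenicsAt_iff (hp : ∀ m, 0 < m → m ≤ n → dunklCoeff (k (j + 1)) m ≠ 0) {t : ℕ}
    (ht : threshold (k j) = t) (f : Monogenics k n) :
    f ∈ monogenicsAt k n j ↔ ∀ b < t, coef (expo j 0 (n - b) b) f.val = 0 := by
  change f.val ∈ tens (powSpace j (threshold (k j)) n) ↔ _
  rw [powSpace_eq_monoSpan, mem_tens_monoSpan_iff, ht]
  constructor
  · intro h b hb
    by_contra hne
    have := (h _ hne).2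
    rw [expo_zero, Nat.cast_le] at this
    omega
  · intro h α hα
    refine ⟨((mem_monogenics_iff j).1 f.val_mem).1 α hα, ?_⟩
    rw [Nat.cast_le]
    by_contra hlt
    rw [eq_expo j α] at hα
    refine hα (coef_eq_zero_of_restrict j f.val_mem hp (S := fun b => b < t) ?_ ?_ _ _ _
      (not_le.1 hlt))
    · intro b hb
      rcases Nat.lt_or_ge (b + 1) t with h | h
      · exact Or.inl h
      · have : b + 1 = t := by omega
        rw [this]
        exact Or.inr (threshold_dunklCoeff _ _ ht)
    · intro a b hb
      by_cases hab : a + b = n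
      · rw [show a = n - b by omega]; exact h b hb
      · exact coef_expo_zero_eq_zero f.val_mem hab

theorem Monogenics.eq_zero_of_restrict
    (hp : ∀ m, 0 < m → m ≤ n → dunklCoeff (k (j + 1)) m ≠ 0) {f : Monogenics k n}
    (h : ∀ b ≤ n, coef (expo j 0 (n - b) b) f.val = 0) : f = 0 := by
  refine Subtype.ext (coef_ext fun α => ?_)
  rw [eq_expo j α]
  refine (coef_eq_zero_of_restrict j f.val_mem hp (S := fun _ => True) (fun _ _ => Or.inl trivial)
    ?_ _ _ _ trivial).trans (map_zero _).symm
  intro a b _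
  by_cases hab : a + b = n
  · rw [show a = n - b by omega]; exact h b (by omega)
  · exact coef_expo_zero_eq_zero f.val_mem hab

variable (Q : (Fin 2 → ℂ) ≃ₗ[ℂ] ℂ × ℂ)

/-- The coordinates with index in `[t, t + d]` of a monogenic, with respect to an eigenbasis of a
Pauli matrix. -/
noncomputable def coords (k : Fin 3 → ℝ) (n : ℕ) (j : Fin 3) (s : ℂ) (t d : ℕ) :
    Monogenics k n →ₗ[ℂ] (Fin (d + 1) → ℂ) × (Fin (d + 1) → ℂ) :=
  ((componentVec k n j (LinearMap.fst ℂ ℂ ℂ ∘ₗ Q.toLinearMap) s t d).prod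
    (componentVec k n j (LinearMap.snd ℂ ℂ ℂ ∘ₗ Q.toLinearMap) (-s) t d)) ∘ₗ
      Monogenics.valHom k n

variable {s : ℂ} {t d : ℕ}

theorem coords_fst_apply (f : Monogenics k n) (i : Fin (d + 1)) :
    (coords Q k n j s t d f).1 i =
      (weight (k (j + 2)) n s (t + i))⁻¹ * (Q (coef (expo j 0 (n - (t + i)) (t + i)) f.val)).1 := rfl

theorem coords_snd_apply (f : Monogenics k n) (i : Fin (d + 1)) :
    (coords Q k n j s t d f).2 i =
      (weight (k (j + 2)) n (-s) (t + i))⁻¹ *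
        (Q (coef (expo j 0 (n - (t + i)) (t + i)) f.val)).2 := rfl

theorem coords_eq_zero_iff (hr : ∀ m, 0 < m → m ≤ n → dunklCoeff (k (j + 2)) m ≠ 0)
    (hs : s ≠ 0) (htd : t + d ≤ n) (f : Monogenics k n) :
    coords Q k n j s t d f = 0 ↔
      ∀ b, t ≤ b → b ≤ t + d → coef (expo j 0 (n - b) b) f.val = 0 := by
  constructor
  · intro h b hb hbd
    obtain ⟨i, rfl⟩ := Nat.exists_eq_add_of_le hb
    have h1 := congrFun (congrArg Prod.fst h) ⟨i, by omega⟩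
    have h2 := congrFun (congrArg Prod.snd h) ⟨i, by omega⟩
    rw [coords_fst_apply] at h1
    rw [coords_snd_apply] at h2
    have h1' := (mul_eq_zero.1 h1).resolve_left
      (inv_ne_zero (weight_ne_zero hr hs (by simp; omega)))
    have h2' := (mul_eq_zero.1 h2).resolve_left
      (inv_ne_zero (weight_ne_zero hr (neg_ne_zero.2 hs) (by simp; omega)))
    exact Q.map_eq_zero_iff.1 (Prod.ext h1' h2')
  · intro h
    refine Prod.ext ?_ ?_ <;> ext i
    · rw [coords_fst_apply, h _ (by omega) (by omega), map_zero]; simp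
    · rw [coords_snd_apply, h _ (by omega) (by omega), map_zero]; simp

theorem exists_coords_eq (hp : ∀ m, 0 < m → m ≤ n → dunklCoeff (k (j + 1)) m ≠ 0)
    (hr : ∀ m, 0 < m → m ≤ n → dunklCoeff (k (j + 2)) m ≠ 0) (hs : s ≠ 0)
    (htd : t + d ≤ n) (u : (Fin (d + 1) → ℂ) × (Fin (d + 1) → ℂ)) :
    ∃ f : Monogenics k n, coords Q k n j s t d f = u ∧
      ∀ b < t, coef (expo j 0 (n - b) b) f.val = 0 := by
  obtain ⟨F, hF⟩ := exists_seq u.1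
  obtain ⟨G, hG⟩ := exists_seq u.2
  obtain ⟨f, hc⟩ : ∃ f : Monogenics k n, ∀ a b, coef (expo j 0 a b) f.val =
      if a + b = n ∧ t ≤ b then Q.symm (weight (k (j + 2)) n s b * F (b - t),
        weight (k (j + 2)) n (-s) b * G (b - t)) else 0 := by
    obtain ⟨f, hf, hc⟩ := exists_monogenic (k := k) j hp
      (c := fun a b => if a + b = n ∧ t ≤ b then Q.symm (weight (k (j + 2)) n s b * F (b - t),
        weight (k (j + 2)) n (-s) b * G (b - t)) else 0) (fun a b h => if_neg fun h' => h h'.1)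
    exact ⟨⟨f, hf⟩, hc⟩
  refine ⟨f, ?_, fun b hb => by rw [hc, if_neg (by omega)]⟩
  have key : ∀ i : Fin (d + 1), Q (coef (expo j 0 (n - (t + i)) (t + i)) f.val) =
      (weight (k (j + 2)) n s (t + i) * F i, weight (k (j + 2)) n (-s) (t + i) * G i) := by
    intro i
    rw [hc, if_pos ⟨by omega, by omega⟩, Q.apply_symm_apply, Nat.add_sub_cancel_left]
  refine Prod.ext ?_ ?_ <;> ext i
  · rw [coords_fst_apply, hF, key, inv_mul_cancel_left₀ (weight_ne_zero hr hs (by omega))]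
  · rw [coords_snd_apply, hG, key,
      inv_mul_cancel_left₀ (weight_ne_zero hr (neg_ne_zero.2 hs) (by omega))]

variable {T : Type*} [AddCommGroup T] [Module ℂ T] [Module BI T]

/-- Two vectors of coordinates as an element of the square of a module. -/
noncomputable def ofCoords (φ : T ≃ₗ[ℂ] (Fin (d + 1) → ℂ)) :
    ((Fin (d + 1) → ℂ) × (Fin (d + 1) → ℂ)) ≃ₗ[ℂ] T × T :=
  φ.symm.prodCongr φ.symm

theorem gen_smul_ofCoords {φ : T ≃ₗ[ℂ] (Fin (d + 1) → ℂ)} {A : Fin 3 → Module.End ℂ (Fin (d + 1) → ℂ)}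
    (hφ : ∀ i x, φ (BI.gen (i + (j + 2)) • x) = A i (φ x)) (i : Fin 3)
    (u : (Fin (d + 1) → ℂ) × (Fin (d + 1) → ℂ)) :
    BI.gen (i + (j + 2)) • ofCoords φ u = ofCoords φ (A i u.1, A i u.2) := by
  refine Prod.ext (φ.injective ?_) (φ.injective ?_)
  · change φ (BI.gen (i + (j + 2)) • φ.symm u.1) = φ (φ.symm (A i u.1))
    rw [hφ, φ.apply_symm_apply, φ.apply_symm_apply]
  · change φ (BI.gen (i + (j + 2)) • φ.symm u.2) = φ (φ.symm (A i u.2))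
    rw [hφ, φ.apply_symm_apply, φ.apply_symm_apply]

theorem fin_three_forall_add {p : Fin 3 → Prop} (m : Fin 3) (h : ∀ i, p (i + m)) (i : Fin 3) : p i := by
  simpa using h (i - m)

variable [IsScalarTower ℂ BI T]

/-- The quotient `M_n / M_n(x_j)`. -/
theorem nonempty_quotient_equiv (hp : ∀ m, 0 < m → m ≤ n → dunklCoeff (k (j + 1)) m ≠ 0)
    (hr : ∀ m, 0 < m → m ≤ n → dunklCoeff (k (j + 2)) m ≠ 0)
    (hn : Odd n) (ht : threshold (k j) = t) (htn : t ≤ n)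
    (hd : d + 1 = t) (φ : T ≃ₗ[ℂ] (Fin (d + 1) → ℂ))
    (hφ : ∀ i x, φ (BI.gen (i + (j + 2)) • x) = oddOp d (k (j + 1))
      (-k (j + 2) - k j - k (j + 1) - n - 1) (k (j + 2)) i (φ x)) :
    Nonempty ((Monogenics k n ⧸ monogenicsAt k n j) ≃ₗ[BI] T × T) := by
  obtain ⟨hto, htκ⟩ := (threshold_eq_coe_iff _ _).1 ht
  have hκ : 2 * (k j : ℂ) = -(d + 1) := by
    have : 2 * k j = -((d : ℝ) + 1) := by rw [htκ, ← hd]; push_cast; ring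
    exact_mod_cast this
  have hde : Even d := by
    rw [← hd, Nat.odd_add_one] at hto; exact Nat.not_odd_iff_even.1 hto
  obtain ⟨Q, hQ⟩ := exists_pauli_diag (j + 1)
  have hQ₁ : ∀ v, (LinearMap.fst ℂ ℂ ℂ ∘ₗ Q.toLinearMap) ((pauli (j + 1)).mulVec v) =
      1 * (LinearMap.fst ℂ ℂ ℂ ∘ₗ Q.toLinearMap) v :=
    fun v => (congrArg Prod.fst (hQ v)).trans (one_mul _).symm
  have hQ₂ : ∀ v, (LinearMap.snd ℂ ℂ ℂ ∘ₗ Q.toLinearMap) ((pauli (j + 1)).mulVec v) =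
      -1 * (LinearMap.snd ℂ ℂ ℂ ∘ₗ Q.toLinearMap) v :=
    fun v => (congrArg Prod.snd (hQ v)).trans (neg_one_mul _).symm
  have h1 : (1 : ℂ) ≠ 0 := one_ne_zero
  let L : Monogenics k n →ₗ[ℂ] T × T := (ofCoords φ).toLinearMap ∘ₗ coords Q k n j 1 0 d
  have hL : ∀ i f, L (BI.gen i • f) = BI.gen i • L f := by
    refine fin_three_forall_add (j + 2) fun i f => ?_
    change ofCoords φ _ = _ • ofCoords φ _
    rw [gen_smul_ofCoords hφ]
    congr 1
    have e : Monogenics.valHom k n (BI.gen (i + (j + 2)) • f) = genOp k (i + (j + 2)) f.val :=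
      Monogenics.gen_smul_val _ f
    refine Prod.ext ?_ ?_
    · change componentVec _ _ _ _ _ _ _ (Monogenics.valHom k n (BI.gen (i + (j + 2)) • f)) = _
      rw [e, componentVec_genOp_quotient hn f.val_mem hr hQ₁ (one_mul 1) hde
        (by omega) hκ]
      rfl
    · change componentVec _ _ _ _ _ _ _ (Monogenics.valHom k n (BI.gen (i + (j + 2)) • f)) = _
      rw [e, componentVec_genOp_quotient hn f.val_mem hr hQ₂ (by norm_num) hde
        (by omega) hκ]
      rfl
  have hsurj : Function.Surjective (BI.linearMapOfGen L hL) := fun x => by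
    obtain ⟨f, hf, -⟩ := exists_coords_eq Q hp hr h1 (t := 0) (d := d) (by omega)
      ((ofCoords φ).symm x)
    exact ⟨f, by change ofCoords φ (coords Q k n j 1 0 d f) = x; rw [hf]; simp⟩
  have hker : monogenicsAt k n j = LinearMap.ker (BI.linearMapOfGen L hL) := by
    ext f
    rw [mem_monogenicsAt_iff hp ht, LinearMap.mem_ker]
    change _ ↔ ofCoords φ (coords Q k n j 1 0 d f) = 0
    rw [LinearEquiv.map_eq_zero_iff, coords_eq_zero_iff Q hr h1 (by omega)]
    exact forall_congr' fun b => ⟨fun h _ hb => h (by omega), fun h hb => h (by omega) (by omega)⟩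
  exact ⟨(Submodule.quotEquivOfEq _ _ hker).trans
    ((BI.linearMapOfGen L hL).quotKerEquivOfSurjective hsurj)⟩

/-- The submodule `M_n(x_j)`. -/
theorem nonempty_monogenicsAt_equiv (hp : ∀ m, 0 < m → m ≤ n → dunklCoeff (k (j + 1)) m ≠ 0)
    (hr : ∀ m, 0 < m → m ≤ n → dunklCoeff (k (j + 2)) m ≠ 0)
    (hn : Odd n) (ht : threshold (k j) = t) (hd : d + t = n)
    (φ : T ≃ₗ[ℂ] (Fin (d + 1) → ℂ))
    (hφ : ∀ i x, φ (BI.gen (i + (j + 2)) • x) = ((![-1, -1, 1] i : ℂ) •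
      oddOp d (k (j + 1) + (n + 1) / 2) (-k (j + 2) - k j - k (j + 1) - (n + 1) / 2)
        (-k (j + 2) - (n + 1) / 2) i) (φ x)) :
    Nonempty (monogenicsAt k n j ≃ₗ[BI] T × T) := by
  obtain ⟨hto, htκ⟩ := (threshold_eq_coe_iff _ _).1 ht
  have hκ : 2 * (k j : ℂ) = -t := by exact_mod_cast htκ
  have hde : Even d := by
    rcases Nat.even_or_odd d with h | h
    · exact h
    · exact absurd (h.add_odd hto) (by rw [hd]; exact Nat.not_even_iff_odd.2 hn)
  obtain ⟨Q, hQ⟩ := exists_pauli_diag (j + 1)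
  have hQ₁ : ∀ v, (LinearMap.fst ℂ ℂ ℂ ∘ₗ Q.toLinearMap) ((pauli (j + 1)).mulVec v) =
      1 * (LinearMap.fst ℂ ℂ ℂ ∘ₗ Q.toLinearMap) v :=
    fun v => (congrArg Prod.fst (hQ v)).trans (one_mul _).symm
  have hQ₂ : ∀ v, (LinearMap.snd ℂ ℂ ℂ ∘ₗ Q.toLinearMap) ((pauli (j + 1)).mulVec v) =
      -1 * (LinearMap.snd ℂ ℂ ℂ ∘ₗ Q.toLinearMap) v :=
    fun v => (congrArg Prod.snd (hQ v)).trans (neg_one_mul _).symm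
  have h1 : (-1 : ℂ) ≠ 0 := neg_ne_zero.2 one_ne_zero
  have htpos := hto.pos
  let L : monogenicsAt k n j →ₗ[ℂ] T × T := ((ofCoords φ).toLinearMap ∘ₗ coords Q k n j (-1) t d) ∘ₗ
    ((monogenicsAt k n j).subtype.restrictScalars ℂ)
  have hL : ∀ i f, L (BI.gen i • f) = BI.gen i • L f := by
    refine fin_three_forall_add (j + 2) fun i f => ?_
    change ofCoords φ _ = _ • ofCoords φ _
    rw [gen_smul_ofCoords hφ]
    congr 1
    have e : Monogenics.valHom k n (BI.gen (i + (j + 2)) • f.1) = genOp k (i + (j + 2)) f.1.val :=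
      Monogenics.gen_smul_val _ f.1
    have h0 := (mem_monogenicsAt_iff hp ht f.1).1 f.2 (t - 1) (by omega)
    refine Prod.ext ?_ ?_
    · change componentVec _ _ _ _ _ _ _ (Monogenics.valHom k n (BI.gen (i + (j + 2)) • f.1)) = _
      rw [e, componentVec_genOp_sub (σ := 1) hn f.1.val_mem hr hQ₁ (one_mul 1)
        hde hto hd hκ (by rw [component_apply, h0, map_zero, mul_zero])]
      rfl
    · change componentVec _ _ _ _ _ _ _ (Monogenics.valHom k n (BI.gen (i + (j + 2)) • f.1)) = _
      rw [e, componentVec_genOp_sub (σ := -1) hn f.1.val_mem hr hQ₂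
        (by norm_num) hde hto hd hκ (by rw [component_apply, h0, map_zero, mul_zero])]
      rfl
  refine BI.nonempty_linearEquiv L hL ⟨?_, fun x => ?_⟩
  · refine (injective_iff_map_eq_zero L).2 fun f hf => Subtype.ext ?_
    replace hf : ofCoords φ (coords Q k n j (-1) t d f.1) = 0 := hf
    rw [LinearEquiv.map_eq_zero_iff, coords_eq_zero_iff Q hr h1 (by omega)] at hf
    refine Monogenics.eq_zero_of_restrict hp fun b hb => ?_
    rcases Nat.lt_or_ge b t with h | h
    · exact (mem_monogenicsAt_iff hp ht f.1).1 f.2 b h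
    · exact hf b h (by omega)
  · obtain ⟨f, hf, hf'⟩ := exists_coords_eq Q hp hr h1 (t := t) (d := d) (by omega)
      ((ofCoords φ).symm x)
    refine ⟨⟨f, (mem_monogenicsAt_iff hp ht f).2 hf'⟩, ?_⟩
    change ofCoords φ (coords Q k n j (-1) t d f) = x
    rw [hf]; simp

end MonogenicModules

section Twists

open Polynomial

variable {d n t : ℕ} {a b c s : ℂ} {g : BI ≃ₐ[ℂ] BI}

/-- The coordinates of a module `O_d(a,b,c)`. -/
noncomputable def oddCoords (hd : Even d) (a b c : ℂ) :
    OddModule d hd a b c ≃ₗ[ℂ] (Fin (d + 1) → ℂ) :=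
  LinearEquiv.refl ℂ (Fin (d + 1) → ℂ)

/-- The coordinates of a twisted module `O_d(a,b,c)`. -/
noncomputable def twistCoords (g : BI ≃ₐ[ℂ] BI) (hd : Even d) (a b c : ℂ) :
    Twist g (OddModule d hd a b c) ≃ₗ[ℂ] (Fin (d + 1) → ℂ) :=
  LinearEquiv.refl ℂ (Fin (d + 1) → ℂ)

theorem twistCoords_gen_smul (hd : Even d) {m i : Fin 3} (hg : g (BI.gen m) = s • BI.gen i)
    (x : Twist g (OddModule d hd a b c)) :
    twistCoords g hd a b c (BI.gen m • x) =
      (s • oddOp d a b c i) (twistCoords g hd a b c x) := by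
  have h : ∀ v : OddModule d hd a b c, g (BI.gen m) • v = s • oddOp d a b c i v := by
    intro v
    rw [hg, smul_assoc, OddModule.gen_smul_eq]
    rfl
  exact h x

theorem prod_oddTheta_sign (hd : Even d) (hs : s = 1 ∨ s = -1) (a : ℂ) :
    ∏ i ∈ Finset.range (d + 1), (X - C (s * oddTheta d (s * a) i)) = oddPoly d a := by
  rcases hs with rfl | rfl
  · simp [oddPoly]
  · have := oddPoly_neg hd (-a)
    rw [neg_neg] at this
    simp [this]

theorem sign_vec (hs : s = 1 ∨ s = -1) :
    (∀ i : Fin 3, (![s, s, 1] (i + 1) * ![s, s, 1] (i + 2) : ℂ) = ![s, s, 1] i) ∧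
      ∀ i : Fin 3, (![s, s, 1] i * ![s, s, 1] i : ℂ) = 1 := by
  rcases hs with rfl | rfl <;> constructor <;> intro i <;> fin_cases i <;> simp

theorem IsOddRegular.nonempty_equiv_twist_sign (hd : Even d) (h : IsOddRegular d a b c)
    (hs : s = 1 ∨ s = -1) (hg : ∀ i, g (BI.gen i) = (![s, s, 1] i : ℂ) • BI.gen i) {a' b' : ℂ}
    (ha : a' = s * a) (hb : b' = s * b) :
    Nonempty (Twist g (OddModule d hd a b c) ≃ₗ[BI] OddModule d hd a' b' c) := by
  subst ha hb
  have hs2 : s * s = 1 := by rcases hs with rfl | rfl <;> norm_num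
  refine h.nonempty_equiv_twist hd (σ := ![s, s, 1]) (τ := id) 0 hg (by simp) (sign_vec hs).1
    (sign_vec hs).2 ?_ ?_ ?_
  · intro i
    rw [add_zero]
    fin_cases i
    · change s * (2 * (s * b) * c - s * a * (d + 1)) = 2 * b * c - a * (d + 1)
      linear_combination (2 * b * c - a * (d + 1)) * hs2
    · change s * (2 * c * (s * a) - s * b * (d + 1)) = 2 * c * a - b * (d + 1)
      linear_combination (2 * c * a - b * (d + 1)) * hs2
    · change 1 * (2 * (s * a) * (s * b) - c * (d + 1)) = 2 * a * b - c * (d + 1)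
      linear_combination (2 * a * b) * hs2
  · exact (charpoly_smul_oddOp_zero d _ _ _ s).trans (prod_oddTheta_sign hd hs a)
  · exact (charpoly_smul_oddOp_one d _ _ _ s).trans (prod_oddTheta_sign hd hs b)

theorem IsOddRegular.nonempty_equiv_twist_cycle (hd : Even d) (h : IsOddRegular d a b c)
    (hs : s = 1 ∨ s = -1)
    (hg : ∀ i, g (BI.gen i) = (![s, s, 1] (i + 2) : ℂ) • BI.gen (i + 2)) {b' c' : ℂ}
    (ha : b' = s * a) (hb : c' = s * b) (hne : ∀ i ≤ d, Even i → 2 * b' + i + 1 ≠ 0) :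
    Nonempty (Twist g (OddModule d hd a b c) ≃ₗ[BI] OddModule d hd c b' c') := by
  subst ha hb
  have hs2 : s * s = 1 := by rcases hs with rfl | rfl <;> norm_num
  refine h.nonempty_equiv_twist hd (σ := ![s, s, 1]) (τ := fun i => i + 2) 1 hg (by decide)
    (sign_vec hs).1 (sign_vec hs).2 ?_ ?_ ?_
  · intro i
    fin_cases i
    · change s * (2 * (s * b) * c - s * a * (d + 1)) = 2 * b * c - a * (d + 1)
      linear_combination (2 * b * c - a * (d + 1)) * hs2
    · change s * (2 * c * (s * a) - s * b * (d + 1)) = 2 * c * a - b * (d + 1)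
      linear_combination (2 * c * a - b * (d + 1)) * hs2
    · change 1 * (2 * (s * a) * (s * b) - c * (d + 1)) = 2 * a * b - c * (d + 1)
      linear_combination (2 * a * b) * hs2
  · exact (charpoly_smul_oddOp_one d _ _ _ s).trans (prod_oddTheta_sign hd hs a)
  · exact (charpoly_smul_oddOp_two hd hne s).trans (prod_oddTheta_sign hd hs b)

theorem IsOddRegular.nonempty_equiv_twist_cycle_symm (hd : Even d) (h : IsOddRegular d a b c)
    (hs : s = 1 ∨ s = -1)
    (hg : ∀ i, g (BI.gen i) = (![s, s, 1] (i + 1) : ℂ) • BI.gen (i + 1)) {a' c' : ℂ}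
    (ha : c' = s * a) (hb : a' = s * b) (hne : ∀ i ≤ d, Even i → 2 * c + i + 1 ≠ 0) :
    Nonempty (Twist g (OddModule d hd a b c) ≃ₗ[BI] OddModule d hd a' c c') := by
  subst ha hb
  have hs2 : s * s = 1 := by rcases hs with rfl | rfl <;> norm_num
  refine h.nonempty_equiv_twist hd (σ := ![s, s, 1]) (τ := fun i => i + 1) 2 hg (by decide)
    (sign_vec hs).1 (sign_vec hs).2 ?_ ?_ ?_
  · intro i
    fin_cases i
    · change s * (2 * (s * b) * c - s * a * (d + 1)) = 2 * b * c - a * (d + 1)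
      linear_combination (2 * b * c - a * (d + 1)) * hs2
    · change s * (2 * c * (s * a) - s * b * (d + 1)) = 2 * c * a - b * (d + 1)
      linear_combination (2 * c * a - b * (d + 1)) * hs2
    · change 1 * (2 * (s * a) * (s * b) - c * (d + 1)) = 2 * a * b - c * (d + 1)
      linear_combination (2 * a * b) * hs2
  · exact (charpoly_smul_oddOp_two hd hne s).trans (prod_oddTheta_sign hd hs a)
  · exact (charpoly_smul_oddOp_zero d _ _ _ s).trans (prod_oddTheta_sign hd hs b)

variable {p r κ : ℝ}

theorem isOddRegular_sub (hp : 0 ≤ p) (hr : 0 ≤ r) (ht : 0 < t) (hd : d + t = n)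
    (hκ : 2 * κ = -t) (ha : a = p + (n + 1) / 2) (hb : b = -r - κ - p - (n + 1) / 2)
    (hc : c = -r - (n + 1) / 2) : IsOddRegular d a b c := by
  have hd' : (d : ℝ) + t = n := by exact_mod_cast hd
  have ht' : (0 : ℝ) < t := by exact_mod_cast ht
  refine ⟨p + (n + 1) / 2, -r - κ - p - (n + 1) / 2, -r - (n + 1) / 2, by rw [ha]; push_cast; rfl,
    by rw [hb]; push_cast; rfl, by rw [hc]; push_cast; rfl, ?_, Or.inr ?_⟩
  · rw [abs_lt]; constructor <;> linarith
  · rw [lt_abs]; left; linarith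

theorem isOddRegular_quotient (hp : 0 ≤ p) (hr : 0 ≤ r) (htn : t ≤ n) (hd : d + 1 = t)
    (hκ : 2 * κ = -t) (ha : a = p) (hb : b = -r - κ - p - n - 1) (hc : c = r) :
    IsOddRegular d a b c := by
  have hd' : (d : ℝ) + 1 = t := by exact_mod_cast hd
  have ht' : (t : ℝ) ≤ n := by exact_mod_cast htn
  refine ⟨p, -r - κ - p - n - 1, r, ha, by rw [hb]; push_cast; rfl, hc, ?_, Or.inl ?_⟩
  · rw [abs_lt]; constructor <;> linarith
  · rw [abs_lt]; constructor <;> linarith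

theorem two_mul_add_ne_zero (hp : 0 ≤ p) (i : ℕ) : 2 * (p : ℂ) + i + 1 ≠ 0 := by
  have : (2 * p + i + 1 : ℝ) ≠ 0 := by positivity
  exact_mod_cast this

theorem two_mul_sub_add_ne_zero (hp : 0 ≤ p) {i : ℕ} (hi : i < n) :
    2 * (-p - (n + 1) / 2 : ℂ) + i + 1 ≠ 0 := by
  have hi' : (i : ℝ) < n := by exact_mod_cast hi
  have : (2 * (-p - (n + 1) / 2) + i + 1 : ℝ) ≠ 0 := by
    have : (2 * (-p - (n + 1) / 2) + i + 1 : ℝ) < 0 := by linarith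
    exact this.ne
  have h := Complex.ofReal_ne_zero.2 this
  push_cast at h
  exact h

variable {k : Fin 3 → ℝ} {j : Fin 3}

theorem nonempty_monogenicsAt_equiv_twist (hn : Odd n) (ht : threshold (k j) = t) (htn : t ≤ n)
    (hp : (n : ℕ∞) < threshold (k (j + 1))) (hr : (n : ℕ∞) < threshold (k (j + 2)))
    (hg : ∀ i, g (BI.gen (i + (j + 2))) = (![-1, -1, 1] i : ℂ) • BI.gen i) (hd : Even (n - t))
    (ha : a = k (j + 1) + (n + 1) / 2)
    (hb : b = -k (j + 2) - k j - k (j + 1) - (n + 1) / 2) (hc : c = -k (j + 2) - (n + 1) / 2) :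
    Nonempty (monogenicsAt k n j ≃ₗ[BI]
      Twist g (OddModule (n - t) hd a b c) × Twist g (OddModule (n - t) hd a b c)) := by
  subst ha hb hc
  exact nonempty_monogenicsAt_equiv (dunklCoeff_ne_zero hp) (dunklCoeff_ne_zero hr) hn ht
    (Nat.sub_add_cancel htn) (twistCoords g hd _ _ _) fun i x => twistCoords_gen_smul hd (hg i) x

theorem nonempty_quotient_equiv_twist (hn : Odd n) (ht : threshold (k j) = t) (htn : t ≤ n)
    (hp : (n : ℕ∞) < threshold (k (j + 1))) (hr : (n : ℕ∞) < threshold (k (j + 2)))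
    (hg : ∀ i, g (BI.gen (i + (j + 2))) = BI.gen i) (hd : Even (t - 1))
    (ha : a = k (j + 1)) (hb : b = -k (j + 2) - k j - k (j + 1) - n - 1) (hc : c = k (j + 2)) :
    Nonempty ((Monogenics k n ⧸ monogenicsAt k n j) ≃ₗ[BI]
      Twist g (OddModule (t - 1) hd a b c) × Twist g (OddModule (t - 1) hd a b c)) := by
  subst ha hb hc
  have ht0 := ((threshold_eq_coe_iff _ _).1 ht).1.pos
  refine nonempty_quotient_equiv (dunklCoeff_ne_zero hp) (dunklCoeff_ne_zero hr) hn ht htn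
    (by omega) (twistCoords g hd _ _ _) fun i x => ?_
  rw [twistCoords_gen_smul (s := 1) hd (by rw [hg, one_smul]) x, one_smul]

theorem signs_neg (i : Fin 3) :
    (((BI.signs (-1, -1) i : ℤ)) : ℂ) = (![-1, -1, 1] : Fin 3 → ℂ) i := by
  fin_cases i <;> simp [BI.signs]

end Twists

end BannaiIto

theorem theorem7p2 (k₁ k₂ k₃ : ℝ) (n : ℕ) (hn : Odd n) :
    -- the case `t₂ ≤ n < min {t₁, t₃}`
    (∀ (t₂ : ℕ) (ht₂ : BannaiIto.threshold k₂ = t₂), t₂ ≤ n →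
      (n : ℕ∞) < min (BannaiIto.threshold k₁) (BannaiIto.threshold k₃) →
      let V := BannaiIto.Twist (BannaiIto.BI.signAut (-1, -1))
        (BannaiIto.OddModule (n - t₂) (BannaiIto.even_sub_of_threshold ht₂ hn)
          (k₃ + (n + 1) / 2) (-k₁ - k₂ - k₃ - (n + 1) / 2) (-k₁ - (n + 1) / 2))
      let W := BannaiIto.OddModule (t₂ - 1) (BannaiIto.even_pred_of_threshold ht₂)
        k₃ (-k₁ - k₂ - k₃ - n - 1) k₁
      Nonempty (BannaiIto.monogenicsAt ![k₁, k₂, k₃] n 1 ≃ₗ[BannaiIto.BI] V × V) ∧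
      Nonempty ((BannaiIto.Monogenics ![k₁, k₂, k₃] n ⧸ BannaiIto.monogenicsAt ![k₁, k₂, k₃] n 1)
        ≃ₗ[BannaiIto.BI] W × W) ∧
      (0 ≤ k₁ → 0 ≤ k₃ →
        IsSimpleModule BannaiIto.BI V ∧ IsSimpleModule BannaiIto.BI W ∧
        Nonempty (V ≃ₗ[BannaiIto.BI]
          BannaiIto.OddModule (n - t₂) (BannaiIto.even_sub_of_threshold ht₂ hn)
            (-k₃ - (n + 1) / 2) (k₁ + k₂ + k₃ + (n + 1) / 2) (-k₁ - (n + 1) / 2)))) ∧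
    -- the case `t₃ ≤ n < min {t₁, t₂}`; here `(1 3 2)` is the cycle `1 ↦ 3 ↦ 2 ↦ 1`
    (∀ (t₃ : ℕ) (ht₃ : BannaiIto.threshold k₃ = t₃), t₃ ≤ n →
      (n : ℕ∞) < min (BannaiIto.threshold k₁) (BannaiIto.threshold k₂) →
      let V := BannaiIto.Twist (BannaiIto.BI.aut (-1, -1) (List.formPerm [0, 2, 1]))
        (BannaiIto.OddModule (n - t₃) (BannaiIto.even_sub_of_threshold ht₃ hn)
          (k₁ + (n + 1) / 2) (-k₁ - k₂ - k₃ - (n + 1) / 2) (-k₂ - (n + 1) / 2))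
      let W := BannaiIto.Twist (BannaiIto.BI.permAut (List.formPerm [0, 2, 1]))
        (BannaiIto.OddModule (t₃ - 1) (BannaiIto.even_pred_of_threshold ht₃)
          k₁ (-k₁ - k₂ - k₃ - n - 1) k₂)
      Nonempty (BannaiIto.monogenicsAt ![k₁, k₂, k₃] n 2 ≃ₗ[BannaiIto.BI] V × V) ∧
      Nonempty ((BannaiIto.Monogenics ![k₁, k₂, k₃] n ⧸ BannaiIto.monogenicsAt ![k₁, k₂, k₃] n 2)
        ≃ₗ[BannaiIto.BI] W × W) ∧
      (0 ≤ k₁ → 0 ≤ k₂ →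
        IsSimpleModule BannaiIto.BI V ∧ IsSimpleModule BannaiIto.BI W ∧
        Nonempty (V ≃ₗ[BannaiIto.BI]
          BannaiIto.OddModule (n - t₃) (BannaiIto.even_sub_of_threshold ht₃ hn)
            (-k₂ - (n + 1) / 2) (-k₁ - (n + 1) / 2) (k₁ + k₂ + k₃ + (n + 1) / 2)) ∧
        Nonempty (W ≃ₗ[BannaiIto.BI]
          BannaiIto.OddModule (t₃ - 1) (BannaiIto.even_pred_of_threshold ht₃)
            k₂ k₁ (-k₁ - k₂ - k₃ - n - 1)))) ∧
    -- the case `t₁ ≤ n < min {t₂, t₃}`; here `(1 2 3)` is the cycle `1 ↦ 2 ↦ 3 ↦ 1`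
    (∀ (t₁ : ℕ) (ht₁ : BannaiIto.threshold k₁ = t₁), t₁ ≤ n →
      (n : ℕ∞) < min (BannaiIto.threshold k₂) (BannaiIto.threshold k₃) →
      let V := BannaiIto.Twist (BannaiIto.BI.aut (-1, -1) (List.formPerm [0, 1, 2]))
        (BannaiIto.OddModule (n - t₁) (BannaiIto.even_sub_of_threshold ht₁ hn)
          (k₂ + (n + 1) / 2) (-k₁ - k₂ - k₃ - (n + 1) / 2) (-k₃ - (n + 1) / 2))
      let W := BannaiIto.Twist (BannaiIto.BI.permAut (List.formPerm [0, 1, 2]))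
        (BannaiIto.OddModule (t₁ - 1) (BannaiIto.even_pred_of_threshold ht₁)
          k₂ (-k₁ - k₂ - k₃ - n - 1) k₃)
      Nonempty (BannaiIto.monogenicsAt ![k₁, k₂, k₃] n 0 ≃ₗ[BannaiIto.BI] V × V) ∧
      Nonempty ((BannaiIto.Monogenics ![k₁, k₂, k₃] n ⧸ BannaiIto.monogenicsAt ![k₁, k₂, k₃] n 0)
        ≃ₗ[BannaiIto.BI] W × W) ∧
      (0 ≤ k₂ → 0 ≤ k₃ →
        IsSimpleModule BannaiIto.BI V ∧ IsSimpleModule BannaiIto.BI W ∧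
        Nonempty (V ≃ₗ[BannaiIto.BI]
          BannaiIto.OddModule (n - t₁) (BannaiIto.even_sub_of_threshold ht₁ hn)
            (k₁ + k₂ + k₃ + (n + 1) / 2) (-k₃ - (n + 1) / 2) (-k₂ - (n + 1) / 2)) ∧
        Nonempty (W ≃ₗ[BannaiIto.BI]
          BannaiIto.OddModule (t₁ - 1) (BannaiIto.even_pred_of_threshold ht₁)
            (-k₁ - k₂ - k₃ - n - 1) k₃ k₂))) := by
  have hI : (-1 : ℂ) = 1 ∨ (-1 : ℂ) = -1 := Or.inr rfl
  have hU : (1 : ℂ) = 1 ∨ (1 : ℂ) = -1 := Or.inl rfl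
  have ones : ∀ i : Fin 3, (![1, 1, 1] : Fin 3 → ℂ) i = 1 := by
    intro i; fin_cases i <;> rfl
  refine ⟨fun t ht htn hlt => ?_, fun t ht htn hlt => ?_, fun t ht htn hlt => ?_⟩
  · obtain ⟨hto, hκ⟩ := (BannaiIto.threshold_eq_coe_iff _ _).1 ht
    have ht0 := hto.pos
    obtain ⟨h1, h3⟩ := lt_min_iff.1 hlt
    have hg : ∀ i, BannaiIto.BI.signAut (-1, -1) (BannaiIto.BI.gen i) =
        (![-1, -1, 1] i : ℂ) • BannaiIto.BI.gen i := fun i => by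
      rw [BannaiIto.BI.signAut_gen, BannaiIto.signs_neg]
    have hi : ∀ i : Fin 3, i + (1 + 2) = i := by decide
    refine ⟨BannaiIto.nonempty_monogenicsAt_equiv_twist (k := ![k₁, k₂, k₃]) (j := 1) hn ht htn h3 h1
      (fun i => by rw [hi, hg]) _ rfl rfl rfl, ?_, fun p1 p3 => ?_⟩
    · exact BannaiIto.nonempty_quotient_equiv (k := ![k₁, k₂, k₃]) (j := 1)
        (BannaiIto.dunklCoeff_ne_zero h3) (BannaiIto.dunklCoeff_ne_zero h1) hn ht htn
        (Nat.sub_add_cancel ht0) (BannaiIto.oddCoords _ _ _ _)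
        (fun i x => by rw [hi]; exact BannaiIto.OddModule.gen_smul_eq _ i x)
    · have hV : BannaiIto.IsOddRegular (n - t) (k₃ + (n + 1) / 2)
          (-k₁ - k₂ - k₃ - (n + 1) / 2) (-k₁ - (n + 1) / 2) :=
        BannaiIto.isOddRegular_sub p3 p1 ht0 (Nat.sub_add_cancel htn) hκ rfl rfl rfl
      have hW : BannaiIto.IsOddRegular (t - 1) k₃ (-k₁ - k₂ - k₃ - n - 1) k₁ :=
        BannaiIto.isOddRegular_quotient p3 p1 htn (Nat.sub_add_cancel ht0) hκ rfl rfl rfl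
      have := hV.isSimpleModule (BannaiIto.even_sub_of_threshold ht hn)
      exact ⟨BannaiIto.Twist.isSimpleModule _ _, hW.isSimpleModule _,
        hV.nonempty_equiv_twist_sign _ hI hg (by ring) (by ring)⟩
  · obtain ⟨hto, hκ⟩ := (BannaiIto.threshold_eq_coe_iff _ _).1 ht
    have ht0 := hto.pos
    obtain ⟨h1, h2⟩ := lt_min_iff.1 hlt
    have hτ : ∀ i : Fin 3, (List.formPerm [0, 2, 1] : Equiv.Perm (Fin 3)) i = i + 2 := by decide
    have hg : ∀ i, BannaiIto.BI.aut (-1, -1) (List.formPerm [0, 2, 1]) (BannaiIto.BI.gen i) =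
        (![-1, -1, 1] (i + 2) : ℂ) • BannaiIto.BI.gen (i + 2) := fun i => by
      rw [BannaiIto.BI.aut_gen, BannaiIto.signs_neg, hτ]
    have hg' : ∀ i, BannaiIto.BI.permAut (List.formPerm [0, 2, 1]) (BannaiIto.BI.gen i) =
        BannaiIto.BI.gen (i + 2) := fun i => by rw [BannaiIto.BI.permAut_gen, hτ]
    have hi : ∀ i : Fin 3, i + (2 + 2) + 2 = i := by decide
    refine ⟨BannaiIto.nonempty_monogenicsAt_equiv_twist (k := ![k₁, k₂, k₃]) (j := 2) hn ht htn h1 h2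
      (fun i => by rw [hg, hi]) _ rfl ?_ rfl, BannaiIto.nonempty_quotient_equiv_twist
      (k := ![k₁, k₂, k₃]) (j := 2) hn ht htn h1 h2 (fun i => by rw [hg', hi]) _ rfl ?_ rfl,
      fun p1 p2 => ?_⟩
    · change (_ : ℂ) = -k₂ - k₃ - k₁ - (n + 1) / 2; ring
    · change (_ : ℂ) = -k₂ - k₃ - k₁ - n - 1; ring
    · have hV : BannaiIto.IsOddRegular (n - t) (k₁ + (n + 1) / 2)
          (-k₁ - k₂ - k₃ - (n + 1) / 2) (-k₂ - (n + 1) / 2) :=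
        BannaiIto.isOddRegular_sub p1 p2 ht0 (Nat.sub_add_cancel htn) hκ rfl (by ring) rfl
      have hW : BannaiIto.IsOddRegular (t - 1) k₁ (-k₁ - k₂ - k₃ - n - 1) k₂ :=
        BannaiIto.isOddRegular_quotient p1 p2 htn (Nat.sub_add_cancel ht0) hκ rfl (by ring) rfl
      have := hV.isSimpleModule (BannaiIto.even_sub_of_threshold ht hn)
      have := hW.isSimpleModule (BannaiIto.even_pred_of_threshold ht)
      exact ⟨BannaiIto.Twist.isSimpleModule _ _, BannaiIto.Twist.isSimpleModule _ _,
        hV.nonempty_equiv_twist_cycle _ hI hg (by ring) (by ring)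
          fun i hi _ => BannaiIto.two_mul_sub_add_ne_zero p1 (by omega),
        hW.nonempty_equiv_twist_cycle _ hU (fun i => by rw [hg', ones, one_smul]) (by ring) (by ring)
          fun i _ _ => BannaiIto.two_mul_add_ne_zero p1 i⟩
  · obtain ⟨hto, hκ⟩ := (BannaiIto.threshold_eq_coe_iff _ _).1 ht
    have ht0 := hto.pos
    obtain ⟨h2, h3⟩ := lt_min_iff.1 hlt
    have hτ : ∀ i : Fin 3, (List.formPerm [0, 1, 2] : Equiv.Perm (Fin 3)) i = i + 1 := by decide
    have hg : ∀ i, BannaiIto.BI.aut (-1, -1) (List.formPerm [0, 1, 2]) (BannaiIto.BI.gen i) =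
        (![-1, -1, 1] (i + 1) : ℂ) • BannaiIto.BI.gen (i + 1) := fun i => by
      rw [BannaiIto.BI.aut_gen, BannaiIto.signs_neg, hτ]
    have hg' : ∀ i, BannaiIto.BI.permAut (List.formPerm [0, 1, 2]) (BannaiIto.BI.gen i) =
        BannaiIto.BI.gen (i + 1) := fun i => by rw [BannaiIto.BI.permAut_gen, hτ]
    have hi : ∀ i : Fin 3, i + (0 + 2) + 1 = i := by decide
    refine ⟨BannaiIto.nonempty_monogenicsAt_equiv_twist (k := ![k₁, k₂, k₃]) (j := 0) hn ht htn h2 h3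
      (fun i => by rw [hg, hi]) _ rfl ?_ rfl, BannaiIto.nonempty_quotient_equiv_twist
      (k := ![k₁, k₂, k₃]) (j := 0) hn ht htn h2 h3 (fun i => by rw [hg', hi]) _ rfl ?_ rfl,
      fun p2 p3 => ?_⟩
    · change (_ : ℂ) = -k₃ - k₁ - k₂ - (n + 1) / 2; ring
    · change (_ : ℂ) = -k₃ - k₁ - k₂ - n - 1; ring
    · have hV : BannaiIto.IsOddRegular (n - t) (k₂ + (n + 1) / 2)
          (-k₁ - k₂ - k₃ - (n + 1) / 2) (-k₃ - (n + 1) / 2) :=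
        BannaiIto.isOddRegular_sub p2 p3 ht0 (Nat.sub_add_cancel htn) hκ rfl (by ring) rfl
      have hW : BannaiIto.IsOddRegular (t - 1) k₂ (-k₁ - k₂ - k₃ - n - 1) k₃ :=
        BannaiIto.isOddRegular_quotient p2 p3 htn (Nat.sub_add_cancel ht0) hκ rfl (by ring) rfl
      have := hV.isSimpleModule (BannaiIto.even_sub_of_threshold ht hn)
      have := hW.isSimpleModule (BannaiIto.even_pred_of_threshold ht)
      exact ⟨BannaiIto.Twist.isSimpleModule _ _, BannaiIto.Twist.isSimpleModule _ _,
        hV.nonempty_equiv_twist_cycle_symm _ hI hg (by ring) (by ring)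
          fun i hi _ => BannaiIto.two_mul_sub_add_ne_zero p3 (by omega),
        hW.nonempty_equiv_twist_cycle_symm _ hU (fun i => by rw [hg', ones, one_smul]) (by ring)
          (by ring) fun i _ _ => BannaiIto.two_mul_add_ne_zero p3 i⟩
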